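/- **Theorem (Convergence of the transmission coefficient).** *Norms.* For $\beta>0$ and $n\ge 0$ let $|g|_{W^{n,\infty}_\beta}=\sum_{l=0}^n \operatorname{ess\,sup}_{x\in\mathbb R} e^{\beta|x|}\,|\partial^l g(x)|$ (weak derivatives). *Potentials.* Fix constants $\theta>0$, $\beta>0$. Let $$V(x,y)=q_{\rm av}(x)+q(x,y)=q_{\rm av}(x)+\sum_{j\in\mathbb Z\setminus\{0\}} q_j(x)\,e^{2\pi i\lambda_j y}$$ be real-valued (for almost every $x$ and all $y\in\mathbb R$), with real frequencies satisfying $|\lambda_j-\lambda_l|\ge\theta$ for $j\neq l$ and $|\lambda_j|\ge\theta$ for all $j$, and with $$\|V\|:=|q_{\rm av}|_{W^{1,\infty}_\beta}+\sum_{j\ne 0}|q_j|_{W^{3,\infty}_\beta}<\infty .$$ Put, for real $\epsilon\neq0$, $q_\epsilon(x)=q(x,x/\epsilon)$ and $\sigma^\epsilon_{\rm eff}(x)=-\epsilon^2\Lambda_{\rm eff}(x)$, where $$\Lambda_{\rm eff}(x)=\frac1{(2\pi)^2}\sum_{j\neq0}\frac{|q_j(x)|^2}{\lambda_j^2}.$$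 *Transmission coefficient.* For a potential $U$ with $\operatorname{ess\,sup}_x e^{\beta|x|}|U(x)|<\infty$ and $|\operatorname{Im}k|<\beta/2$, let $f^U_\pm(x;k)$ be the Jost solutions, i.e. the unique continuous solutions with $f^U_\pm(x;k)\sim e^{\pm ikx}$ as $x\to\pm\infty$ of $$f^U_+(x;k)=e^{ikx}+\int_x^\infty \tfrac{\sin(k(y-x))}{k}U(y)f^U_+(y;k)\,dy,\qquad f^U_-(x;k)=e^{-ikx}-\int_{-\infty}^x \tfrac{\sin(k(y-x))}{k}U(y)f^U_-(y;k)\,dy$$ (with $\sin(kz)/k:=z$ at $k=0$). The transmission coefficient $t^U(k)$ is defined, for $k\ne0$, by the relation $$f^U_+(x;k)=\frac{r^U(k)}{t^U(k)}f^U_-(x;k)+\frac1{t^U(k)}f^U_-(x;-k)\qquad(x\in\mathbb R);$$ at $k=0$, $t^U(k)$ and the quotient $k/t^U(k)$ are understood as limits, and $k/t^U(k)=0$ at a pole $k \neq 0$ of $t^U$. *Wave numbers.* Fix $0<\alpha<\beta/2$. Let $K\subset\{k\in\mathbb C:|\operatorname{Im}k|<\alpha\}$ be compact and contain no pole of $t^{q_{\rm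 av}}$, and put $M_K=\max\bigl(1,\sup_{k\in K}|t^{q_{\rm av}}(k)|\bigr)$. *Conclusion.* For all such $V$ and $K$ there is $\epsilon_0>0$ such that for every real $\epsilon$ with $0<|\epsilon|<\epsilon_0$, $$\sup_{k\in K}\left|\frac{k}{t^{q_{\rm av}+\sigma^\epsilon_{\rm eff}}(k)}-\frac{k}{t^{q_{\rm av}+q_\epsilon}(k)}\right|\le|\epsilon|^3\,M_K\,C\Bigl(\|V\|,\sup_{k\in K}|k|\Bigr),$$ where, for the fixed constants $\theta,\beta,\alpha$, the quantity $C$ depends only on $\|V\|$ and $\sup_{k\in K}|k|$; in particular it does not depend on $\epsilon$. -/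

import Mathlib

open MeasureTheory Filter Topology
open scoped ContDiff ENNReal

noncomputable section

namespace Scattering

/-! ### Exponentially weighted Sobolev spaces on the line -/

/-- `v` is the weak derivative of order `n` of `g` on the real line. -/
def HasWeakDeriv (n : ℕ) (g v : ℝ → ℂ) : Prop :=
  LocallyIntegrable g volume ∧ LocallyIntegrable v volume ∧
    ∀ φ : ℝ → ℝ, ContDiff ℝ ∞ φ → HasCompactSupport φ →
      ∫ x, ((iteratedDeriv n φ x : ℝ) : ℂ) * g x = (-1) ^ n * ∫ x, ((φ x : ℝ) : ℂ) * v x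

/-- The norm of `L^∞_β`, namely `ess sup_x e^{β|x|} |g x|`. -/
def weightedSupNorm (β : ℝ) (g : ℝ → ℂ) : ℝ≥0∞ :=
  eLpNorm (fun x => (Real.exp (β * |x|) : ℂ) * g x) ⊤ volume

/-- The norm of `W^{n,∞}_β`: the sum over `l ≤ n` of the `L^∞_β` norms of the weak derivatives of
order `l`. Weak derivatives are unique almost everywhere, so the infimum ranges over families with
one and the same value; it is `⊤` when some weak derivative does not exist. -/
def weightedSobolevNorm (β : ℝ) (n : ℕ) (g : ℝ → ℂ) : ℝ≥0∞ :=
  ⨅ (D : ℕ → ℝ → ℂ) (_ : ∀ l ∈ Finset.range (n + 1), HasWeakDeriv l g (D l)),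
    ∑ l ∈ Finset.range (n + 1), weightedSupNorm β (D l)

/-! ### Jost solutions and the transmission coefficient -/

/-- The kernel `sin (k z) / k`, with its continuous extension `z` at `k = 0`. -/
def sinKernel (k : ℂ) (z : ℝ) : ℂ :=
  if k = 0 then (z : ℂ) else Complex.sin (k * z) / k

/-- `f` is the Jost solution `f_+^V(·;k)`: `f(x) ~ e^{ikx}` as `x → ∞`, and
`f(x) = e^{ikx} + ∫_x^∞ (sin (k(y-x)) / k) V(y) f(y) dy`. -/
structure IsJostPlus (V : ℝ → ℂ) (k : ℂ) (f : ℝ → ℂ) : Prop where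
  continuous : Continuous f
  asymptotic : Tendsto (fun x : ℝ => f x * Complex.exp (-(Complex.I * k * x))) atTop (𝓝 1)
  integrable : ∀ x : ℝ,
    IntegrableOn (fun y => sinKernel k (y - x) * V y * f y) (Set.Ioi x) volume
  volterra : ∀ x : ℝ, f x = Complex.exp (Complex.I * k * x)
    + ∫ y in Set.Ioi x, sinKernel k (y - x) * V y * f y

/-- `f` is the Jost solution `f_-^V(·;k)`: `f(x) ~ e^{-ikx}` as `x → -∞`, and
`f(x) = e^{-ikx} - ∫_{-∞}^x (sin (k(y-x)) / k) V(y) f(y) dy`. -/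
structure IsJostMinus (V : ℝ → ℂ) (k : ℂ) (f : ℝ → ℂ) : Prop where
  continuous : Continuous f
  asymptotic : Tendsto (fun x : ℝ => f x * Complex.exp (Complex.I * k * x)) atBot (𝓝 1)
  integrable : ∀ x : ℝ,
    IntegrableOn (fun y => sinKernel k (y - x) * V y * f y) (Set.Iio x) volume
  volterra : ∀ x : ℝ, f x = Complex.exp (-(Complex.I * k * x))
    - ∫ y in Set.Iio x, sinKernel k (y - x) * V y * f y

/-- The Jost solution `f_+^V(·;k)`; it exists and is unique when `V ∈ L^∞_β`, `Im k > -β/2`. -/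
def jostPlus (V : ℝ → ℂ) (k : ℂ) : ℝ → ℂ := Classical.epsilon (IsJostPlus V k)

/-- The Jost solution `f_-^V(·;k)`; it exists and is unique when `V ∈ L^∞_β`, `Im k > -β/2`. -/
def jostMinus (V : ℝ → ℂ) (k : ℂ) : ℝ → ℂ := Classical.epsilon (IsJostMinus V k)

/-- `b = 1 / t^V(k)` in the scattering relation
`f_+(x;k) = (r(k)/t(k)) f_-(x;k) + (1/t(k)) f_-(x;-k)` for all `x`; here `a = r(k)/t(k)`. -/
def IsInvTransmission (V : ℝ → ℂ) (k b : ℂ) : Prop :=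
  ∃ a : ℂ, ∀ x : ℝ, jostPlus V k x = a * jostMinus V k x + b * jostMinus V (-k) x

/-- `1 / t^V(k)`, for `k ≠ 0`: there `f_-(·;k)` and `f_-(·;-k)` are linearly independent, so that
the coefficient is determined by the scattering relation. It vanishes at the poles of `t^V`. -/
def invTransmission (V : ℝ → ℂ) (k : ℂ) : ℂ := Classical.epsilon (IsInvTransmission V k)

/-- The transmission coefficient `t^V(k)`, extended to `k = 0` by its limit. -/
def transmission (V : ℝ → ℂ) (k : ℂ) : ℂ :=
  if k = 0 then limUnder (𝓝[≠] (0 : ℂ)) (fun z => 1 / invTransmission V z)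
  else 1 / invTransmission V k

/-- The quotient `k / t^V(k)`, extended to `k = 0` by its limit. (At a pole `k ≠ 0` of `t^V`, the
value is `0`, in accordance with `1 / ∞ = 0`.) -/
def kOverT (V : ℝ → ℂ) (k : ℂ) : ℂ :=
  if k = 0 then limUnder (𝓝[≠] (0 : ℂ)) (fun z => z / transmission V z)
  else k / transmission V k

/-- `k` is a pole of the (meromorphic) function `t`. -/
def IsPole (t : ℂ → ℂ) (k : ℂ) : Prop := Tendsto t (𝓝[≠] k) (Bornology.cobounded ℂ)

/-! ### Two-scale potentials -/

/-- The non-zero integers. -/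
abbrev NZ : Type := {j : ℤ // j ≠ 0}

/-- `V(x,y) = q_av(x) + ∑_{j ≠ 0} q_j(x) e^{2π i λ_j y}`. -/
def twoScale (qav : ℝ → ℂ) (q : NZ → ℝ → ℂ) (lam : NZ → ℝ) (x y : ℝ) : ℂ :=
  qav x + ∑' j, q j x * Complex.exp (2 * Real.pi * Complex.I * lam j * y)

/-- The potential `V_ε(x) = V(x, x/ε) = q_av(x) + q(x, x/ε)`. -/
def Veps (qav : ℝ → ℂ) (q : NZ → ℝ → ℂ) (lam : NZ → ℝ) (ε x : ℝ) : ℂ :=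
  twoScale qav q lam x (x / ε)

/-- `Λ_eff(x) = (2π)⁻² ∑_{j ≠ 0} |q_j(x)|² / λ_j²`. -/
def LambdaEff (q : NZ → ℝ → ℂ) (lam : NZ → ℝ) (x : ℝ) : ℝ :=
  1 / (2 * Real.pi) ^ 2 * ∑' j, ‖q j x‖ ^ 2 / lam j ^ 2

/-- The effective potential well `σ_eff^ε(x) = -ε² Λ_eff(x)`. -/
def sigmaEff (q : NZ → ℝ → ℂ) (lam : NZ → ℝ) (ε x : ℝ) : ℝ :=
  -ε ^ 2 * LambdaEff q lam x

/-- The effective potential `q_av + σ_eff^ε`. -/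
def Veff (qav : ℝ → ℂ) (q : NZ → ℝ → ℂ) (lam : NZ → ℝ) (ε x : ℝ) : ℂ :=
  qav x + (sigmaEff q lam ε x : ℂ)

/-- The norm of `V`: the `W^{1,∞}_β` norm of `q_av` plus the sum over `j ≠ 0` of the
`W^{3,∞}_β` norms of the `q_j`. -/
def tripleNorm (β : ℝ) (qav : ℝ → ℂ) (q : NZ → ℝ → ℂ) : ℝ≥0∞ :=
  weightedSobolevNorm β 1 qav + ∑' j, weightedSobolevNorm β 3 (q j)

/-- The hypotheses on `V`, with constants `θ` and `β`. -/
structure HypothesesV (θ β : ℝ) (qav : ℝ → ℂ) (q : NZ → ℝ → ℂ) (lam : NZ → ℝ) : Prop where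
  real_valued : ∀ᵐ x : ℝ, ∀ y : ℝ, (twoScale qav q lam x y).im = 0
  separated : ∀ j l : NZ, j ≠ l → θ ≤ |lam j - lam l|
  away_from_zero : ∀ j : NZ, θ ≤ |lam j|
  norm_finite : tripleNorm β qav q < ⊤

/-- The hypotheses on the set `K` of wave numbers, where `α` is the half-width of the strip. -/
structure HypothesesK (α : ℝ) (qav : ℝ → ℂ) (K : Set ℂ) : Prop where
  compact : IsCompact K
  strip : ∀ k ∈ K, |k.im| < α
  no_pole : ∀ k ∈ K, ¬ IsPole (transmission qav) k

/-- `M_K = max (1, sup_{k ∈ K} |t^{q_av}(k)|)`. -/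
def MK (qav : ℝ → ℂ) (K : Set ℂ) : ℝ :=
  max 1 (sSup ((fun k => ‖transmission qav k‖) '' K))

end Scattering

end

/-! The quotient `k/t^U(k)` is `i/2` times the Wronskian of the Jost solutions `f_+^U` and `f_-^U`
(`JostSetting.kOverT_eq`). The mixed Wronskian of `f_+^{U₁}` and `f_-^{U₂}` has derivative `(U₂ -
U₁) f_+^{U₁} f_-^{U₂}` and tends to the Wronskians of `U₁` and `U₂` at `-∞` and `+∞`. With `U₁ =
V_eff`, `U₂ = V_ε`, `u = f_+^{U₁}` and `v = f_-^{U₂}`, the difference to be estimated becomes `∫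
(V_ε - V_eff) u v` (`JostSetting.jostWronskian_sub`).

Put `ξ_j = 2πλ_j/ε`. Then `V_ε - V_eff` is the sum over `j` of `q_j e^{iξ_j x} + |q_j|²/ξ_j²`. Two
integrations by parts turn `∫ q_j u v e^{iξ_j x}` into `-ξ_j⁻² ∫ (q_j u v)'' e^{iξ_j x}`. The
equation `v'' = (V_ε - k²) v` makes `V_ε` reappear; being real, `V_ε` may be expanded in the
conjugate modes `conj q_l e^{-iξ_l x}`. The resonant mode `l = j` does not oscillate and produces
`|q_j|² u v`, which cancels the term of the effective potential exactly. All other terms either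
oscillate at a frequency of order at least `1/ε` against a Lipschitz function, which gains one power
of `ε`, or carry `σ_eff = O(ε²)`. With the prefactor `ξ_j⁻² = O(ε²)` this is `O(ε³)`
(`RegularTwoScale.norm_integral_mode_le`), summable in `j`.

The estimates are uniform in `ε` because `u, u', v, v'` are Lipschitz with constants that see only
the amplitude of the potentials, and uniform in `k` near `0` because the Wronskian never divides by
`k`. All growth and decay is tracked by weights `e^{±γ|x|}`, the Jost solutions being `O(e^{a|x|})`
for a fixed `a` between `α` and `β/2`. -/

noncomputable section

namespace Scattering

/-! ### Weighted Lipschitz functions -/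

/-- `F` is bounded by `L e^{-γ|x|}` and locally Lipschitz with constant `L e^{-γ|x|}`. -/
structure WeightedLipschitz (γ L : ℝ) (F : ℝ → ℂ) : Prop where
  bound : ∀ x, ‖F x‖ ≤ L * Real.exp (-γ * |x|)
  lip : ∀ x y, |x - y| ≤ 1 → ‖F x - F y‖ ≤ L * |x - y| * Real.exp (-γ * |x|)

/-- Weights at points at distance at most one are comparable. -/
lemma exp_weight_le (γ : ℝ) {x y : ℝ} (h : |x - y| ≤ 1) :
    Real.exp (-γ * |y|) ≤ Real.exp |γ| * Real.exp (-γ * |x|) := by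
  rw [← Real.exp_add]
  apply Real.exp_le_exp.2
  have h1 : γ * (|x| - |y|) ≤ |γ| * 1 := by
    calc γ * (|x| - |y|) ≤ |γ * (|x| - |y|)| := le_abs_self _
      _ = |γ| * |(|x| - |y|)| := abs_mul _ _
      _ ≤ |γ| * 1 := by
        gcongr
        exact (abs_abs_sub_abs_le_abs_sub x y).trans h
  linarith

lemma WeightedLipschitz.nonneg {γ L : ℝ} {F : ℝ → ℂ} (h : WeightedLipschitz γ L F) : 0 ≤ L := by
  have := (norm_nonneg _).trans (h.bound 0)
  simpa using this

lemma WeightedLipschitz.mono {γ L L' : ℝ} {F : ℝ → ℂ} (h : WeightedLipschitz γ L F)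
    (hL : L ≤ L') : WeightedLipschitz γ L' F :=
  ⟨fun x => (h.bound x).trans (by gcongr), fun x y hxy => (h.lip x y hxy).trans (by gcongr)⟩

lemma WeightedLipschitz.continuous {γ L : ℝ} {F : ℝ → ℂ} (h : WeightedLipschitz γ L F) :
    Continuous F := by
  rw [continuous_iff_continuousAt]
  intro x
  rw [ContinuousAt, tendsto_iff_norm_sub_tendsto_zero]
  have h1 : Tendsto (fun y => L * |x - y| * Real.exp (-γ * |x|)) (𝓝 x) (𝓝 0) := by
    have : Continuous (fun y => L * |x - y| * Real.exp (-γ * |x|)) := by fun_prop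
    simpa using this.tendsto x
  refine squeeze_zero' (Eventually.of_forall fun _ => norm_nonneg _) ?_ h1
  filter_upwards [Metric.ball_mem_nhds x one_pos] with y hy
  rw [norm_sub_rev]
  refine h.lip x y ?_
  rw [Metric.mem_ball, dist_comm, Real.dist_eq] at hy
  exact hy.le

lemma WeightedLipschitz.add {γ L₁ L₂ : ℝ} {F₁ F₂ : ℝ → ℂ} (h₁ : WeightedLipschitz γ L₁ F₁)
    (h₂ : WeightedLipschitz γ L₂ F₂) : WeightedLipschitz γ (L₁ + L₂) (fun x => F₁ x + F₂ x) := by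
  refine ⟨fun x => ?_, fun x y hxy => ?_⟩
  · refine (norm_add_le _ _).trans ?_
    linarith [h₁.bound x, h₂.bound x]
  · rw [add_sub_add_comm]
    refine (norm_add_le _ _).trans ?_
    linarith [h₁.lip x y hxy, h₂.lip x y hxy]

/-- Exponents add, and may be negative: Jost solutions enter with `γ = -a`, so that a coefficient
times two of them keeps the decay rate `β - 2a`. -/
lemma WeightedLipschitz.mul {γ₁ γ₂ L₁ L₂ : ℝ} {F₁ F₂ : ℝ → ℂ} (h₁ : WeightedLipschitz γ₁ L₁ F₁)
    (h₂ : WeightedLipschitz γ₂ L₂ F₂) :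
    WeightedLipschitz (γ₁ + γ₂) (3 * (L₁ * L₂)) (fun x => F₁ x * F₂ x) := by
  have n₁ := h₁.nonneg
  have n₂ := h₂.nonneg
  have he : ∀ x : ℝ, Real.exp (-(γ₁ + γ₂) * |x|) = Real.exp (-γ₁ * |x|) * Real.exp (-γ₂ * |x|) := by
    intro x
    rw [← Real.exp_add]
    congr 1
    ring
  refine ⟨fun x => ?_, fun x y hxy => ?_⟩
  · rw [norm_mul, he]
    calc ‖F₁ x‖ * ‖F₂ x‖ ≤ (L₁ * Real.exp (-γ₁ * |x|)) * (L₂ * Real.exp (-γ₂ * |x|)) := by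
          gcongr
          · exact h₁.bound x
          · exact h₂.bound x
      _ = 1 * (L₁ * L₂) * (Real.exp (-γ₁ * |x|) * Real.exp (-γ₂ * |x|)) := by ring
      _ ≤ _ := by gcongr; norm_num
  · rw [he]
    set a := Real.exp (-γ₁ * |x|)
    set b := Real.exp (-γ₂ * |x|)
    -- Values are taken at `x` only, so no weight at `y` appears; the quadratic remainder accounts
    -- for the third unit of the factor `3`.
    have e : F₁ x * F₂ x - F₁ y * F₂ y = (F₁ x - F₁ y) * F₂ x + F₁ x * (F₂ x - F₂ y)
        - (F₁ x - F₁ y) * (F₂ x - F₂ y) := by ring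
    rw [e]
    refine (norm_sub_le _ _).trans ((add_le_add_left (norm_add_le _ _) _).trans ?_)
    rw [norm_mul, norm_mul, norm_mul]
    have a0 : 0 ≤ a := (Real.exp_pos _).le
    have b0 : 0 ≤ b := (Real.exp_pos _).le
    have l₁ := h₁.lip x y hxy
    have l₂ := h₂.lip x y hxy
    have l₂' : ‖F₂ x - F₂ y‖ ≤ L₂ * 1 * b := l₂.trans (by gcongr)
    calc ‖F₁ x - F₁ y‖ * ‖F₂ x‖ + ‖F₁ x‖ * ‖F₂ x - F₂ y‖ + ‖F₁ x - F₁ y‖ * ‖F₂ x - F₂ y‖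
        ≤ (L₁ * |x - y| * a) * (L₂ * b) + (L₁ * a) * (L₂ * |x - y| * b)
          + (L₁ * |x - y| * a) * (L₂ * 1 * b) := by
          gcongr
          · exact h₂.bound x
          · exact h₁.bound x
      _ = 3 * (L₁ * L₂) * |x - y| * (a * b) := by ring

lemma WeightedLipschitz.const (c : ℂ) : WeightedLipschitz 0 ‖c‖ (fun _ => c) := by
  refine ⟨fun x => by simp, fun x y _ => ?_⟩
  simp only [sub_self, norm_zero]
  positivity

lemma WeightedLipschitz.star {γ L : ℝ} {F : ℝ → ℂ} (h : WeightedLipschitz γ L F) :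
    WeightedLipschitz γ L (fun x => (starRingEnd ℂ) (F x)) := by
  refine ⟨fun x => ?_, fun x y hxy => ?_⟩
  · rw [RCLike.norm_conj]; exact h.bound x
  · rw [← map_sub, RCLike.norm_conj]; exact h.lip x y hxy

/-- Mean value inequality on the segment; `e^{|γ|}` is the price of moving the weight by at most
one. -/
lemma WeightedLipschitz.of_hasDerivAt {γ L : ℝ} {F F' : ℝ → ℂ} (hF : ∀ x, HasDerivAt F (F' x) x)
    (hb : ∀ x, ‖F x‖ ≤ L * Real.exp (-γ * |x|)) (hb' : ∀ x, ‖F' x‖ ≤ L * Real.exp (-γ * |x|)) :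
    WeightedLipschitz γ (Real.exp |γ| * L) F := by
  have n : 0 ≤ L := by
    have := (norm_nonneg _).trans (hb 0)
    simpa using this
  have e1 : 1 ≤ Real.exp |γ| := Real.one_le_exp (abs_nonneg _)
  refine ⟨fun x => (hb x).trans ?_, fun x y hxy => ?_⟩
  · gcongr
    exact le_mul_of_one_le_left n e1
  · have key := (convex_uIcc x y).norm_image_sub_le_of_norm_hasDerivWithin_le
      (f := F) (f' := F') (C := L * (Real.exp |γ| * Real.exp (-γ * |x|)))
      (fun z _ => (hF z).hasDerivWithinAt) (fun z hz => (hb' z).trans (by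
        gcongr
        apply exp_weight_le
        refine le_trans ?_ hxy
        rw [abs_sub_comm x z, abs_sub_comm x y]
        exact Set.abs_sub_left_of_mem_uIcc hz)) (Set.right_mem_uIcc) (Set.left_mem_uIcc)
    refine key.trans (le_of_eq ?_)
    rw [Real.norm_eq_abs]
    ring

/-! ### Regular representatives of weakly differentiable functions -/

lemma forall_le_of_ae_le {f g : ℝ → ℝ} (hf : Continuous f) (hg : Continuous g)
    (h : ∀ᵐ x, f x ≤ g x) (x : ℝ) : f x ≤ g x := by
  have hd : Dense {x | f x ≤ g x} := Measure.dense_of_ae h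
  have hc : IsClosed {x | f x ≤ g x} := isClosed_le hf hg
  have : x ∈ closure {x | f x ≤ g x} := hd x
  rwa [hc.closure_eq] at this

/-- A function with an essentially bounded weak derivative is the integral of that derivative. -/
lemma ae_eq_integral_of_weakDeriv {D v : ℝ → ℂ} {M : ℝ} (hD : LocallyIntegrable D volume)
    (hv : LocallyIntegrable v volume) (hM : ∀ᵐ x, ‖v x‖ ≤ M)
    (hw : ∀ φ : ℝ → ℝ, ContDiff ℝ ∞ φ → HasCompactSupport φ →
      ∫ x, ((deriv φ x : ℝ) : ℂ) * D x = - ∫ x, ((φ x : ℝ) : ℂ) * v x) :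
    ∃ c : ℂ, D =ᵐ[volume] fun x => c + ∫ s in (0 : ℝ)..x, v s := by
  -- Mollifiers with radii in the fixed ratio `2`, the boundedness required for almost everywhere
  -- convergence at Lebesgue points.
  let φ : ℕ → ContDiffBump (0 : ℝ) := fun n =>
    ⟨1 / ((n : ℝ) + 1), 2 * (1 / ((n : ℝ) + 1)), by positivity, by
      have : 0 < 1 / ((n : ℝ) + 1) := by positivity
      linarith⟩
  have hφ : Tendsto (fun n => (φ n).rOut) atTop (𝓝 0) := by
    have := (tendsto_one_div_add_atTop_nhds_zero_nat (𝕜 := ℝ)).const_mul 2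
    rwa [mul_zero] at this
  have h'φ : ∀ᶠ n in atTop, (φ n).rOut ≤ 2 * (φ n).rIn := Eventually.of_forall fun n => le_rfl
  have aD := ContDiffBump.ae_convolution_tendsto_right_of_locallyIntegrable hφ h'φ hD
  have av := ContDiffBump.ae_convolution_tendsto_right_of_locallyIntegrable hφ h'φ hv
  let Dn : ℕ → ℝ → ℂ := fun n =>
    MeasureTheory.convolution ((φ n).normed volume) D (ContinuousLinearMap.lsmul ℝ ℝ) volume
  let vn : ℕ → ℝ → ℂ := fun n =>
    MeasureTheory.convolution ((φ n).normed volume) v (ContinuousLinearMap.lsmul ℝ ℝ) volume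
  have hsm : ∀ n, ContDiff ℝ ∞ ((φ n).normed (volume : Measure ℝ)) := fun n =>
    (φ n).contDiff_normed
  have hcs : ∀ n, HasCompactSupport ((φ n).normed (volume : Measure ℝ)) := fun n =>
    (φ n).hasCompactSupport_normed
  have hder : ∀ n x, HasDerivAt (Dn n) (vn n x) x := by
    intro n x
    have h1 := (hcs n).hasDerivAt_convolution_left (ContinuousLinearMap.lsmul ℝ ℝ)
      ((hsm n).of_le (by exact_mod_cast le_top)) hD x
    set ρ := (φ n).normed (volume : Measure ℝ) with hρ
    suffices e : vn n x = MeasureTheory.convolution (deriv ρ) D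
        (ContinuousLinearMap.lsmul ℝ ℝ) volume x by
      rw [e]
      exact h1
    have hρd : ∀ t, HasDerivAt (fun t => ρ (x - t)) (- deriv ρ (x - t)) t := by
      intro t
      have h2 : HasDerivAt ρ (deriv ρ (x - t)) (x - t) :=
        (((hsm n).differentiable (by simp)) _).hasDerivAt
      have h4 := HasDerivAt.comp_const_sub x t h2
      exact h4
    -- Testing against the reflected mollifier `t ↦ ρ(x - t)`: the sign from the reflection cancels
    -- the sign of the weak formulation, so the mollified `D` has the mollified `v` as classical
    -- derivative.
    have h3 := hw (fun t => ρ (x - t)) ((hsm n).comp (contDiff_const.sub contDiff_id))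
      ((hcs n).comp_homeomorph (Homeomorph.subLeft x))
    have h5 : deriv (fun t => ρ (x - t)) = fun t => - deriv ρ (x - t) :=
      funext fun t => (hρd t).deriv
    rw [h5] at h3
    change ∫ t, ρ t • v (x - t) = ∫ t, deriv ρ t • D (x - t)
    simp only [Complex.real_smul]
    rw [← integral_sub_left_eq_self _ volume x, ← integral_sub_left_eq_self
      (fun t => ((deriv ρ t : ℝ) : ℂ) * D (x - t)) volume x]
    simp only [sub_sub_cancel]
    simp only [Complex.ofReal_neg, neg_mul, integral_neg, neg_inj] at h3
    exact h3.symm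
  have hvc : ∀ n, Continuous (vn n) := fun n =>
    (hcs n).continuous_convolution_left _ (hsm n).continuous hv
  have hvb : ∀ n x, ‖vn n x‖ ≤ M := by
    intro n x
    have hM' : ∀ᵐ t, ‖v (x - t)‖ ≤ M := by
      exact (Measure.measurePreserving_sub_left volume x).quasiMeasurePreserving.ae hM
    simp only [vn, MeasureTheory.convolution_def, ContinuousLinearMap.lsmul_apply]
    calc ‖∫ t, (φ n).normed volume t • v (x - t)‖
        ≤ ∫ t, (φ n).normed volume t * M := by
          refine norm_integral_le_of_norm_le ((φ n).integrable_normed.mul_const M) ?_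
          filter_upwards [hM'] with t ht
          rw [norm_smul, Real.norm_of_nonneg ((φ n).nonneg_normed t)]
          exact mul_le_mul_of_nonneg_left ht ((φ n).nonneg_normed t)
      _ = M := by rw [integral_mul_const, (φ n).integral_normed, one_mul]
  have hii : ∀ a b, IntervalIntegrable v volume a b := fun a b =>
    (hv.integrableOn_isCompact isCompact_uIcc).intervalIntegrable
  -- A point at which the mollifications of `D` converge anchors the constant of integration.
  obtain ⟨x₀, hx₀⟩ := aD.exists
  refine ⟨D x₀ - ∫ s in (0 : ℝ)..x₀, v s, ?_⟩
  filter_upwards [aD] with x hx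
  have h1 : ∀ n, Dn n x - Dn n x₀ = ∫ s in x₀..x, vn n s := fun n =>
    (intervalIntegral.integral_eq_sub_of_hasDerivAt (fun s _ => hder n s)
      ((hvc n).intervalIntegrable _ _)).symm
  have h2 : Tendsto (fun n => ∫ s in x₀..x, vn n s) atTop (𝓝 (∫ s in x₀..x, v s)) := by
    refine intervalIntegral.tendsto_integral_filter_of_dominated_convergence (fun _ => M)
      (Eventually.of_forall fun n => (hvc n).aestronglyMeasurable)
      (Eventually.of_forall fun n => ae_of_all _ fun s _ => hvb n s)
      intervalIntegrable_const ?_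
    filter_upwards [av] with s hs _ using hs
  have h3 : Tendsto (fun n => Dn n x - Dn n x₀) atTop (𝓝 (D x - D x₀)) := hx.sub hx₀
  simp only [h1] at h3
  have h4 := tendsto_nhds_unique h3 h2
  rw [← intervalIntegral.integral_add_adjacent_intervals (hii 0 x₀) (hii x₀ x), ← h4]
  ring

/-- Testing the order `n` relation with `φ'` and the order `n + 1` relation with `φ` gives the same
left-hand side; `(-1)^n` cancels. Hence consecutive weak derivatives of `g` are weak derivatives of
each other. -/
lemma HasWeakDeriv.step {g D v : ℝ → ℂ} {n : ℕ} (h₀ : HasWeakDeriv n g D)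
    (h₁ : HasWeakDeriv (n + 1) g v) (φ : ℝ → ℝ) (hφ : ContDiff ℝ ∞ φ) (hc : HasCompactSupport φ) :
    ∫ x, ((deriv φ x : ℝ) : ℂ) * D x = - ∫ x, ((φ x : ℝ) : ℂ) * v x := by
  have hφ' : ContDiff ℝ ∞ (deriv φ) := by
    have := contDiff_infty_iff_deriv.1 hφ
    exact this.2
  have e0 := h₀.2.2 (deriv φ) hφ' hc.deriv
  have e1 := h₁.2.2 φ hφ hc
  rw [iteratedDeriv_succ'] at e1
  rw [e1, pow_succ, mul_assoc] at e0
  have := mul_left_cancel₀ (pow_ne_zero n (by norm_num : (-1 : ℂ) ≠ 0)) e0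
  rw [← this]
  ring

lemma HasWeakDeriv.ae_eq {g D : ℝ → ℂ} (h : HasWeakDeriv 0 g D) : g =ᵐ[volume] D := by
  refine ae_eq_of_integral_contDiff_smul_eq h.1 h.2.1 fun φ hφ hc => ?_
  simpa [iteratedDeriv_zero] using h.2.2 φ hφ hc

/-- The continuous representative of a function with a weighted bound on its weak derivative. -/
lemma exists_weightedLipschitz_rep {β N : ℝ} {g D v : ℝ → ℂ} {n : ℕ} (hN : 0 ≤ N)
    (hβ : 0 ≤ β) (h₀ : HasWeakDeriv n g D) (h₁ : HasWeakDeriv (n + 1) g v)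
    (b₀ : ∀ᵐ x, ‖D x‖ ≤ N * Real.exp (-β * |x|)) (b₁ : ∀ᵐ x, ‖v x‖ ≤ N * Real.exp (-β * |x|)) :
    ∃ R : ℝ → ℂ, D =ᵐ[volume] R ∧ WeightedLipschitz β (Real.exp β * N) R ∧
      (∀ x, ‖R x‖ ≤ N * Real.exp (-β * |x|)) ∧
      ∀ w : ℝ → ℂ, Continuous w → v =ᵐ[volume] w → ∀ x, HasDerivAt R (w x) x := by
  have hM : ∀ᵐ x, ‖v x‖ ≤ N := by
    filter_upwards [b₁] with x hx
    refine hx.trans (mul_le_of_le_one_right hN (Real.exp_le_one_iff.2 ?_))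
    nlinarith [abs_nonneg x]
  have hv := h₁.2.1
  have hii : ∀ a b, IntervalIntegrable v volume a b := fun a b =>
    (hv.integrableOn_isCompact isCompact_uIcc).intervalIntegrable
  obtain ⟨c, hc⟩ := ae_eq_integral_of_weakDeriv h₀.2.1 hv hM (h₀.step h₁)
  set R : ℝ → ℂ := fun x => c + ∫ s in (0 : ℝ)..x, v s with hR
  have hRc : Continuous R :=
    continuous_const.add (intervalIntegral.continuous_primitive (fun a b => hii a b) 0)
  have hb : ∀ x, ‖R x‖ ≤ N * Real.exp (-β * |x|) := by
    refine forall_le_of_ae_le hRc.norm (by fun_prop) ?_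
    filter_upwards [hc, b₀] with x h1 h2
    rwa [← h1]
  refine ⟨R, hc, ⟨fun x => (hb x).trans ?_, fun x y hxy => ?_⟩, hb, ?_⟩
  · gcongr
    exact le_mul_of_one_le_left hN (Real.one_le_exp hβ)
  · have e : R x - R y = ∫ s in y..x, v s := by
      simp only [hR]
      rw [← intervalIntegral.integral_add_adjacent_intervals (hii 0 y) (hii y x)]
      ring
    rw [e]
    have := intervalIntegral.norm_integral_le_of_norm_le_const_ae (f := v) (a := y) (b := x)
      (C := N * (Real.exp β * Real.exp (-β * |x|))) (by
        filter_upwards [b₁] with s hs hsm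
        refine hs.trans ?_
        gcongr
        have := exp_weight_le β (x := x) (y := s) (by
          refine le_trans ?_ hxy
          have := Set.abs_sub_right_of_mem_uIcc (Set.uIoc_subset_uIcc hsm)
          exact this)
        rwa [abs_of_nonneg hβ] at this)
    refine this.trans (le_of_eq ?_)
    ring
  · intro w hw hvw x
    have e : R = fun x => c + ∫ s in (0 : ℝ)..x, w s := by
      funext y
      simp only [hR]
      congr 1
      exact intervalIntegral.integral_congr_ae (by filter_upwards [hvw] with s hs _ using hs)
    rw [e]
    exact (intervalIntegral.integral_hasDerivAt_right (hw.intervalIntegrable _ _)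
      hw.aestronglyMeasurable.stronglyMeasurableAtFilter hw.continuousAt).const_add c

/-! ### Tails of integrals -/

lemma integral_Ioi_eq_sub {E : Type*} [NormedAddCommGroup E] [NormedSpace ℝ E] {p : ℝ → E}
    (hp : Integrable p) (x : ℝ) :
    ∫ y in Set.Ioi x, p y = (∫ y in Set.Ioi 0, p y) - ∫ y in (0 : ℝ)..x, p y := by
  have h := intervalIntegral.integral_Ioi_sub_Ioi' (hp.integrableOn (s := Set.Ioi 0))
    (hp.integrableOn (s := Set.Ioi x))
  rw [← h]
  abel

lemma hasDerivAt_integral_Ioi {E : Type*} [NormedAddCommGroup E] [NormedSpace ℝ E]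
    [CompleteSpace E] {p : ℝ → E} (hc : Continuous p) (hp : Integrable p) (x : ℝ) :
    HasDerivAt (fun x => ∫ y in Set.Ioi x, p y) (-p x) x := by
  have e : (fun x => ∫ y in Set.Ioi x, p y)
      = fun x => (∫ y in Set.Ioi 0, p y) - ∫ y in (0 : ℝ)..x, p y :=
    funext fun x => integral_Ioi_eq_sub hp x
  rw [e]
  exact (intervalIntegral.integral_hasDerivAt_right (hc.intervalIntegrable _ _)
    hc.aestronglyMeasurable.stronglyMeasurableAtFilter hc.continuousAt).const_sub _

lemma tendsto_integral_Ioi_zero {E : Type*} [NormedAddCommGroup E] [NormedSpace ℝ E]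
    {p : ℝ → E} (hp : Integrable p) :
    Tendsto (fun x => ∫ y in Set.Ioi x, p y) atTop (𝓝 0) := by
  have e : (fun x => ∫ y in Set.Ioi x, p y)
      = fun x => (∫ y in Set.Ioi 0, p y) - ∫ y in (0 : ℝ)..x, p y :=
    funext fun x => integral_Ioi_eq_sub hp x
  rw [e]
  have := (intervalIntegral_tendsto_integral_Ioi 0 hp.integrableOn tendsto_id).const_sub
    (∫ y in Set.Ioi 0, p y)
  simpa using this

lemma integrable_exp_weight {γ : ℝ} (hγ : 0 < γ) :
    Integrable (fun x : ℝ => Real.exp (-γ * |x|)) := by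
  have h1 : IntegrableOn (fun x : ℝ => Real.exp (-γ * |x|)) (Set.Ioi 0) := by
    refine (exp_neg_integrableOn_Ioi 0 hγ).congr_fun (fun x hx => ?_) measurableSet_Ioi
    rw [abs_of_pos hx]
  have h2 : IntegrableOn (fun x : ℝ => Real.exp (-γ * |x|)) (Set.Iic 0) := by
    have h3 : IntegrableOn (fun x : ℝ => Real.exp (-γ * |x|)) (Set.Ioi (-0)) := by simpa using h1
    rw [← integrableOn_Ici_iff_integrableOn_Ioi] at h3
    simpa using h3.comp_neg_Iic
  have := h2.union h1
  rwa [Set.Iic_union_Ioi, integrableOn_univ] at this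

/-! ### A Grönwall inequality from the right -/

section Gronwall

variable {w : ℝ → ℝ}

lemma exp_two_tail_le (w0 : ∀ x, 0 ≤ w x) (wi : Integrable w) (x : ℝ) :
    Real.exp (2 * ∫ y in Set.Ioi x, w y) ≤ Real.exp (2 * ∫ y, w y) := by
  gcongr
  · exact ae_of_all _ w0
  · exact Measure.restrict_le_self

lemma integrable_mul_exp_tail (wc : Continuous w) (w0 : ∀ x, 0 ≤ w x) (wi : Integrable w) :
    Integrable (fun x => w x * Real.exp (2 * ∫ y in Set.Ioi x, w y)) := by
  have hc : Continuous (fun x => ∫ y in Set.Ioi x, w y) :=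
    continuous_iff_continuousAt.2 fun x => (hasDerivAt_integral_Ioi wc wi x).continuousAt
  refine wi.mul_bdd (c := Real.exp (2 * ∫ y, w y))
    (Real.continuous_exp.comp (hc.const_mul 2)).aestronglyMeasurable (ae_of_all _ fun x => ?_)
  rw [Real.norm_of_nonneg (Real.exp_pos _).le]
  exact exp_two_tail_le w0 wi x

/-- The integrand is the derivative of `-e^{2W}/2`, where `W` is the tail of `∫ w`. The resulting
factor `1/2` closes both Grönwall's inequality and the contraction argument, however large `w` is.
-/
lemma integral_mul_exp_tail (wc : Continuous w) (w0 : ∀ x, 0 ≤ w x) (wi : Integrable w) (x : ℝ) :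
    ∫ y in Set.Ioi x, w y * Real.exp (2 * ∫ s in Set.Ioi y, w s)
      = (Real.exp (2 * ∫ s in Set.Ioi x, w s) - 1) / 2 := by
  have hd : ∀ y, HasDerivAt (fun y => -(Real.exp (2 * ∫ s in Set.Ioi y, w s) / 2))
      (w y * Real.exp (2 * ∫ s in Set.Ioi y, w s)) y := by
    intro y
    have := ((((hasDerivAt_integral_Ioi wc wi y).const_mul 2).exp).div_const 2).neg
    refine this.congr_deriv ?_
    ring
  rw [integral_Ioi_of_hasDerivAt_of_tendsto' (m := -(1 / 2)) (fun y _ => hd y)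
    (integrable_mul_exp_tail wc w0 wi).integrableOn]
  · ring
  · have h := (((tendsto_integral_Ioi_zero wi).const_mul 2).rexp).div_const 2 |>.neg
    simpa using h

/-- Grönwall's inequality for a Volterra inequality on half-lines unbounded to the right. -/
lemma gronwall_right {h : ℝ → ℝ} {B : ℝ} (wc : Continuous w) (w0 : ∀ x, 0 ≤ w x)
    (wi : Integrable w) (hc : Continuous h) (hB : 0 ≤ B)
    (hbd : ∀ x₀, ∃ M, ∀ x, x₀ ≤ x → h x ≤ M) (h0 : ∀ x, 0 ≤ h x)
    (hh : ∀ x, h x ≤ B + ∫ y in Set.Ioi x, w y * h y) (x : ℝ) :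
    h x ≤ 2 * B * Real.exp (2 * ∫ y, w y) := by
  set W : ℝ → ℝ := fun x => ∫ y in Set.Ioi x, w y with hW
  have W0 : ∀ x, 0 ≤ W x := fun x => integral_nonneg w0
  obtain ⟨M, hM⟩ := hbd x
  -- The supremum `S` of `h e^{-2W}` over the half-line is finite by the a priori bound, and
  -- satisfies `S ≤ B + S/2`.
  set A : Set ℝ := (fun y => h y * Real.exp (-(2 * W y))) '' Set.Ici x
  have Abd : BddAbove A := by
    refine ⟨M, ?_⟩
    rintro _ ⟨y, hy, rfl⟩
    refine (mul_le_of_le_one_right (h0 y) (Real.exp_le_one_iff.2 ?_)).trans (hM y hy)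
    linarith [W0 y]
  set S := sSup A
  have hS : ∀ y, x ≤ y → h y ≤ S * Real.exp (2 * W y) := by
    intro y hy
    have h1 : h y * Real.exp (-(2 * W y)) ≤ S := le_csSup Abd ⟨y, hy, rfl⟩
    calc h y = h y * Real.exp (-(2 * W y)) * Real.exp (2 * W y) := by
          rw [mul_assoc, ← Real.exp_add]; simp
      _ ≤ _ := by gcongr
  have S0 : 0 ≤ S := (mul_nonneg (h0 x) (Real.exp_pos _).le).trans
    (le_csSup Abd ⟨x, Set.self_mem_Ici, rfl⟩)
  have key : ∀ y, x ≤ y → h y ≤ B + S * ((Real.exp (2 * W y) - 1) / 2) := by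
    intro y hy
    refine (hh y).trans ?_
    rw [← integral_mul_exp_tail wc w0 wi y, ← integral_const_mul]
    refine add_le_add le_rfl ?_
    have hi := ((integrable_mul_exp_tail wc w0 wi).const_mul S).integrableOn (s := Set.Ioi y)
    have hle : ∀ z ∈ Set.Ioi y, w z * h z ≤ S * (w z * Real.exp (2 * W z)) := by
      intro z hz
      calc w z * h z ≤ w z * (S * Real.exp (2 * W z)) :=
            mul_le_mul_of_nonneg_left (hS z (hy.trans (le_of_lt hz))) (w0 z)
        _ = _ := by ring
    refine setIntegral_mono_on ?_ hi measurableSet_Ioi hle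
    refine Integrable.mono' hi (wc.mul hc).aestronglyMeasurable ?_
    refine (ae_restrict_iff' measurableSet_Ioi).2 (ae_of_all _ fun z hz => ?_)
    rw [Real.norm_of_nonneg (mul_nonneg (w0 z) (h0 z))]
    exact hle z hz
  have hSB : S ≤ B + S / 2 := by
    refine csSup_le ⟨_, ⟨x, Set.self_mem_Ici, rfl⟩⟩ ?_
    rintro _ ⟨y, hy, rfl⟩
    have e1 : 1 ≤ Real.exp (2 * W y) := Real.one_le_exp (by linarith [W0 y])
    have h2 := key y hy
    have h3 : h y ≤ (B + S / 2) * Real.exp (2 * W y) := by nlinarith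
    calc h y * Real.exp (-(2 * W y)) ≤ (B + S / 2) * Real.exp (2 * W y) * Real.exp (-(2 * W y)) := by
          gcongr
      _ = B + S / 2 := by rw [mul_assoc, ← Real.exp_add]; simp
  calc h x ≤ S * Real.exp (2 * W x) := hS x le_rfl
    _ ≤ 2 * B * Real.exp (2 * ∫ y, w y) := by
      have h1 : S ≤ 2 * B := by linarith
      exact mul_le_mul h1 (exp_two_tail_le w0 wi x) (Real.exp_pos _).le (by linarith)

end Gronwall

/-! ### The kernels of the Volterra equation -/

lemma norm_cos_mul_le (k : ℂ) (z : ℝ) : ‖Complex.cos (k * z)‖ ≤ Real.exp (|k.im| * |z|) := by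
  have h1 : ‖Complex.exp (k * z * Complex.I)‖ ≤ Real.exp (|k.im| * |z|) := by
    rw [Complex.norm_exp]
    apply Real.exp_le_exp.2
    have : (k * z * Complex.I).re = -(k.im * z) := by simp
    rw [this, ← abs_mul]
    exact neg_le_abs _
  have h2 : ‖Complex.exp (-(k * z) * Complex.I)‖ ≤ Real.exp (|k.im| * |z|) := by
    rw [Complex.norm_exp]
    apply Real.exp_le_exp.2
    have : (-(k * z) * Complex.I).re = k.im * z := by simp
    rw [this, ← abs_mul]
    exact le_abs_self _
  rw [Complex.cos, norm_div, Complex.norm_ofNat, div_le_iff₀ two_pos]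
  refine (norm_add_le _ _).trans ?_
  linarith

lemma hasDerivAt_sinKernel (k : ℂ) (x : ℝ) :
    HasDerivAt (sinKernel k) (Complex.cos (k * x)) x := by
  unfold sinKernel
  by_cases hk : k = 0
  · simp only [hk, if_true, zero_mul, Complex.cos_zero]
    exact Complex.ofRealCLM.hasDerivAt
  · simp only [hk, if_false]
    have h1 : HasDerivAt (fun x : ℝ => k * (x : ℂ)) k x := by
      simpa using (Complex.ofRealCLM.hasDerivAt (x := x)).const_mul k
    have h2 := (Complex.hasDerivAt_sin (k * x)).comp x h1
    have h3 := h2.div_const k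
    rwa [mul_div_assoc, div_self hk, mul_one] at h3

lemma hasDerivAt_cos_mul (k : ℂ) (x : ℝ) :
    HasDerivAt (fun x : ℝ => Complex.cos (k * x)) (-(k ^ 2 * sinKernel k x)) x := by
  have h1 : HasDerivAt (fun x : ℝ => k * (x : ℂ)) k x := by
    simpa using (Complex.ofRealCLM.hasDerivAt (x := x)).const_mul k
  have h2 := (Complex.hasDerivAt_cos (k * x)).comp x h1
  refine h2.congr_deriv ?_
  unfold sinKernel
  split_ifs with hk
  · simp [hk]
  · field_simp

lemma continuous_sinKernel (k : ℂ) : Continuous (sinKernel k) :=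
  continuous_iff_continuousAt.2 fun x => (hasDerivAt_sinKernel k x).continuousAt

lemma sinKernel_zero_right (k : ℂ) : sinKernel k 0 = 0 := by
  unfold sinKernel
  split_ifs <;> simp

lemma sinKernel_neg (k : ℂ) (x : ℝ) : sinKernel k (-x) = -sinKernel k x := by
  unfold sinKernel
  split_ifs
  · simp
  · simp [neg_div]

/-- Separates `x` from `y`: the Volterra integral becomes two tail integrals with coefficients
depending on `x`, to which the fundamental theorem of calculus applies. -/
lemma sinKernel_sub (k : ℂ) (x y : ℝ) :
    sinKernel k (y - x)
      = sinKernel k y * Complex.cos (k * x) - Complex.cos (k * y) * sinKernel k x := by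
  unfold sinKernel
  split_ifs with hk
  · simp [hk]
  · push_cast
    rw [mul_sub, Complex.sin_sub]
    field_simp

lemma cos_mul_sub (k : ℂ) (x y : ℝ) :
    Complex.cos (k * (y - x : ℝ)) = Complex.cos (k * y) * Complex.cos (k * x)
      + k ^ 2 * (sinKernel k y * sinKernel k x) := by
  unfold sinKernel
  split_ifs with hk
  · simp [hk]
  · push_cast
    rw [mul_sub, Complex.cos_sub]
    field_simp

lemma cos_sq_add_sinKernel_sq (k : ℂ) (x : ℝ) :
    Complex.cos (k * x) ^ 2 + k ^ 2 * sinKernel k x ^ 2 = 1 := by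
  have := cos_mul_sub k x x
  simp only [sub_self, Complex.ofReal_zero, mul_zero, Complex.cos_zero] at this
  rw [this]
  ring

/-- Mean value inequality with derivative `cos (kx)`. In contrast to bounding `sin` and dividing by
`k`, this is uniform as `k → 0`, at the cost of a factor `|z|`. -/
lemma norm_sinKernel_le (k : ℂ) (z : ℝ) : ‖sinKernel k z‖ ≤ |z| * Real.exp (|k.im| * |z|) := by
  have key := (convex_uIcc (0 : ℝ) z).norm_image_sub_le_of_norm_hasDerivWithin_le
    (f := sinKernel k) (f' := fun x => Complex.cos (k * x)) (C := Real.exp (|k.im| * |z|))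
    (fun s _ => (hasDerivAt_sinKernel k s).hasDerivWithinAt) (fun s hs => by
      refine (norm_cos_mul_le k s).trans ?_
      have := Set.abs_sub_left_of_mem_uIcc hs
      rw [sub_zero, sub_zero] at this
      exact Real.exp_le_exp.2 (mul_le_mul_of_nonneg_left this (abs_nonneg _))) Set.left_mem_uIcc Set.right_mem_uIcc
  rw [sinKernel_zero_right, sub_zero, sub_zero, Real.norm_eq_abs] at key
  linarith

/-- A polynomial factor is absorbed by widening the exponent; this is why the weight exponent `a` is
taken strictly larger than `α`. -/
lemma mul_exp_le {α a : ℝ} (h : α < a) (s : ℝ) :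
    |s| * Real.exp (α * |s|) ≤ 1 / (a - α) * Real.exp (a * |s|) := by
  have h0 : 0 < a - α := sub_pos.2 h
  have h1 : (a - α) * |s| ≤ Real.exp ((a - α) * |s|) := by
    linarith [Real.add_one_le_exp ((a - α) * |s|)]
  have e : Real.exp (a * |s|) = Real.exp ((a - α) * |s|) * Real.exp (α * |s|) := by
    rw [← Real.exp_add]; ring_nf
  rw [e, ← mul_assoc]
  gcongr
  rw [one_div, ← div_eq_inv_mul, le_div_iff₀ h0]
  linarith

lemma norm_sinKernel_le_exp {α a : ℝ} (h : α < a) {k : ℂ} (hk : |k.im| ≤ α) (z : ℝ) :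
    ‖sinKernel k z‖ ≤ 1 / (a - α) * Real.exp (a * |z|) :=
  (norm_sinKernel_le k z).trans (le_trans (by gcongr) (mul_exp_le h z))

lemma norm_cos_mul_le_exp {a : ℝ} {k : ℂ} (hk : |k.im| ≤ a) (z : ℝ) :
    ‖Complex.cos (k * z)‖ ≤ Real.exp (a * |z|) :=
  (norm_cos_mul_le k z).trans (by gcongr)

lemma norm_exp_I_mul_le {a : ℝ} {k : ℂ} (hk : |k.im| ≤ a) (x : ℝ) :
    ‖Complex.exp (Complex.I * k * x)‖ ≤ Real.exp (a * |x|) := by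
  rw [Complex.norm_exp]
  apply Real.exp_le_exp.2
  have : (Complex.I * k * x).re = -(k.im * x) := by simp
  rw [this]
  calc -(k.im * x) ≤ |k.im * x| := neg_le_abs _
    _ = |k.im| * |x| := abs_mul _ _
    _ ≤ _ := by gcongr

/-! ### Jost solutions for continuous, exponentially decaying potentials -/

/-- Standing assumptions on a potential `U` and on the exponents: wave numbers lie in the strip of
half-width `α`, Jost solutions are measured against `e^{a|x|}`, and `U` is `O(e^{-β|x|})`. -/
structure JostSetting (α a β A : ℝ) (U : ℝ → ℂ) : Prop where
  alpha_nonneg : 0 ≤ α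
  alpha_lt : α < a
  lt_beta : 0 < β - 2 * a
  continuous : Continuous U
  bound : ∀ x, ‖U x‖ ≤ A * Real.exp (-β * |x|)

/-- The weight dominating the Volterra kernel. -/
def jostWeight (α a β A y : ℝ) : ℝ := A / (a - α) * Real.exp (-(β - 2 * a) * |y|)

/-- The resulting bound on `e^{-a|x|} |f_±(x;k)|`. -/
def jostBound (α a β A : ℝ) : ℝ := 2 * Real.exp (2 * ∫ y, jostWeight α a β A y)

lemma jostBound_nonneg (α a β A : ℝ) : 0 ≤ jostBound α a β A := by
  unfold jostBound
  positivity

namespace JostSetting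

variable {α a β A : ℝ} {U : ℝ → ℂ} (hs : JostSetting α a β A U)
include hs

lemma amp_nonneg : 0 ≤ A := by
  have := (norm_nonneg _).trans (hs.bound 0)
  simpa using this

lemma a_pos : 0 < a := hs.alpha_nonneg.trans_lt hs.alpha_lt

omit hs in
lemma weight_continuous : Continuous (jostWeight α a β A) := by
  unfold jostWeight
  fun_prop

lemma weight_nonneg (y : ℝ) : 0 ≤ jostWeight α a β A y := by
  have := hs.amp_nonneg
  have := sub_pos.2 hs.alpha_lt
  unfold jostWeight
  positivity

lemma weight_integrable : Integrable (jostWeight α a β A) :=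
  (integrable_exp_weight hs.lt_beta).const_mul _

lemma mul_exp_bound (y : ℝ) : ‖U y‖ * Real.exp (a * |y|) * Real.exp (a * |y|)
    ≤ A * Real.exp (-(β - 2 * a) * |y|) := by
  have e : Real.exp (-(β - 2 * a) * |y|)
      = Real.exp (-β * |y|) * Real.exp (a * |y|) * Real.exp (a * |y|) := by
    rw [← Real.exp_add, ← Real.exp_add]
    ring_nf
  rw [e, ← mul_assoc, ← mul_assoc]
  gcongr
  exact hs.bound y

/-- Split `e^{a|y - x|} ≤ e^{a|y|} e^{a|x|}`. Together with the growth of the solution this costs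
`e^{2a|y|}`, which the decay of `U` dominates since `2a < β`. -/
lemma kernel_bound {k : ℂ} (hk : |k.im| ≤ α) (x y : ℝ) :
    ‖sinKernel k (y - x) * U y‖ * Real.exp (a * |y|)
      ≤ Real.exp (a * |x|) * jostWeight α a β A y := by
  have h0 := sub_pos.2 hs.alpha_lt
  have h1 : ‖sinKernel k (y - x)‖ ≤ 1 / (a - α) * (Real.exp (a * |y|) * Real.exp (a * |x|)) := by
    refine (norm_sinKernel_le_exp hs.alpha_lt hk _).trans ?_
    rw [← Real.exp_add, ← mul_add]
    have := hs.a_pos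
    gcongr
    exact abs_sub y x
  rw [norm_mul]
  calc ‖sinKernel k (y - x)‖ * ‖U y‖ * Real.exp (a * |y|)
      ≤ 1 / (a - α) * (Real.exp (a * |y|) * Real.exp (a * |x|)) * ‖U y‖ * Real.exp (a * |y|) := by
        gcongr
    _ = Real.exp (a * |x|) * (1 / (a - α)) * (‖U y‖ * Real.exp (a * |y|) * Real.exp (a * |y|)) := by
        ring
    _ ≤ Real.exp (a * |x|) * (1 / (a - α)) * (A * Real.exp (-(β - 2 * a) * |y|)) := by
        have := hs.mul_exp_bound y
        gcongr
    _ = _ := by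
        unfold jostWeight
        ring

lemma kernel_mul_bound {k : ℂ} (hk : |k.im| ≤ α) (x y : ℝ) {z : ℂ} {c : ℝ}
    (hz : ‖z‖ ≤ c * Real.exp (a * |y|)) :
    ‖sinKernel k (y - x) * U y * z‖ ≤ Real.exp (a * |x|) * (jostWeight α a β A y * c) := by
  have c0 : 0 ≤ c := by
    have := (norm_nonneg _).trans hz
    exact nonneg_of_mul_nonneg_left this (Real.exp_pos _)
  rw [norm_mul]
  calc ‖sinKernel k (y - x) * U y‖ * ‖z‖
      ≤ ‖sinKernel k (y - x) * U y‖ * (c * Real.exp (a * |y|)) := by gcongr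
    _ = (‖sinKernel k (y - x) * U y‖ * Real.exp (a * |y|)) * c := by ring
    _ ≤ (Real.exp (a * |x|) * jostWeight α a β A y) * c :=
        mul_le_mul_of_nonneg_right (hs.kernel_bound hk x y) c0
    _ = _ := by ring

lemma integrable_kernel {k : ℂ} (hk : |k.im| ≤ α) {f : ℝ → ℂ} (hf : Continuous f) {M : ℝ}
    (hM : ∀ y, ‖f y‖ ≤ M * Real.exp (a * |y|)) (x : ℝ) :
    Integrable (fun y => sinKernel k (y - x) * U y * f y) := by
  refine Integrable.mono' ((hs.weight_integrable.mul_const M).const_mul (Real.exp (a * |x|)))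
    (Continuous.aestronglyMeasurable ?_) (ae_of_all _ fun y => hs.kernel_mul_bound hk x y (hM y))
  exact (((continuous_sinKernel k).comp (continuous_id.sub continuous_const)).mul
    hs.continuous).mul hf

lemma integrable_sinKernel {k : ℂ} (hk : |k.im| ≤ α) {f : ℝ → ℂ} (hf : Continuous f) {M : ℝ}
    (hM : ∀ y, ‖f y‖ ≤ M * Real.exp (a * |y|)) :
    Integrable (fun y => sinKernel k y * U y * f y) := by
  simpa using hs.integrable_kernel hk hf hM 0

lemma cos_bound {k : ℂ} (hk : |k.im| ≤ α) (y : ℝ) {z : ℂ} {M : ℝ}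
    (hM : ‖z‖ ≤ M * Real.exp (a * |y|)) :
    ‖Complex.cos (k * y) * U y * z‖ ≤ M * A * Real.exp (-(β - 2 * a) * |y|) := by
  have M0 : 0 ≤ M := by
    have := (norm_nonneg _).trans hM
    exact nonneg_of_mul_nonneg_left this (Real.exp_pos _)
  rw [norm_mul, norm_mul]
  calc ‖Complex.cos (k * y)‖ * ‖U y‖ * ‖z‖
      ≤ Real.exp (a * |y|) * ‖U y‖ * (M * Real.exp (a * |y|)) := by
        gcongr
        exact norm_cos_mul_le_exp (hk.trans hs.alpha_lt.le) y
    _ = M * (‖U y‖ * Real.exp (a * |y|) * Real.exp (a * |y|)) := by ring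
    _ ≤ M * (A * Real.exp (-(β - 2 * a) * |y|)) := by
        have := hs.mul_exp_bound y
        gcongr
    _ = _ := by ring

lemma integrable_cos {k : ℂ} (hk : |k.im| ≤ α) {f : ℝ → ℂ} (hf : Continuous f) {M : ℝ}
    (hM : ∀ y, ‖f y‖ ≤ M * Real.exp (a * |y|)) :
    Integrable (fun y : ℝ => Complex.cos (k * y) * U y * f y) := by
  refine Integrable.mono' ((integrable_exp_weight hs.lt_beta).const_mul (M * A))
    (Continuous.aestronglyMeasurable ?_) (ae_of_all _ fun y => hs.cos_bound hk y (hM y))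
  have := hs.continuous
  fun_prop

lemma integral_kernel_eq {k : ℂ} (hk : |k.im| ≤ α) {f : ℝ → ℂ} (hf : Continuous f) {M : ℝ}
    (hM : ∀ y, ‖f y‖ ≤ M * Real.exp (a * |y|)) (x : ℝ) :
    ∫ y in Set.Ioi x, sinKernel k (y - x) * U y * f y
      = (∫ y in Set.Ioi x, sinKernel k y * U y * f y) * Complex.cos (k * x)
        - (∫ y : ℝ in Set.Ioi x, Complex.cos (k * y) * U y * f y) * sinKernel k x := by
  rw [← integral_mul_const, ← integral_mul_const, ← integral_sub]
  · refine integral_congr_ae (ae_of_all _ fun y => ?_)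
    simp only [sinKernel_sub]
    ring
  · exact ((hs.integrable_sinKernel hk hf hM).mul_const _).integrableOn
  · exact ((hs.integrable_cos hk hf hM).mul_const _).integrableOn

lemma norm_integral_kernel_le {k : ℂ} (hk : |k.im| ≤ α) {f : ℝ → ℂ} {c : ℝ → ℝ}
    (hc : Integrable (fun y => jostWeight α a β A y * c y))
    (hM : ∀ y, ‖f y‖ ≤ c y * Real.exp (a * |y|)) (x : ℝ) :
    ‖∫ y in Set.Ioi x, sinKernel k (y - x) * U y * f y‖
      ≤ Real.exp (a * |x|) * ∫ y in Set.Ioi x, jostWeight α a β A y * c y := by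
  rw [← integral_const_mul]
  exact norm_integral_le_of_norm_le (hc.integrableOn.const_mul _)
    (ae_of_all _ fun y => hs.kernel_mul_bound hk x y (hM y))

/-- Banach's fixed point theorem in a weighted sup norm of Bielecki type, in which the Volterra
operator has norm at most `1/2` irrespective of the size of `U`. -/
lemma exists_volterra {k : ℂ} (hk : |k.im| ≤ α) :
    ∃ f : ℝ → ℂ, Continuous f ∧ (∃ M, ∀ y, ‖f y‖ ≤ M * Real.exp (a * |y|)) ∧
      ∀ x, f x = Complex.exp (Complex.I * k * x)
        + ∫ y in Set.Ioi x, sinKernel k (y - x) * U y * f y := by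
  set w := jostWeight α a β A with hw
  have wc := weight_continuous (α := α) (a := a) (β := β) (A := A)
  have w0 := hs.weight_nonneg
  have wi := hs.weight_integrable
  set W : ℝ → ℝ := fun x => ∫ y in Set.Ioi x, w y with hW
  have W0 : ∀ x, 0 ≤ W x := fun x => integral_nonneg w0
  have Wc : Continuous W :=
    continuous_iff_continuousAt.2 fun x => (hasDerivAt_integral_Ioi wc wi x).continuousAt
  set I := ∫ y, w y
  have WI : ∀ x, Real.exp (2 * W x) ≤ Real.exp (2 * I) := exp_two_tail_le w0 wi
  -- `e^{a|x|}` accounts for the growth of solutions; `e^{2W}` makes the operator contractive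
  -- through `integral_mul_exp_tail`.
  let Φ : ℝ → ℝ := fun x => Real.exp (a * |x|) * Real.exp (2 * W x)
  have Φc : Continuous Φ := by fun_prop
  have Φ0 : ∀ x, 0 < Φ x := fun x => by positivity
  let F : BoundedContinuousFunction ℝ ℂ → ℝ → ℂ := fun u y => (Φ y : ℂ) * u y
  have Fc : ∀ u, Continuous (F u) := fun u => by fun_prop
  have FM' : ∀ (u : BoundedContinuousFunction ℝ ℂ) y,
      ‖F u y‖ ≤ (Real.exp (2 * W y) * ‖u‖) * Real.exp (a * |y|) := by
    intro u y
    simp only [F, norm_mul, Complex.norm_real, Real.norm_of_nonneg (Φ0 y).le]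
    calc Φ y * ‖u y‖ ≤ Φ y * ‖u‖ := by
          have := Φ0 y
          gcongr
          exact u.norm_coe_le_norm y
      _ = _ := by simp only [Φ]; ring
  have FM : ∀ u y, ‖F u y‖ ≤ (Real.exp (2 * I) * ‖u‖) * Real.exp (a * |y|) := by
    intro u y
    refine (FM' u y).trans ?_
    have := WI y
    gcongr ?_ * _ * _
  have hint : ∀ c : ℝ, Integrable (fun y => w y * (Real.exp (2 * W y) * c)) := fun c => by
    simpa only [mul_assoc] using (integrable_mul_exp_tail wc w0 wi).mul_const c
  have hval : ∀ c x : ℝ, ∫ y in Set.Ioi x, w y * (Real.exp (2 * W y) * c)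
      = (Real.exp (2 * W x) - 1) / 2 * c := fun c x => by
    simp only [← mul_assoc]
    rw [integral_mul_const, integral_mul_exp_tail wc w0 wi x]
  have hKle : ∀ u x, ‖∫ y in Set.Ioi x, sinKernel k (y - x) * U y * F u y‖
      ≤ Φ x * (‖u‖ / 2) := by
    intro u x
    refine (hs.norm_integral_kernel_le hk (hint ‖u‖) (FM' u) x).trans ?_
    rw [hval]
    simp only [Φ]
    rw [mul_assoc]
    refine mul_le_mul_of_nonneg_left ?_ (Real.exp_pos _).le
    nlinarith [norm_nonneg u]
  have hKc : ∀ u, Continuous (fun x => ∫ y in Set.Ioi x, sinKernel k (y - x) * U y * F u y) := by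
    intro u
    simp only [hs.integral_kernel_eq hk (Fc u) (FM u)]
    have c1 : Continuous (fun x => ∫ y in Set.Ioi x, sinKernel k y * U y * F u y) :=
      continuous_iff_continuousAt.2 fun x => (hasDerivAt_integral_Ioi
        (((continuous_sinKernel k).mul hs.continuous).mul (Fc u))
        (hs.integrable_sinKernel hk (Fc u) (FM u)) x).continuousAt
    have c2 : Continuous (fun x : ℝ => ∫ y : ℝ in Set.Ioi x, Complex.cos (k * y) * U y * F u y) := by
      have := hs.continuous
      have := Fc u
      exact continuous_iff_continuousAt.2 fun x => (hasDerivAt_integral_Ioi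
        (by fun_prop) (hs.integrable_cos hk (Fc u) (FM u)) x).continuousAt
    have := continuous_sinKernel k
    fun_prop
  -- The Volterra map conjugated by `Φ`, acting on bounded continuous functions.
  let T₀ : BoundedContinuousFunction ℝ ℂ → ℝ → ℂ := fun u x =>
    ((Φ x)⁻¹ : ℂ) * (Complex.exp (Complex.I * k * x)
      + ∫ y in Set.Ioi x, sinKernel k (y - x) * U y * F u y)
  have Φne : ∀ x, (Φ x : ℂ) ≠ 0 := fun x => by exact_mod_cast (Φ0 x).ne'
  have T₀c : ∀ u, Continuous (T₀ u) := by
    intro u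
    have h1 : Continuous (fun x => ((Φ x : ℂ))⁻¹) :=
      (Complex.continuous_ofReal.comp Φc).inv₀ Φne
    have := hKc u
    fun_prop
  have T₀b : ∀ u x, ‖T₀ u x‖ ≤ 1 + ‖u‖ / 2 := by
    intro u x
    simp only [T₀, norm_mul, norm_inv, Complex.norm_real, Real.norm_of_nonneg (Φ0 x).le]
    rw [inv_mul_le_iff₀ (Φ0 x), mul_add]
    refine (norm_add_le _ _).trans (add_le_add ?_ (hKle u x))
    refine (norm_exp_I_mul_le (hk.trans hs.alpha_lt.le) x).trans ?_
    simp only [Φ, mul_one]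
    exact le_mul_of_one_le_right (Real.exp_pos _).le (Real.one_le_exp (by linarith [W0 x]))
  let T : BoundedContinuousFunction ℝ ℂ → BoundedContinuousFunction ℝ ℂ := fun u =>
    BoundedContinuousFunction.ofNormedAddCommGroup (T₀ u) (T₀c u) _ (T₀b u)
  have hT : ContractingWith (1 / 2 : NNReal) T := by
    refine ⟨by rw [← NNReal.coe_lt_coe]; norm_num, LipschitzWith.of_dist_le_mul fun u v => ?_⟩
    rw [BoundedContinuousFunction.dist_le (by positivity)]
    intro x
    have e : T₀ u x - T₀ v x = ((Φ x)⁻¹ : ℂ) *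
        ∫ y in Set.Ioi x, sinKernel k (y - x) * U y * F (u - v) y := by
      have : ∀ y, sinKernel k (y - x) * U y * F (u - v) y
          = sinKernel k (y - x) * U y * F u y - sinKernel k (y - x) * U y * F v y := by
        intro y
        simp only [F, BoundedContinuousFunction.coe_sub, Pi.sub_apply]
        ring
      simp only [this]
      rw [integral_sub (hs.integrable_kernel hk (Fc u) (FM u) x).integrableOn
        (hs.integrable_kernel hk (Fc v) (FM v) x).integrableOn]
      simp only [T₀]
      ring
    change dist (T₀ u x) (T₀ v x) ≤ _
    rw [dist_eq_norm, e, norm_mul, norm_inv, Complex.norm_real, Real.norm_of_nonneg (Φ0 x).le,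
      inv_mul_le_iff₀ (Φ0 x), dist_eq_norm]
    refine (hKle (u - v) x).trans (le_of_eq ?_)
    push_cast
    ring
  obtain ⟨u, hu⟩ : ∃ u, T u = u := ⟨_, hT.fixedPoint_isFixedPt⟩
  refine ⟨F u, Fc u, ⟨_, FM u⟩, fun x => ?_⟩
  have h1 : T₀ u x = u x := congrArg (fun v : BoundedContinuousFunction ℝ ℂ => v x) hu
  have h2 : F u x = (Φ x : ℂ) * T₀ u x := by rw [h1]
  rw [h2]
  simp only [T₀]
  rw [← mul_assoc, mul_inv_cancel₀ (Φne x), one_mul]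

end JostSetting

/-- The derivative of a solution of the Volterra equation for `f_+`. -/
def volterraDeriv (U : ℝ → ℂ) (k : ℂ) (f : ℝ → ℂ) (x : ℝ) : ℂ :=
  Complex.I * k * Complex.exp (Complex.I * k * x)
    - ∫ y : ℝ in Set.Ioi x, Complex.cos (k * (y - x : ℝ)) * U y * f y

lemma hasDerivAt_exp_I_mul (k : ℂ) (x : ℝ) :
    HasDerivAt (fun x : ℝ => Complex.exp (Complex.I * k * x))
      (Complex.I * k * Complex.exp (Complex.I * k * x)) x := by
  have h1 : HasDerivAt (fun x : ℝ => Complex.I * k * (x : ℂ)) (Complex.I * k) x := by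
    simpa using (Complex.ofRealCLM.hasDerivAt (x := x)).const_mul (Complex.I * k)
  refine h1.cexp.congr_deriv ?_
  ring

/-! ### Bounds, derivatives and existence of `f_+`. -/

namespace JostSetting

variable {α a β A : ℝ} {U : ℝ → ℂ} (hs : JostSetting α a β A U)
include hs

/-- Grönwall's inequality for the Volterra equation, in the weight `e^{a|x|}`. -/
lemma norm_le_of_le_add_integral {k : ℂ} (hk : |k.im| ≤ α) {d : ℝ → ℂ} (hd : Continuous d)
    (hbd : ∀ x₀, ∃ M, ∀ x, x₀ ≤ x → ‖d x‖ ≤ M * Real.exp (a * |x|)) {B : ℝ} (hB : 0 ≤ B)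
    (h : ∀ x, ‖d x‖ ≤ B * Real.exp (a * |x|)
      + ‖∫ y in Set.Ioi x, sinKernel k (y - x) * U y * d y‖) (x : ℝ) :
    ‖d x‖ ≤ B * jostBound α a β A * Real.exp (a * |x|) := by
  have wc := weight_continuous (α := α) (a := a) (β := β) (A := A)
  have w0 := hs.weight_nonneg
  have wi := hs.weight_integrable
  set w := jostWeight α a β A
  set g : ℝ → ℝ := fun x => ‖d x‖ * Real.exp (-(a * |x|)) with hg
  have gd : ∀ x, ‖d x‖ = g x * Real.exp (a * |x|) := by
    intro x
    rw [hg, mul_assoc, ← Real.exp_add]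
    simp
  have gc : Continuous g := by fun_prop
  have g0 : ∀ x, 0 ≤ g x := fun x => by positivity
  have hbd' : ∀ x₀, ∃ M, ∀ x, x₀ ≤ x → g x ≤ M := by
    intro x₀
    obtain ⟨M, hM⟩ := hbd x₀
    refine ⟨M, fun x hx => ?_⟩
    have := hM x hx
    rw [gd] at this
    exact le_of_mul_le_mul_right this (Real.exp_pos _)
  have key := gronwall_right wc w0 wi gc hB hbd' g0 (fun x => by
    obtain ⟨M, hM⟩ := hbd' x
    have hint : IntegrableOn (fun y => w y * g y) (Set.Ioi x) := by
      refine Integrable.mono' (wi.mul_const M).integrableOn (wc.mul gc).aestronglyMeasurable ?_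
      refine (ae_restrict_iff' measurableSet_Ioi).2 (ae_of_all _ fun z hz => ?_)
      rw [Real.norm_of_nonneg (mul_nonneg (w0 z) (g0 z))]
      exact mul_le_mul_of_nonneg_left (hM z (le_of_lt hz)) (w0 z)
    have h1 : ‖∫ y in Set.Ioi x, sinKernel k (y - x) * U y * d y‖
        ≤ Real.exp (a * |x|) * ∫ y in Set.Ioi x, w y * g y := by
      rw [← integral_const_mul]
      exact norm_integral_le_of_norm_le (hint.const_mul _)
        (ae_of_all _ fun y => hs.kernel_mul_bound hk x y (gd y).le)
    have h2 := (h x).trans (add_le_add le_rfl h1)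
    rw [gd, mul_comm B, ← mul_add, mul_comm (g x)] at h2
    exact le_of_mul_le_mul_left h2 (Real.exp_pos _)) x
  rw [gd]
  refine mul_le_mul_of_nonneg_right (key.trans (le_of_eq ?_)) (Real.exp_pos _).le
  unfold jostBound
  ring

/-- Grönwall with source `e^{ikx}`. The bound holds for every function satisfying `IsJostPlus`, so
the choice made in `jostPlus` is immaterial. -/
lemma norm_isJostPlus_le {k : ℂ} (hk : |k.im| ≤ α) {f : ℝ → ℂ} (hf : IsJostPlus U k f) (x : ℝ) :
    ‖f x‖ ≤ jostBound α a β A * Real.exp (a * |x|) := by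
  have := hs.norm_le_of_le_add_integral hk hf.continuous (fun x₀ => ?_) zero_le_one (fun x => ?_) x
  · simpa using this
  -- A priori boundedness on `[x₀, ∞)`: from the asymptotics far out, from compactness on the rest.
  · have h1 := (hf.asymptotic.norm.eventually (gt_mem_nhds (show ‖(1 : ℂ)‖ < 2 by simp)))
    obtain ⟨X, hX⟩ := eventually_atTop.1 h1
    obtain ⟨C, hC⟩ := (isCompact_Icc (a := x₀) (b := X)).exists_bound_of_continuousOn
      hf.continuous.continuousOn
    have ha := hs.a_pos
    refine ⟨max C 2, fun x hx => ?_⟩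
    rcases le_total X x with hxX | hxX
    · have h2 := (hX x hxX).le
      have h3 : f x = (f x * Complex.exp (-(Complex.I * k * x))) * Complex.exp (Complex.I * k * x) := by
        rw [mul_assoc, ← Complex.exp_add]
        simp
      rw [h3, norm_mul]
      gcongr
      · exact h2.trans (le_max_right _ _)
      · exact norm_exp_I_mul_le (hk.trans hs.alpha_lt.le) x
    · refine (hC x ⟨hx, hxX⟩).trans ((le_max_left C 2).trans ?_)
      exact le_mul_of_one_le_right (by positivity) (Real.one_le_exp (by positivity))
  · rw [one_mul]
    nth_rewrite 1 [hf.volterra x]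
    refine (norm_add_le _ _).trans (add_le_add ?_ le_rfl)
    exact norm_exp_I_mul_le (hk.trans hs.alpha_lt.le) x

section Solution

variable {k : ℂ} (hk : |k.im| ≤ α) {f : ℝ → ℂ} (hf : Continuous f) {M : ℝ}
  (hM : ∀ y, ‖f y‖ ≤ M * Real.exp (a * |y|))
include hk hf hM

-- The integrand is at most a constant times `e^{a(y-x)} e^{-βy} e^{ay}`, whose tail integral is of
-- order `e^{-(β-a)x}`. Leaving `K` general covers both the sine kernel (for `f`) and the cosine
-- kernel (for `f'`).
omit hk hf in
lemma tail_bound {x : ℝ} (hx : 0 ≤ x) {K : ℝ → ℂ} {c : ℝ} (hc : 0 ≤ c)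
    (hK : ∀ s, ‖K s‖ ≤ c * Real.exp (a * |s|)) :
    ‖∫ y in Set.Ioi x, K (y - x) * U y * f y‖
      ≤ c * M * A / (β - 2 * a) * Real.exp (-(β - a) * x) := by
  have hγ := hs.lt_beta
  have M0 : 0 ≤ M := by
    have := (norm_nonneg _).trans (hM 0)
    simpa using this
  have hi : ∫ y in Set.Ioi x, Real.exp (-(β - 2 * a) * y)
      = Real.exp (-(β - 2 * a) * x) / (β - 2 * a) := by
    rw [integral_exp_mul_Ioi (by linarith)]
    rw [neg_div_neg_eq]
  have e : c * M * A / (β - 2 * a) * Real.exp (-(β - a) * x)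
      = ∫ y in Set.Ioi x, (c * M * A * Real.exp (-(a * x))) * Real.exp (-(β - 2 * a) * y) := by
    rw [integral_const_mul, hi, show -(β - a) * x = -(a * x) + -(β - 2 * a) * x by ring,
      Real.exp_add]
    ring
  rw [e]
  refine norm_integral_le_of_norm_le ((exp_neg_integrableOn_Ioi x hγ).const_mul _) ?_
  refine (ae_restrict_iff' measurableSet_Ioi).2 (ae_of_all _ fun y hy => ?_)
  have hy' : x < y := hy
  have hK' := hK (y - x)
  rw [abs_of_pos (sub_pos.2 hy')] at hK'
  have hU := hs.bound y
  have hfy := hM y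
  rw [abs_of_pos (hx.trans_lt hy')] at hU hfy
  rw [norm_mul, norm_mul]
  have hA := hs.amp_nonneg
  calc ‖K (y - x)‖ * ‖U y‖ * ‖f y‖
      ≤ (c * Real.exp (a * (y - x))) * (A * Real.exp (-β * y)) * (M * Real.exp (a * y)) := by
        gcongr
    _ = c * M * A * (Real.exp (a * (y - x)) * Real.exp (-β * y) * Real.exp (a * y)) := by ring
    _ = _ := by
        rw [mul_assoc (c * M * A), ← Real.exp_add, ← Real.exp_add, ← Real.exp_add]
        ring_nf

lemma volterraDeriv_eq (x : ℝ) :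
    volterraDeriv U k f x = Complex.I * k * Complex.exp (Complex.I * k * x)
      - ((∫ y : ℝ in Set.Ioi x, Complex.cos (k * y) * U y * f y) * Complex.cos (k * x)
        + k ^ 2 * ((∫ y in Set.Ioi x, sinKernel k y * U y * f y) * sinKernel k x)) := by
  unfold volterraDeriv
  rw [← integral_mul_const, ← integral_mul_const, ← integral_const_mul, ← integral_add]
  · congr 1
    refine integral_congr_ae (ae_of_all _ fun y => ?_)
    simp only [cos_mul_sub]
    ring
  · exact ((hs.integrable_cos hk hf hM).mul_const _).integrableOn
  · exact (((hs.integrable_sinKernel hk hf hM).mul_const _).const_mul _).integrableOn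

lemma hasDerivAt_tails (x : ℝ) :
    HasDerivAt (fun x => ∫ y in Set.Ioi x, sinKernel k y * U y * f y)
        (-(sinKernel k x * U x * f x)) x ∧
      HasDerivAt (fun x : ℝ => ∫ y : ℝ in Set.Ioi x, Complex.cos (k * y) * U y * f y)
        (-(Complex.cos (k * x) * U x * f x)) x := by
  have hU := hs.continuous
  have hsc := continuous_sinKernel k
  exact ⟨hasDerivAt_integral_Ioi (by fun_prop) (hs.integrable_sinKernel hk hf hM) x,
    hasDerivAt_integral_Ioi (by fun_prop) (hs.integrable_cos hk hf hM) x⟩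

variable (hV : ∀ x, f x = Complex.exp (Complex.I * k * x)
        + ∫ y in Set.Ioi x, sinKernel k (y - x) * U y * f y)
include hV

/-- Differentiate the separated form from `sinKernel_sub`; the two boundary terms at `y = x` cancel,
since the kernel vanishes on the diagonal. -/
lemma hasDerivAt_solution (x : ℝ) : HasDerivAt f (volterraDeriv U k f x) x := by
  obtain ⟨h1, h2⟩ := hs.hasDerivAt_tails hk hf hM x
  have e : f = fun x : ℝ => Complex.exp (Complex.I * k * x)
      + ((∫ y in Set.Ioi x, sinKernel k y * U y * f y) * Complex.cos (k * x)
        - (∫ y : ℝ in Set.Ioi x, Complex.cos (k * y) * U y * f y) * sinKernel k x) := by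
    funext x
    rw [← hs.integral_kernel_eq hk hf hM x]
    exact hV x
  rw [hs.volterraDeriv_eq hk hf hM]
  have h3 := (hasDerivAt_exp_I_mul k x).add ((h1.mul (hasDerivAt_cos_mul k x)).sub
    (h2.mul (hasDerivAt_sinKernel k x)))
  refine HasDerivAt.congr_deriv (f' := _) (h3.congr_of_eventuallyEq ?_) ?_
  · exact Eventually.of_forall fun y => congrFun e y
  · ring

/-- Here the kernel equals `1` on the diagonal, by `cos² + k² (sin/k)² = 1`, and the boundary term
is `U f`; the rest reassembles to `-k² f` by the Volterra equation. -/
lemma hasDerivAt_volterraDeriv (x : ℝ) :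
    HasDerivAt (volterraDeriv U k f) ((U x - k ^ 2) * f x) x := by
  obtain ⟨h1, h2⟩ := hs.hasDerivAt_tails hk hf hM x
  have h3 := ((hasDerivAt_exp_I_mul k x).const_mul (Complex.I * k)).sub
    ((h2.mul (hasDerivAt_cos_mul k x)).add
      ((h1.mul (hasDerivAt_sinKernel k x)).const_mul (k ^ 2)))
  refine HasDerivAt.congr_deriv (f' := _) (h3.congr_of_eventuallyEq ?_) ?_
  · exact Eventually.of_forall fun y => hs.volterraDeriv_eq hk hf hM y
  · have e := hV x
    rw [hs.integral_kernel_eq hk hf hM x] at e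
    have e2 := cos_sq_add_sinKernel_sq k x
    set S := ∫ y in Set.Ioi x, sinKernel k y * U y * f y
    set C := ∫ y : ℝ in Set.Ioi x, Complex.cos (k * y) * U y * f y
    set s := sinKernel k x
    set c := Complex.cos (k * x)
    set E := Complex.exp (Complex.I * k * x)
    linear_combination (U x * f x) * e2 + k ^ 2 * e + k ^ 2 * E * Complex.I_sq

omit hV hf

lemma norm_volterraDeriv_le (x : ℝ) :
    ‖volterraDeriv U k f x‖ ≤ (‖k‖ + M * A * ∫ y, Real.exp (-(β - 2 * a) * |y|))
      * Real.exp (a * |x|) := by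
  unfold volterraDeriv
  have hka := hk.trans hs.alpha_lt.le
  have ha := hs.a_pos
  have hA := hs.amp_nonneg
  have M0 : 0 ≤ M := by
    have := (norm_nonneg _).trans (hM 0)
    simpa using this
  rw [add_mul]
  refine (norm_sub_le _ _).trans (add_le_add ?_ ?_)
  · rw [norm_mul, norm_mul, Complex.norm_I, one_mul]
    gcongr
    exact norm_exp_I_mul_le hka x
  · have hi := (integrable_exp_weight hs.lt_beta).const_mul (M * A * Real.exp (a * |x|))
    calc ‖∫ y : ℝ in Set.Ioi x, Complex.cos (k * (y - x : ℝ)) * U y * f y‖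
        ≤ ∫ y in Set.Ioi x, M * A * Real.exp (a * |x|) * Real.exp (-(β - 2 * a) * |y|) := by
          refine norm_integral_le_of_norm_le hi.integrableOn (ae_of_all _ fun y => ?_)
          have h1 : ‖Complex.cos (k * (y - x : ℝ))‖
              ≤ Real.exp (a * |y|) * Real.exp (a * |x|) := by
            refine (norm_cos_mul_le_exp hka _).trans ?_
            rw [← Real.exp_add, ← mul_add]
            gcongr
            exact abs_sub y x
          rw [norm_mul, norm_mul]
          calc ‖Complex.cos (k * (y - x : ℝ))‖ * ‖U y‖ * ‖f y‖
              ≤ (Real.exp (a * |y|) * Real.exp (a * |x|)) * ‖U y‖ * (M * Real.exp (a * |y|)) := by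
                gcongr
                exact hM y
            _ = M * Real.exp (a * |x|) * (‖U y‖ * Real.exp (a * |y|) * Real.exp (a * |y|)) := by
                ring
            _ ≤ M * Real.exp (a * |x|) * (A * Real.exp (-(β - 2 * a) * |y|)) := by
                have := hs.mul_exp_bound y
                gcongr
            _ = _ := by ring
      _ ≤ ∫ y, M * A * Real.exp (a * |x|) * Real.exp (-(β - 2 * a) * |y|) :=
          setIntegral_le_integral hi (ae_of_all _ fun y => by positivity)
      _ = _ := by
          rw [integral_const_mul]
          ring

end Solution

/-- The asymptotics follow from `tail_bound`: the remainder `e^{-(β-a)x}` still decays after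
multiplication by `e^{-ikx}`, of size at most `e^{ax}`. -/
lemma exists_isJostPlus {k : ℂ} (hk : |k.im| ≤ α) : ∃ f, IsJostPlus U k f := by
  obtain ⟨f, hf, ⟨M, hM⟩, hV⟩ := hs.exists_volterra hk
  refine ⟨f, hf, ?_, fun x => (hs.integrable_kernel hk hf hM x).integrableOn, hV⟩
  have h0 := sub_pos.2 hs.alpha_lt
  rw [tendsto_iff_norm_sub_tendsto_zero]
  have hlim : Tendsto (fun x : ℝ => 1 / (a - α) * M * A / (β - 2 * a)
      * Real.exp (-(β - 2 * a) * x)) atTop (𝓝 0) := by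
    have h1 : Tendsto (fun x : ℝ => -(β - 2 * a) * x) atTop atBot :=
      tendsto_id.const_mul_atTop_of_neg (by linarith [hs.lt_beta])
    simpa using (Real.tendsto_exp_atBot.comp h1).const_mul (1 / (a - α) * M * A / (β - 2 * a))
  refine squeeze_zero' (Eventually.of_forall fun _ => norm_nonneg _) ?_ hlim
  filter_upwards [eventually_ge_atTop 0] with x hx
  have h1 := hs.tail_bound hM hx (K := sinKernel k) (c := 1 / (a - α)) (by positivity)
    (norm_sinKernel_le_exp hs.alpha_lt hk)
  have e : f x * Complex.exp (-(Complex.I * k * x)) - 1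
      = (∫ y in Set.Ioi x, sinKernel k (y - x) * U y * f y)
        * Complex.exp (-(Complex.I * k * x)) := by
    rw [hV x, add_mul, ← Complex.exp_add]
    simp
  have h2 : ‖Complex.exp (-(Complex.I * k * x))‖ ≤ Real.exp (a * x) := by
    have := norm_exp_I_mul_le (k := -k) (a := a) (by simpa using hk.trans hs.alpha_lt.le) x
    rw [abs_of_nonneg hx] at this
    simpa using this
  rw [e, norm_mul]
  refine (mul_le_mul h1 h2 (norm_nonneg _) ((norm_nonneg _).trans h1)).trans (le_of_eq ?_)
  rw [mul_assoc, ← Real.exp_add]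
  ring_nf

lemma isJostPlus {k : ℂ} (hk : |k.im| ≤ α) : IsJostPlus U k (jostPlus U k) :=
  Classical.epsilon_spec (hs.exists_isJostPlus hk)

end JostSetting

/-! ### Reflection -/

lemma integral_Iio_kernel_eq (U : ℝ → ℂ) (k : ℂ) (f : ℝ → ℂ) (x : ℝ) :
    ∫ y in Set.Iio x, sinKernel k (y - x) * U y * f y
      = -∫ y in Set.Ioi (-x), sinKernel k (y - -x) * U (-y) * f (-y) := by
  rw [← integral_Iic_eq_integral_Iio, ← neg_neg x, ← integral_comp_neg_Ioi, neg_neg x,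
    ← integral_neg]
  refine integral_congr_ae (ae_of_all _ fun y => ?_)
  have : -y - x = -(y - -x) := by ring
  simp only [this, sinKernel_neg]
  ring

lemma integrableOn_Iio_kernel_iff (U : ℝ → ℂ) (k : ℂ) (f : ℝ → ℂ) (x : ℝ) :
    IntegrableOn (fun y => sinKernel k (y - x) * U y * f y) (Set.Iio x) ↔
      IntegrableOn (fun y => sinKernel k (y - -x) * U (-y) * f (-y)) (Set.Ioi (-x)) := by
  have e : (fun y => sinKernel k (y - -x) * U (-y) * f (-y))
      = fun y => -(fun y => sinKernel k (y - x) * U y * f y) (-y) := by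
    funext y
    have : -y - x = -(y - -x) := by ring
    simp only [this, sinKernel_neg]
    ring
  rw [e, integrableOn_fun_neg_iff, ← integrableOn_Iic_iff_integrableOn_Iio]
  have h := (Measure.measurePreserving_neg (volume : Measure ℝ)).integrableOn_comp_preimage
    (Homeomorph.neg ℝ).measurableEmbedding
    (f := fun y => sinKernel k (y - x) * U y * f y) (s := Set.Iic x)
  rw [← h, ← integrableOn_Ici_iff_integrableOn_Ioi]
  simp [Function.comp_def]

/-- The kernel is odd, which accounts for the opposite sign in the equation for `f_-`. Every
statement on `f_-` is obtained from one on `f_+` by reflecting `U`. -/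
lemma isJostMinus_iff (U : ℝ → ℂ) (k : ℂ) (f : ℝ → ℂ) :
    IsJostMinus U k f ↔ IsJostPlus (fun x => U (-x)) k (fun x => f (-x)) := by
  have key : ∀ x, (f x = Complex.exp (-(Complex.I * k * x))
      - ∫ y in Set.Iio x, sinKernel k (y - x) * U y * f y) ↔
      (f (- -x) = Complex.exp (Complex.I * k * (-x : ℝ))
      + ∫ y in Set.Ioi (-x), sinKernel k (y - -x) * U (-y) * f (-y)) := by
    intro x
    rw [integral_Iio_kernel_eq, neg_neg, sub_neg_eq_add]
    push_cast
    rw [mul_neg]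
  constructor
  · intro h
    refine ⟨h.continuous.comp continuous_neg, ?_, fun x => ?_, fun x => ?_⟩
    · have := h.asymptotic.comp tendsto_neg_atTop_atBot
      refine this.congr fun x => ?_
      simp
    · have := (integrableOn_Iio_kernel_iff U k f (-x)).1 (h.integrable (-x))
      simpa only [neg_neg] using this
    · have := (key (-x)).1 (h.volterra (-x))
      simpa only [neg_neg] using this
  · intro h
    have hc : Continuous f := by
      have := h.continuous.comp continuous_neg
      simpa [Function.comp_def] using this
    refine ⟨hc, ?_, fun x => ?_, fun x => ?_⟩
    · have := h.asymptotic.comp tendsto_neg_atBot_atTop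
      refine this.congr fun x => ?_
      simp
    · exact (integrableOn_Iio_kernel_iff U k f x).2 (h.integrable (-x))
    · exact (key x).2 (h.volterra (-x))

/-- The derivative of `f_+`. -/
def jostPlusDeriv (U : ℝ → ℂ) (k : ℂ) : ℝ → ℂ := volterraDeriv U k (jostPlus U k)

/-- The derivative of `f_-`. -/
def jostMinusDeriv (U : ℝ → ℂ) (k : ℂ) (x : ℝ) : ℂ :=
  -volterraDeriv (fun x => U (-x)) k (fun x => jostMinus U k (-x)) (-x)

/-- `f` solves `f'' = (U - k²) f`, with `f' = d`, and both are bounded by `M e^{a|x|}`. -/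
structure IsSchrodingerSolution (a M : ℝ) (U : ℝ → ℂ) (k : ℂ) (f d : ℝ → ℂ) : Prop where
  hasDerivAt : ∀ x, HasDerivAt f (d x) x
  hasDerivAt' : ∀ x, HasDerivAt d ((U x - k ^ 2) * f x) x
  bound : ∀ x, ‖f x‖ ≤ M * Real.exp (a * |x|)
  bound' : ∀ x, ‖d x‖ ≤ M * Real.exp (a * |x|)

/-- A bound for Jost solutions and their derivatives at wave numbers of modulus at most `B`. -/
def solutionBound (α a β A B : ℝ) : ℝ :=
  jostBound α a β A + (B + jostBound α a β A * A * ∫ y, Real.exp (-(β - 2 * a) * |y|))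

/-! ### Jost solutions as solutions of the Schrödinger equation, and their asymptotics. -/

namespace JostSetting

variable {α a β A : ℝ} {U : ℝ → ℂ} (hs : JostSetting α a β A U)
include hs

lemma reflect : JostSetting α a β A (fun x => U (-x)) :=
  ⟨hs.alpha_nonneg, hs.alpha_lt, hs.lt_beta, hs.continuous.comp continuous_neg, fun x => by
    simpa using hs.bound (-x)⟩

lemma isJostMinus {k : ℂ} (hk : |k.im| ≤ α) : IsJostMinus U k (jostMinus U k) := by
  obtain ⟨g, hg⟩ := hs.reflect.exists_isJostPlus hk
  refine Classical.epsilon_spec (p := IsJostMinus U k) ⟨fun x => g (-x), ?_⟩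
  rw [isJostMinus_iff]
  simpa using hg

lemma isJostPlus_reflect {k : ℂ} (hk : |k.im| ≤ α) :
    IsJostPlus (fun x => U (-x)) k (fun x => jostMinus U k (-x)) :=
  (isJostMinus_iff U k _).1 (hs.isJostMinus hk)

lemma isSchrodingerSolution_of_isJostPlus {k : ℂ} (hk : |k.im| ≤ α) {B : ℝ} (hB : ‖k‖ ≤ B)
    {f : ℝ → ℂ} (hf : IsJostPlus U k f) :
    IsSchrodingerSolution a (solutionBound α a β A B) U k f (volterraDeriv U k f) := by
  have hM := hs.norm_isJostPlus_le hk hf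
  have hb := jostBound_nonneg α a β A
  have hA := hs.amp_nonneg
  have hI : 0 ≤ ∫ y, Real.exp (-(β - 2 * a) * |y|) := integral_nonneg fun y => (Real.exp_pos _).le
  have hB0 := (norm_nonneg k).trans hB
  refine ⟨hs.hasDerivAt_solution hk hf.continuous hM hf.volterra,
    hs.hasDerivAt_volterraDeriv hk hf.continuous hM hf.volterra, fun x => ?_, fun x => ?_⟩
  · refine (hM x).trans ?_
    gcongr
    exact le_add_of_nonneg_right (by positivity)
  · refine (hs.norm_volterraDeriv_le hk hM x).trans ?_
    gcongr
    unfold solutionBound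
    have : ‖k‖ + jostBound α a β A * A * ∫ y, Real.exp (-(β - 2 * a) * |y|)
        ≤ B + jostBound α a β A * A * ∫ y, Real.exp (-(β - 2 * a) * |y|) := by gcongr
    linarith

lemma jostPlus_solution {k : ℂ} (hk : |k.im| ≤ α) {B : ℝ} (hB : ‖k‖ ≤ B) :
    IsSchrodingerSolution a (solutionBound α a β A B) U k (jostPlus U k) (jostPlusDeriv U k) :=
  hs.isSchrodingerSolution_of_isJostPlus hk hB (hs.isJostPlus hk)

lemma jostMinus_solution {k : ℂ} (hk : |k.im| ≤ α) {B : ℝ} (hB : ‖k‖ ≤ B) :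
    IsSchrodingerSolution a (solutionBound α a β A B) U k (jostMinus U k) (jostMinusDeriv U k) := by
  have h := hs.reflect.isSchrodingerSolution_of_isJostPlus hk hB (hs.isJostPlus_reflect hk)
  refine ⟨fun x => ?_, fun x => ?_, fun x => ?_, fun x => ?_⟩
  · have := (h.hasDerivAt (-x)).scomp x (hasDerivAt_neg x)
    simpa [Function.comp_def, jostMinusDeriv] using this
  · have := ((h.hasDerivAt' (-x)).scomp x (hasDerivAt_neg x)).neg
    refine (this.congr_of_eventuallyEq (Eventually.of_forall fun y => rfl)).congr_deriv ?_
    simp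
  · simpa using h.bound (-x)
  · simpa [jostMinusDeriv] using h.bound' (-x)

/-- Serves only to compute limits of Wronskians, so `D` may depend on everything but `x`. The rate
`β - a` beats the growth `e^{a|x|}` of a second solution. -/
lemma exists_asymptotic_of_isJostPlus {k : ℂ} (hk : |k.im| ≤ α) {f : ℝ → ℂ}
    (hf : IsJostPlus U k f) : ∃ D : ℝ, ∀ x, 0 ≤ x →
      ‖f x - Complex.exp (Complex.I * k * x)‖ ≤ D * Real.exp (-(β - a) * x) ∧
      ‖volterraDeriv U k f x - Complex.I * k * Complex.exp (Complex.I * k * x)‖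
        ≤ D * Real.exp (-(β - a) * x) := by
  have hM := hs.norm_isJostPlus_le hk hf
  have h0 := sub_pos.2 hs.alpha_lt
  have hka := hk.trans hs.alpha_lt.le
  set M := jostBound α a β A
  refine ⟨max (1 / (a - α) * M * A / (β - 2 * a)) (1 * M * A / (β - 2 * a)), fun x hx => ⟨?_, ?_⟩⟩
  · rw [hf.volterra x, add_sub_cancel_left]
    refine (hs.tail_bound hM hx (by positivity)
      (norm_sinKernel_le_exp hs.alpha_lt hk)).trans ?_
    gcongr
    exact le_max_left _ _
  · unfold volterraDeriv
    rw [sub_sub_cancel_left, norm_neg]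
    refine (hs.tail_bound (K := fun s => Complex.cos (k * s)) hM hx zero_le_one
      (fun s => by simpa using norm_cos_mul_le_exp hka s)).trans ?_
    gcongr
    exact le_max_right _ _

lemma exists_asymptotic_plus {k : ℂ} (hk : |k.im| ≤ α) : ∃ D : ℝ, ∀ x, 0 ≤ x →
      ‖jostPlus U k x - Complex.exp (Complex.I * k * x)‖ ≤ D * Real.exp (-(β - a) * |x|) ∧
      ‖jostPlusDeriv U k x - Complex.I * k * Complex.exp (Complex.I * k * x)‖
        ≤ D * Real.exp (-(β - a) * |x|) := by
  obtain ⟨D, hD⟩ := hs.exists_asymptotic_of_isJostPlus hk (hs.isJostPlus hk)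
  refine ⟨D, fun x hx => ?_⟩
  rw [abs_of_nonneg hx]
  exact hD x hx

lemma exists_asymptotic_minus {k : ℂ} (hk : |k.im| ≤ α) : ∃ D : ℝ, ∀ x, x ≤ 0 →
      ‖jostMinus U k x - Complex.exp (-(Complex.I * k * x))‖ ≤ D * Real.exp (-(β - a) * |x|) ∧
      ‖jostMinusDeriv U k x - -(Complex.I * k) * Complex.exp (-(Complex.I * k * x))‖
        ≤ D * Real.exp (-(β - a) * |x|) := by
  obtain ⟨D, hD⟩ := hs.reflect.exists_asymptotic_of_isJostPlus hk (hs.isJostPlus_reflect hk)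
  refine ⟨D, fun x hx => ?_⟩
  rw [abs_of_nonpos hx]
  obtain ⟨h1, h2⟩ := hD (-x) (neg_nonneg.2 hx)
  rw [← norm_neg] at h2
  constructor
  · simpa using h1
  · refine le_of_eq_of_le (congrArg _ ?_) h2
    unfold jostMinusDeriv
    push_cast
    ring_nf

/-! ### Continuity of Jost solutions at zero energy -/

-- From `|sin w - w| ≤ |w|² e^{|w|}` with `w = zs`; dividing by `z` leaves one power of `|z|`.
omit hs in
lemma norm_sinKernel_sub_zero_le {z : ℂ} (s : ℝ) :
    ‖sinKernel z s - sinKernel 0 s‖ ≤ ‖z‖ * (|s| * (|s| * Real.exp (‖z‖ * |s|))) := by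
  by_cases hz : z = 0
  · simp [hz]
  have e : sinKernel z s - sinKernel 0 s = (Complex.sin (z * s) - z * s) / z := by
    unfold sinKernel
    simp only [hz, if_true, if_false]
    field_simp
  have h : ∀ w : ℂ, ‖Complex.sin w - w‖ ≤ ‖w‖ ^ 2 * Real.exp ‖w‖ := by
    intro w
    have h1 := Complex.norm_exp_sub_sum_le_norm_mul_exp (-w * Complex.I) 2
    have h2 := Complex.norm_exp_sub_sum_le_norm_mul_exp (w * Complex.I) 2
    simp only [Finset.sum_range_succ, Finset.sum_range_zero, norm_mul, norm_neg, Complex.norm_I,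
      mul_one, pow_zero, pow_one, zero_add, Nat.factorial_zero, Nat.factorial_one, Nat.cast_one,
      div_one] at h1 h2
    have e2 : Complex.sin w - w = ((Complex.exp (-w * Complex.I) - (1 + -w * Complex.I))
        - (Complex.exp (w * Complex.I) - (1 + w * Complex.I))) * Complex.I / 2 := by
      rw [Complex.sin]
      linear_combination -w * Complex.I_sq
    rw [e2, norm_div, norm_mul, Complex.norm_I, mul_one, Complex.norm_ofNat,
      div_le_iff₀ two_pos]
    refine (norm_sub_le _ _).trans ?_
    linarith
  rw [e, norm_div, div_le_iff₀ (norm_pos_iff.2 hz)]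
  refine (h _).trans (le_of_eq ?_)
  rw [norm_mul, Complex.norm_real, Real.norm_eq_abs]
  ring

/-- The difference solves the Volterra equation for `z` with a source of order `|z|`, and Grönwall
applies. The value of `C` is part of the statement to show that it does not depend on `z`. -/
lemma norm_isJostPlus_sub_le {z : ℂ} (hz : ‖z‖ ≤ α) {f f₀ : ℝ → ℂ} (hf : IsJostPlus U z f)
    (hf₀ : IsJostPlus U 0 f₀) : ∃ C : ℝ, (∀ x, ‖f x - f₀ x‖ ≤ ‖z‖ * C * Real.exp (a * |x|)) ∧
      C = (1 / (a - α) + 2 / (a - α) * (2 / (a - α)) * jostBound α a β A * A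
        * ∫ y, Real.exp (-(β - 2 * a) * |y|)) * jostBound α a β A := by
  refine ⟨_, fun x => ?_, rfl⟩
  have h0 := sub_pos.2 hs.alpha_lt
  have hA := hs.amp_nonneg
  have ha := hs.a_pos
  have hkz : |z.im| ≤ α := (Complex.abs_im_le_norm z).trans hz
  have hk0 : |(0 : ℂ).im| ≤ α := by simpa using hs.alpha_nonneg
  have b := hs.norm_isJostPlus_le hkz hf
  have b₀ := hs.norm_isJostPlus_le hk0 hf₀
  set M := jostBound α a β A with hM
  have M0 : 0 ≤ M := jostBound_nonneg α a β A
  set I := ∫ y, Real.exp (-(β - 2 * a) * |y|)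
  have hI : 0 ≤ I := integral_nonneg fun y => (Real.exp_pos _).le
  have := hs.norm_le_of_le_add_integral hkz (hf.continuous.sub hf₀.continuous)
    (B := ‖z‖ * (1 / (a - α) + 2 / (a - α) * (2 / (a - α)) * M * A * I))
    (fun x₀ => ⟨2 * M, fun x _ => by
      refine (norm_sub_le _ _).trans ?_
      linarith [b x, b₀ x]⟩) (by positivity) (fun x => ?_) x
  · refine this.trans (le_of_eq ?_)
    ring
  · have i1 := (hs.integrable_kernel hkz hf.continuous b x).integrableOn (s := Set.Ioi x)
    have i2 := (hs.integrable_kernel hkz hf₀.continuous b₀ x).integrableOn (s := Set.Ioi x)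
    have i3 := (hs.integrable_kernel hk0 hf₀.continuous b₀ x).integrableOn (s := Set.Ioi x)
    have e : f x - f₀ x = (Complex.exp (Complex.I * z * x) - 1)
        + (∫ y in Set.Ioi x, (sinKernel z (y - x) - sinKernel 0 (y - x)) * U y * f₀ y)
        + ∫ y in Set.Ioi x, sinKernel z (y - x) * U y * (f y - f₀ y) := by
      have e1 : ∫ y in Set.Ioi x, (sinKernel z (y - x) - sinKernel 0 (y - x)) * U y * f₀ y
          = (∫ y in Set.Ioi x, sinKernel z (y - x) * U y * f₀ y)
            - ∫ y in Set.Ioi x, sinKernel 0 (y - x) * U y * f₀ y := by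
        rw [← integral_sub i2 i3]
        simp only [sub_mul]
      have e2 : ∫ y in Set.Ioi x, sinKernel z (y - x) * U y * (f y - f₀ y)
          = (∫ y in Set.Ioi x, sinKernel z (y - x) * U y * f y)
            - ∫ y in Set.Ioi x, sinKernel z (y - x) * U y * f₀ y := by
        rw [← integral_sub i1 i2]
        simp only [mul_sub]
      rw [e1, e2, hf.volterra x, hf₀.volterra x]
      simp only [mul_zero, zero_mul, Complex.exp_zero]
      ring
    have n1 : ‖Complex.exp (Complex.I * z * x) - 1‖
        ≤ ‖z‖ * (1 / (a - α)) * Real.exp (a * |x|) := by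
      have h1 := Complex.norm_exp_sub_sum_le_norm_mul_exp (Complex.I * z * x) 1
      simp only [Finset.sum_range_one, pow_zero, Nat.factorial_zero, Nat.cast_one, div_one,
        pow_one, norm_mul, Complex.norm_I, one_mul, Complex.norm_real, Real.norm_eq_abs] at h1
      calc _ ≤ ‖z‖ * |x| * Real.exp (‖z‖ * |x|) := h1
        _ ≤ ‖z‖ * |x| * Real.exp (α * |x|) := by gcongr
        _ = ‖z‖ * (|x| * Real.exp (α * |x|)) := by ring
        _ ≤ ‖z‖ * (1 / (a - α) * Real.exp (a * |x|)) := by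
          have := mul_exp_le hs.alpha_lt x
          gcongr
        _ = _ := by ring
    have n2 : ‖∫ y in Set.Ioi x, (sinKernel z (y - x) - sinKernel 0 (y - x)) * U y * f₀ y‖
        ≤ ‖z‖ * (2 / (a - α) * (2 / (a - α)) * M * A * I) * Real.exp (a * |x|) := by
      have hK : ∀ s : ℝ, ‖sinKernel z s - sinKernel 0 s‖
          ≤ ‖z‖ * (2 / (a - α) * (2 / (a - α))) * Real.exp (a * |s|) := by
        intro s
        -- Two factors `|s|` have to be absorbed: one from `α` to the midpoint `(α + a)/2`, one from
        -- there to `a`.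
        have m1 := mul_exp_le (show α < (α + a) / 2 by linarith) s
        have m2 := mul_exp_le (show (α + a) / 2 < a by linarith) s
        have q1 : 1 / ((α + a) / 2 - α) = 2 / (a - α) := by
          rw [show (α + a) / 2 - α = (a - α) / 2 by ring, one_div_div]
        have q2 : 1 / (a - (α + a) / 2) = 2 / (a - α) := by
          rw [show a - (α + a) / 2 = (a - α) / 2 by ring, one_div_div]
        rw [q1] at m1
        rw [q2] at m2
        calc ‖sinKernel z s - sinKernel 0 s‖
            ≤ ‖z‖ * (|s| * (|s| * Real.exp (‖z‖ * |s|))) := norm_sinKernel_sub_zero_le s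
          _ ≤ ‖z‖ * (|s| * (|s| * Real.exp (α * |s|))) := by gcongr
          _ ≤ ‖z‖ * (|s| * (2 / (a - α) * Real.exp ((α + a) / 2 * |s|))) := by gcongr
          _ = ‖z‖ * (2 / (a - α) * (|s| * Real.exp ((α + a) / 2 * |s|))) := by ring
          _ ≤ ‖z‖ * (2 / (a - α) * (2 / (a - α) * Real.exp (a * |s|))) := by gcongr
          _ = _ := by ring
      set c := ‖z‖ * (2 / (a - α) * (2 / (a - α))) with hc
      have c0 : 0 ≤ c := by positivity
      have hi := (integrable_exp_weight hs.lt_beta).const_mul (c * M * A * Real.exp (a * |x|))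
      calc _ ≤ ∫ y in Set.Ioi x, c * M * A * Real.exp (a * |x|)
              * Real.exp (-(β - 2 * a) * |y|) := by
            refine norm_integral_le_of_norm_le hi.integrableOn (ae_of_all _ fun y => ?_)
            have h1 : ‖sinKernel z (y - x) - sinKernel 0 (y - x)‖
                ≤ c * (Real.exp (a * |y|) * Real.exp (a * |x|)) := by
              refine (hK _).trans ?_
              rw [← Real.exp_add, ← mul_add]
              gcongr
              exact abs_sub y x
            rw [norm_mul, norm_mul]
            calc ‖sinKernel z (y - x) - sinKernel 0 (y - x)‖ * ‖U y‖ * ‖f₀ y‖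
                ≤ (c * (Real.exp (a * |y|) * Real.exp (a * |x|))) * ‖U y‖
                  * (M * Real.exp (a * |y|)) := by
                  gcongr
                  exact b₀ y
              _ = c * M * Real.exp (a * |x|)
                  * (‖U y‖ * Real.exp (a * |y|) * Real.exp (a * |y|)) := by ring
              _ ≤ c * M * Real.exp (a * |x|) * (A * Real.exp (-(β - 2 * a) * |y|)) := by
                  have := hs.mul_exp_bound y
                  gcongr
              _ = _ := by ring
        _ ≤ ∫ y, c * M * A * Real.exp (a * |x|) * Real.exp (-(β - 2 * a) * |y|) :=
            setIntegral_le_integral hi (ae_of_all _ fun y => by positivity)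
        _ = _ := by
            rw [integral_const_mul, hc]
            ring
    rw [Pi.sub_apply, e]
    refine (norm_add_le _ _).trans (add_le_add ((norm_add_le _ _).trans ?_) le_rfl)
    refine (add_le_add n1 n2).trans (le_of_eq ?_)
    ring

/-- Pointwise convergence comes from the preceding estimate, that of the derivatives from dominated
convergence. The family `f` is arbitrary so that the result applies to reflected potentials too. -/
lemma tendsto_isJostPlus_zero (hα : 0 < α) {f : ℂ → ℝ → ℂ}
    (hf : ∀ z : ℂ, |z.im| ≤ α → IsJostPlus U z (f z)) :
    Tendsto (fun z => f z 0) (𝓝 0) (𝓝 (f 0 0)) ∧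
    Tendsto (fun z => volterraDeriv U z (f z) 0) (𝓝 0) (𝓝 (volterraDeriv U 0 (f 0) 0)) := by
  have hk0 : |(0 : ℂ).im| ≤ α := by simpa using hα.le
  have hnear : ∀ᶠ z : ℂ in 𝓝 0, ‖z‖ ≤ α := by
    have : Tendsto (fun z : ℂ => ‖z‖) (𝓝 0) (𝓝 0) := by simpa using tendsto_norm_zero (E := ℂ)
    exact (this.eventually (gt_mem_nhds hα)).mono fun z hz => le_of_lt hz
  have hk : ∀ z : ℂ, ‖z‖ ≤ α → |z.im| ≤ α := fun z hz => (Complex.abs_im_le_norm z).trans hz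
  have hpt : ∀ x, Tendsto (fun z => f z x) (𝓝 0) (𝓝 (f 0 x)) := by
    intro x
    rw [tendsto_iff_norm_sub_tendsto_zero]
    set C := (1 / (a - α) + 2 / (a - α) * (2 / (a - α)) * jostBound α a β A * A
        * ∫ y, Real.exp (-(β - 2 * a) * |y|)) * jostBound α a β A with hC
    have hlim : Tendsto (fun z : ℂ => ‖z‖ * C * Real.exp (a * |x|)) (𝓝 0) (𝓝 0) := by
      have : Continuous (fun z : ℂ => ‖z‖ * C * Real.exp (a * |x|)) := by fun_prop
      simpa using this.tendsto 0
    refine squeeze_zero' (Eventually.of_forall fun _ => norm_nonneg _) ?_ hlim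
    filter_upwards [hnear] with z hz
    obtain ⟨C', h1, h2⟩ := hs.norm_isJostPlus_sub_le hz (hf z (hk z hz)) (hf 0 hk0)
    rw [hC, ← h2]
    exact h1 x
  refine ⟨hpt 0, ?_⟩
  unfold volterraDeriv
  refine Tendsto.sub ?_ ?_
  · have : Continuous (fun z : ℂ => Complex.I * z * Complex.exp (Complex.I * z * (0 : ℝ))) := by
      fun_prop
    exact this.tendsto 0
  · have hi := (integrable_exp_weight hs.lt_beta).const_mul (jostBound α a β A * A)
    refine tendsto_integral_filter_of_dominated_convergence _ ?_ ?_ hi.integrableOn ?_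
    · filter_upwards [hnear] with z hz
      have h1 := (hf z (hk z hz)).continuous
      have h2 := hs.continuous
      exact Continuous.aestronglyMeasurable (by fun_prop)
    · filter_upwards [hnear] with z hz
      refine ae_of_all _ fun y => ?_
      rw [sub_zero]
      exact hs.cos_bound (hk z hz) y (hs.norm_isJostPlus_le (hk z hz) (hf z (hk z hz)) y)
    · refine ae_of_all _ fun y => ?_
      have h1 : Tendsto (fun z : ℂ => Complex.cos (z * (y - 0 : ℝ))) (𝓝 0)
          (𝓝 (Complex.cos (0 * (y - 0 : ℝ)))) := by
        have : Continuous (fun z : ℂ => Complex.cos (z * (y - 0 : ℝ))) := by fun_prop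
        exact this.tendsto 0
      exact (h1.mul tendsto_const_nhds).mul (hpt y)

end JostSetting

/-! ### Wronskians -/

/-- The Wronskian of `f_+` and `f_-`, evaluated at the origin. -/
def jostWronskian (U : ℝ → ℂ) (k : ℂ) : ℂ :=
  jostPlus U k 0 * jostMinusDeriv U k 0 - jostPlusDeriv U k 0 * jostMinus U k 0

/-- The `k²` terms and `f' g'` cancel. Different potentials are allowed for the perturbation
formula, and only `k₁² = k₂²` is asked so as to pair `k` with `-k`. -/
lemma IsSchrodingerSolution.hasDerivAt_wronskian {a₁ a₂ M₁ M₂ : ℝ} {U₁ U₂ : ℝ → ℂ} {k₁ k₂ : ℂ}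
    {f d g e : ℝ → ℂ} (h₁ : IsSchrodingerSolution a₁ M₁ U₁ k₁ f d)
    (h₂ : IsSchrodingerSolution a₂ M₂ U₂ k₂ g e) (hk : k₁ ^ 2 = k₂ ^ 2) (x : ℝ) :
    HasDerivAt (fun x => f x * e x - d x * g x) ((U₂ x - U₁ x) * (f x * g x)) x := by
  have := ((h₁.hasDerivAt x).mul (h₂.hasDerivAt' x)).sub
    ((h₁.hasDerivAt' x).mul (h₂.hasDerivAt x))
  refine this.congr_deriv ?_
  rw [hk]
  ring

lemma IsSchrodingerSolution.wronskian_eq {a₁ a₂ M₁ M₂ : ℝ} {U : ℝ → ℂ} {k₁ k₂ : ℂ}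
    {f d g e : ℝ → ℂ} (h₁ : IsSchrodingerSolution a₁ M₁ U k₁ f d)
    (h₂ : IsSchrodingerSolution a₂ M₂ U k₂ g e) (hk : k₁ ^ 2 = k₂ ^ 2) (x y : ℝ) :
    f x * e x - d x * g x = f y * e y - d y * g y := by
  have h := fun x => h₁.hasDerivAt_wronskian h₂ hk x
  simp only [sub_self, zero_mul] at h
  exact is_const_of_deriv_eq_zero (fun x => (h x).differentiableAt) (fun x => (h x).deriv) x y

/-- The product of a function of order `e^{a|x|}` with one of order `e^{-(β-a)|x|}` decays. -/
lemma tendsto_zero_of_growth_mul_decay {a β M D : ℝ} (h : 0 < β - 2 * a) {l : Filter ℝ}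
    (hl : Tendsto (fun x : ℝ => |x|) l atTop) {p q : ℝ → ℂ}
    (hp : ∀ x, ‖p x‖ ≤ M * Real.exp (a * |x|))
    (hq : ∀ᶠ x in l, ‖q x‖ ≤ D * Real.exp (-(β - a) * |x|)) :
    Tendsto (fun x => p x * q x) l (𝓝 0) := by
  rw [tendsto_zero_iff_norm_tendsto_zero]
  have hlim : Tendsto (fun x : ℝ => M * D * Real.exp (-(β - 2 * a) * |x|)) l (𝓝 0) := by
    have h1 : Tendsto (fun x : ℝ => -(β - 2 * a) * |x|) l atBot :=
      hl.const_mul_atTop_of_neg (by linarith)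
    simpa using (Real.tendsto_exp_atBot.comp h1).const_mul (M * D)
  refine squeeze_zero' (Eventually.of_forall fun _ => norm_nonneg _) ?_ hlim
  filter_upwards [hq] with x hx
  rw [norm_mul]
  refine (mul_le_mul (hp x) hx (norm_nonneg _) ((norm_nonneg _).trans (hp x))).trans (le_of_eq ?_)
  rw [show -(β - 2 * a) * |x| = a * |x| + -(β - a) * |x| by ring, Real.exp_add]
  ring

lemma norm_sub_le_of_common {f g e : ℂ} {D₁ D₂ E : ℝ} (hf : ‖f - e‖ ≤ D₁ * E)
    (hg : ‖g - e‖ ≤ D₂ * E) : ‖f - g‖ ≤ (D₁ + D₂) * E := by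
  have : f - g = (f - e) - (g - e) := by ring
  rw [this, add_mul]
  exact (norm_sub_le _ _).trans (add_le_add hf hg)

/-! ### The transmission coefficient as a Wronskian. -/

namespace JostSetting

variable {α a β A : ℝ} {U : ℝ → ℂ} (hs : JostSetting α a β A U)
include hs

/-- The Wronskian is constant, and at `-∞` it is that of `e^{-ikx}` and `e^{ikx}`. -/
lemma wronskian_minus {k : ℂ} (hk : |k.im| ≤ α) (x : ℝ) :
    jostMinus U k x * jostMinusDeriv U (-k) x - jostMinusDeriv U k x * jostMinus U (-k) x
      = 2 * Complex.I * k := by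
  have hk' : |(-k).im| ≤ α := by simpa using hk
  have h₁ := hs.jostMinus_solution hk le_rfl
  have h₂ := hs.jostMinus_solution hk' le_rfl
  obtain ⟨D₁, hD₁⟩ := hs.exists_asymptotic_minus hk
  obtain ⟨D₂, hD₂⟩ := hs.exists_asymptotic_minus hk'
  have hl : Tendsto (fun x : ℝ => |x|) atBot atTop := tendsto_abs_atBot_atTop
  have hka := hk.trans hs.alpha_lt.le
  set e₁ : ℝ → ℂ := fun x => Complex.exp (-(Complex.I * k * x)) with he₁
  set e₂ : ℝ → ℂ := fun x => Complex.exp (-(Complex.I * (-k) * x)) with he₂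
  have ee : ∀ x, e₁ x * e₂ x = 1 := by
    intro x
    rw [he₁, he₂, ← Complex.exp_add]
    simp
  have be₂ : ∀ x, ‖e₂ x‖ ≤ 1 * Real.exp (a * |x|) := by
    intro x
    have := norm_exp_I_mul_le hka x
    simpa [he₂] using this
  have t1 := tendsto_zero_of_growth_mul_decay hs.lt_beta hl h₁.bound
    ((eventually_le_atBot 0).mono fun x hx => (hD₂ x hx).2)
  have t2 := tendsto_zero_of_growth_mul_decay hs.lt_beta hl be₂
    ((eventually_le_atBot 0).mono fun x hx => (hD₁ x hx).1)
  have t3 := tendsto_zero_of_growth_mul_decay hs.lt_beta hl h₁.bound'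
    ((eventually_le_atBot 0).mono fun x hx => (hD₂ x hx).1)
  have t4 := tendsto_zero_of_growth_mul_decay hs.lt_beta hl be₂
    ((eventually_le_atBot 0).mono fun x hx => (hD₁ x hx).2)
  -- The Wronskian is `2ik` plus four error terms, each a function of order `e^{a|x|}` times one of
  -- order `e^{-(β-a)|x|}`.
  have t := ((t1.add (t2.const_mul (Complex.I * k))).sub (t3.add t4)).add_const (2 * Complex.I * k)
  have hc : ∀ y, jostMinus U k y * jostMinusDeriv U (-k) y - jostMinusDeriv U k y * jostMinus U (-k) y
      = jostMinus U k x * jostMinusDeriv U (-k) x - jostMinusDeriv U k x * jostMinus U (-k) x :=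
    fun y => h₁.wronskian_eq h₂ (by ring) y x
  have t' : Tendsto (fun y => jostMinus U k y * jostMinusDeriv U (-k) y
      - jostMinusDeriv U k y * jostMinus U (-k) y) atBot (𝓝 (2 * Complex.I * k)) := by
    simp only [mul_zero, add_zero, sub_zero, zero_add] at t
    refine t.congr fun y => ?_
    change _ * (_ - -(Complex.I * -k) * e₂ y) + Complex.I * k * (e₂ y * (_ - e₁ y))
      - (_ * (_ - e₂ y) + e₂ y * (_ - -(Complex.I * k) * e₁ y)) + 2 * Complex.I * k = _
    linear_combination (-2 * Complex.I * k) * ee y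
  simp only [hc] at t'
  exact tendsto_nhds_unique tendsto_const_nhds t'

/-- Cramer's rule in the basis `f_-(·;k)`, `f_-(·;-k)`, whose Wronskian `2ik` is nonzero. -/
lemma exists_isInvTransmission {k : ℂ} (hk : |k.im| ≤ α) (hk0 : k ≠ 0) :
    ∃ b, IsInvTransmission U k b := by
  have hk' : |(-k).im| ≤ α := by simpa using hk
  have hp := hs.jostPlus_solution hk le_rfl
  have h₁ := hs.jostMinus_solution hk le_rfl
  have h₂ := hs.jostMinus_solution hk' le_rfl
  have hI : 2 * Complex.I * k ≠ 0 := by simp [hk0]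
  refine ⟨-jostWronskian U k / (2 * Complex.I * k),
    (jostPlus U k 0 * jostMinusDeriv U (-k) 0 - jostPlusDeriv U k 0 * jostMinus U (-k) 0)
      / (2 * Complex.I * k), fun x => ?_⟩
  have w1 := hp.wronskian_eq h₁ rfl 0 x
  have w2 := hp.wronskian_eq h₂ (by ring) 0 x
  have w3 := hs.wronskian_minus hk x
  unfold jostWronskian
  rw [w1, w2]
  field_simp
  linear_combination (-jostPlus U k x) * w3

/-- Taking the Wronskian of the scattering relation with `f_-(·;k)` removes the reflection term. Any
admissible coefficient is thus determined, whichever one is chosen. -/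
lemma mul_invTransmission {k : ℂ} (hk : |k.im| ≤ α) (hk0 : k ≠ 0) :
    k * invTransmission U k = Complex.I / 2 * jostWronskian U k := by
  have hk' : |(-k).im| ≤ α := by simpa using hk
  have hp := hs.jostPlus_solution hk le_rfl
  have h₁ := hs.jostMinus_solution hk le_rfl
  have h₂ := hs.jostMinus_solution hk' le_rfl
  obtain ⟨c, hc⟩ : IsInvTransmission U k (invTransmission U k) :=
    Classical.epsilon_spec (hs.exists_isInvTransmission hk hk0)
  set b := invTransmission U k
  have hd : jostPlusDeriv U k 0 = c * jostMinusDeriv U k 0 + b * jostMinusDeriv U (-k) 0 := by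
    refine (hp.hasDerivAt 0).unique ?_
    refine (((h₁.hasDerivAt 0).const_mul c).add
      ((h₂.hasDerivAt 0).const_mul b)).congr_of_eventuallyEq ?_
    exact Eventually.of_forall hc
  have w3 := hs.wronskian_minus hk 0
  unfold jostWronskian
  rw [hd, hc 0]
  linear_combination (b * Complex.I / 2) * w3 + k * b * Complex.I_sq

lemma tendsto_jostWronskian_zero (hα : 0 < α) :
    Tendsto (jostWronskian U) (𝓝 0) (𝓝 (jostWronskian U 0)) := by
  obtain ⟨p1, p2⟩ := hs.tendsto_isJostPlus_zero hα (f := fun z => jostPlus U z)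
    fun z hz => hs.isJostPlus hz
  obtain ⟨m1, m2⟩ := hs.reflect.tendsto_isJostPlus_zero hα (f := fun z x => jostMinus U z (-x))
    fun z hz => hs.isJostPlus_reflect hz
  simp only [neg_zero] at m1
  have m2' : Tendsto (fun z => jostMinusDeriv U z 0) (𝓝 0) (𝓝 (jostMinusDeriv U 0 0)) := by
    have := m2.neg
    simpa [jostMinusDeriv] using this
  exact (p1.mul m2').sub (p2.mul m1)

lemma kOverT_eq (hα : 0 < α) {k : ℂ} (hk : |k.im| ≤ α) :
    kOverT U k = Complex.I / 2 * jostWronskian U k := by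
  have hne : ∀ z : ℂ, z ≠ 0 → |z.im| ≤ α →
      z / transmission U z = Complex.I / 2 * jostWronskian U z := by
    intro z hz hzα
    -- At a pole `1/t = 0`, and the conventions `1/0 = 0`, `z/0 = 0` give `z/t = 0`, in agreement
    -- with the vanishing Wronskian.
    rw [transmission, if_neg hz, one_div, div_inv_eq_mul]
    exact hs.mul_invTransmission hzα hz
  unfold kOverT
  split_ifs with h0
  · subst h0
    refine Tendsto.limUnder_eq ?_
    have h1 := ((hs.tendsto_jostWronskian_zero hα).const_mul (Complex.I / 2)).mono_left
      (nhdsWithin_le_nhds (s := {0}ᶜ))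
    refine h1.congr' ?_
    have hnear : ∀ᶠ z : ℂ in 𝓝[≠] 0, ‖z‖ < α := by
      have : Tendsto (fun z : ℂ => ‖z‖) (𝓝 0) (𝓝 0) := by simpa using tendsto_norm_zero (E := ℂ)
      exact (this.eventually (gt_mem_nhds hα)).filter_mono nhdsWithin_le_nhds
    filter_upwards [hnear, self_mem_nhdsWithin] with z hz hz0
    exact (hne z hz0 ((Complex.abs_im_le_norm z).trans hz.le)).symm
  · exact hne k h0 hk

omit hs in
/-- Perturbation formula for the Wronskian of the Jost solutions. -/
lemma jostWronskian_sub {A₁ A₂ : ℝ} {U₁ U₂ : ℝ → ℂ} (h₁ : JostSetting α a β A₁ U₁)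
    (h₂ : JostSetting α a β A₂ U₂) {k : ℂ} (hk : |k.im| ≤ α) :
    Integrable (fun x => (U₂ x - U₁ x) * (jostPlus U₁ k x * jostMinus U₂ k x)) ∧
    ∫ x, (U₂ x - U₁ x) * (jostPlus U₁ k x * jostMinus U₂ k x)
      = jostWronskian U₂ k - jostWronskian U₁ k := by
  have p₁ := h₁.jostPlus_solution hk le_rfl
  have p₂ := h₂.jostPlus_solution hk le_rfl
  have m₁ := h₁.jostMinus_solution hk le_rfl
  have m₂ := h₂.jostMinus_solution hk le_rfl
  obtain ⟨D₁, hD₁⟩ := h₁.exists_asymptotic_plus hk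
  obtain ⟨D₂, hD₂⟩ := h₂.exists_asymptotic_plus hk
  obtain ⟨E₁, hE₁⟩ := h₁.exists_asymptotic_minus hk
  obtain ⟨E₂, hE₂⟩ := h₂.exists_asymptotic_minus hk
  have hint : Integrable (fun x => (U₂ x - U₁ x) * (jostPlus U₁ k x * jostMinus U₂ k x)) := by
    have c1 := h₁.continuous
    have c2 := h₂.continuous
    have c3 : Continuous (jostPlus U₁ k) :=
      continuous_iff_continuousAt.2 fun x => (p₁.hasDerivAt x).continuousAt
    have c4 : Continuous (jostMinus U₂ k) :=
      continuous_iff_continuousAt.2 fun x => (m₂.hasDerivAt x).continuousAt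
    set M₁ := solutionBound α a β A₁ ‖k‖
    set M₂ := solutionBound α a β A₂ ‖k‖
    refine Integrable.mono' ((integrable_exp_weight h₁.lt_beta).const_mul ((A₂ + A₁) * (M₁ * M₂)))
      (Continuous.aestronglyMeasurable (by fun_prop)) (ae_of_all _ fun x => ?_)
    rw [norm_mul, norm_mul]
    have b1 := h₁.bound x
    have b2 := h₂.bound x
    have b3 : ‖U₂ x - U₁ x‖ ≤ (A₂ + A₁) * Real.exp (-β * |x|) := by
      refine (norm_sub_le _ _).trans ?_
      linarith
    have b4 := p₁.bound x
    have b5 := m₂.bound x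
    calc ‖U₂ x - U₁ x‖ * (‖jostPlus U₁ k x‖ * ‖jostMinus U₂ k x‖)
        ≤ ((A₂ + A₁) * Real.exp (-β * |x|)) * ((M₁ * Real.exp (a * |x|))
          * (M₂ * Real.exp (a * |x|))) := by
          refine mul_le_mul b3 (mul_le_mul b4 b5 (norm_nonneg _) ?_) (by positivity) ?_
          · exact (norm_nonneg _).trans b4
          · exact (norm_nonneg _).trans b3
      _ = (A₂ + A₁) * (M₁ * M₂)
          * (Real.exp (-β * |x|) * Real.exp (a * |x|) * Real.exp (a * |x|)) := by ring
      _ = _ := by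
          rw [← Real.exp_add, ← Real.exp_add]
          ring_nf
  refine ⟨hint, ?_⟩
  have w1 : ∀ x, jostPlus U₁ k x * jostMinusDeriv U₁ k x - jostPlusDeriv U₁ k x * jostMinus U₁ k x
      = jostWronskian U₁ k := fun x => p₁.wronskian_eq m₁ rfl x 0
  have w2 : ∀ x, jostPlus U₂ k x * jostMinusDeriv U₂ k x - jostPlusDeriv U₂ k x * jostMinus U₂ k x
      = jostWronskian U₂ k := fun x => p₂.wronskian_eq m₂ rfl x 0
  -- At `-∞` the two solutions `f_-` share their asymptotics, so `f_-^{U₂}` may be replaced by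
  -- `f_-^{U₁}`; at `+∞` the same holds for `f_+`.
  refine integral_of_hasDerivAt_of_tendsto (fun x => p₁.hasDerivAt_wronskian m₂ rfl x) hint ?_ ?_
  · have hl : Tendsto (fun x : ℝ => |x|) atBot atTop := tendsto_abs_atBot_atTop
    have t1 := tendsto_zero_of_growth_mul_decay h₁.lt_beta hl p₁.bound
      ((eventually_le_atBot 0).mono fun x hx => norm_sub_le_of_common (hE₂ x hx).2 (hE₁ x hx).2)
    have t2 := tendsto_zero_of_growth_mul_decay h₁.lt_beta hl p₁.bound'
      ((eventually_le_atBot 0).mono fun x hx => norm_sub_le_of_common (hE₂ x hx).1 (hE₁ x hx).1)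
    have t := (t1.sub t2).add_const (jostWronskian U₁ k)
    simp only [sub_zero, zero_add] at t
    refine t.congr fun x => ?_
    rw [← w1 x]
    ring
  · have hl : Tendsto (fun x : ℝ => |x|) atTop atTop := tendsto_abs_atTop_atTop
    have t1 := tendsto_zero_of_growth_mul_decay h₁.lt_beta hl m₂.bound'
      ((eventually_ge_atTop 0).mono fun x hx => norm_sub_le_of_common (hD₁ x hx).1 (hD₂ x hx).1)
    have t2 := tendsto_zero_of_growth_mul_decay h₁.lt_beta hl m₂.bound
      ((eventually_ge_atTop 0).mono fun x hx => norm_sub_le_of_common (hD₁ x hx).2 (hD₂ x hx).2)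
    have t := (t1.sub t2).add_const (jostWronskian U₂ k)
    simp only [sub_zero, zero_add] at t
    refine t.congr fun x => ?_
    rw [← w2 x]
    ring

end JostSetting

/-! ### Almost everywhere equal potentials -/

/-- The potential enters only under Lebesgue integrals, so the defining predicates coincide and
hence so do the choices. This permits replacing the coefficients by regular representatives. -/
lemma kOverT_congr_ae {U V : ℝ → ℂ} (h : U =ᵐ[volume] V) : kOverT U = kOverT V := by
  have hae : ∀ (k : ℂ) (f : ℝ → ℂ) (x : ℝ) (s : Set ℝ),
      (fun y => sinKernel k (y - x) * U y * f y)
        =ᵐ[volume.restrict s] fun y => sinKernel k (y - x) * V y * f y := by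
    intro k f x s
    filter_upwards [ae_restrict_of_ae h] with y hy
    rw [hy]
  have hp : ∀ k, IsJostPlus U k = IsJostPlus V k := by
    intro k
    funext f
    refine propext ⟨fun H => ⟨H.continuous, H.asymptotic, fun x => ?_, fun x => ?_⟩,
      fun H => ⟨H.continuous, H.asymptotic, fun x => ?_, fun x => ?_⟩⟩
    · exact (integrable_congr (hae k f x _)).1 (H.integrable x)
    · rw [← integral_congr_ae (hae k f x _)]; exact H.volterra x
    · exact (integrable_congr (hae k f x _)).2 (H.integrable x)
    · rw [integral_congr_ae (hae k f x _)]; exact H.volterra x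
  have hm : ∀ k, IsJostMinus U k = IsJostMinus V k := by
    intro k
    funext f
    refine propext ⟨fun H => ⟨H.continuous, H.asymptotic, fun x => ?_, fun x => ?_⟩,
      fun H => ⟨H.continuous, H.asymptotic, fun x => ?_, fun x => ?_⟩⟩
    · exact (integrable_congr (hae k f x _)).1 (H.integrable x)
    · rw [← integral_congr_ae (hae k f x _)]; exact H.volterra x
    · exact (integrable_congr (hae k f x _)).2 (H.integrable x)
    · rw [integral_congr_ae (hae k f x _)]; exact H.volterra x
  have hi : invTransmission U = invTransmission V := by
    funext k
    unfold invTransmission IsInvTransmission jostPlus jostMinus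
    simp only [hp, hm]
  have ht : transmission U = transmission V := by
    funext k
    unfold transmission
    rw [hi]
  funext k
  unfold kOverT
  rw [ht]

/-! ### Oscillatory integrals -/

/-- The plane wave `e^{iξx}`. -/
def phase (ξ : ℝ) (x : ℝ) : ℂ := Complex.exp (Complex.I * (ξ : ℂ) * x)

lemma norm_phase (ξ x : ℝ) : ‖phase ξ x‖ = 1 := by
  unfold phase
  rw [Complex.norm_exp]
  simp

lemma continuous_phase (ξ : ℝ) : Continuous (phase ξ) := by
  unfold phase
  fun_prop

lemma hasDerivAt_phase (ξ x : ℝ) : HasDerivAt (phase ξ) (Complex.I * ξ * phase ξ x) x :=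
  hasDerivAt_exp_I_mul (ξ : ℂ) x

lemma phase_mul_conj (ξ₁ ξ₂ x : ℝ) :
    phase ξ₁ x * (starRingEnd ℂ) (phase ξ₂ x) = phase (ξ₁ - ξ₂) x := by
  unfold phase
  rw [← Complex.exp_conj, ← Complex.exp_add]
  congr 1
  simp
  ring

lemma phase_add_half_period {ξ : ℝ} (hξ : ξ ≠ 0) (x : ℝ) :
    phase ξ (x + Real.pi / ξ) = -phase ξ x := by
  unfold phase
  have h : (ξ : ℂ) ≠ 0 := by exact_mod_cast hξ
  have : Complex.I * (ξ : ℂ) * ((x + Real.pi / ξ : ℝ) : ℂ)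
      = Complex.I * ξ * x + Real.pi * Complex.I := by
    push_cast
    field_simp
  rw [this, Complex.exp_add, Complex.exp_pi_mul_I]
  ring

lemma WeightedLipschitz.weaken {γ γ' L : ℝ} {F : ℝ → ℂ} (h : WeightedLipschitz γ L F)
    (hγ : γ' ≤ γ) : WeightedLipschitz γ' L F := by
  have n := h.nonneg
  exact ⟨fun x => (h.bound x).trans (by gcongr), fun x y hxy => (h.lip x y hxy).trans (by gcongr)⟩

lemma integrable_of_norm_le_exp {γ L : ℝ} (hγ : 0 < γ) {F : ℝ → ℂ} (hc : Continuous F)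
    (hb : ∀ x, ‖F x‖ ≤ L * Real.exp (-γ * |x|)) : Integrable F :=
  ((integrable_exp_weight hγ).const_mul L).mono' hc.aestronglyMeasurable (ae_of_all _ hb)

lemma norm_integral_le_exp {γ L : ℝ} (hγ : 0 < γ) {F : ℝ → ℂ}
    (hb : ∀ x, ‖F x‖ ≤ L * Real.exp (-γ * |x|)) :
    ‖∫ x, F x‖ ≤ L * ∫ x, Real.exp (-γ * |x|) := by
  rw [← integral_const_mul]
  exact norm_integral_le_of_norm_le ((integrable_exp_weight hγ).const_mul L) (ae_of_all _ hb)

/-- Integrals of weighted Lipschitz functions against plane waves are of the order of the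
wavelength. -/
lemma WeightedLipschitz.norm_integral_mul_phase_le {γ L : ℝ} {F : ℝ → ℂ}
    (h : WeightedLipschitz γ L F) (hγ : 0 < γ) {ξ : ℝ} (hξ : Real.pi ≤ |ξ|) :
    ‖∫ x, F x * phase ξ x‖ ≤ L * (Real.pi / |ξ|) * ∫ x, Real.exp (-γ * |x|) := by
  have hξ0 : 0 < |ξ| := Real.pi_pos.trans_le hξ
  have hne : ξ ≠ 0 := abs_pos.1 hξ0
  set d := Real.pi / ξ with hd
  have hdabs : |d| = Real.pi / |ξ| := by rw [hd, abs_div, abs_of_pos Real.pi_pos]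
  have hd1 : |d| ≤ 1 := by rw [hdabs]; exact (div_le_one hξ0).2 hξ
  have hc : Continuous (fun x => F x * phase ξ x) := h.continuous.mul (continuous_phase ξ)
  have hi : Integrable (fun x => F x * phase ξ x) := by
    refine integrable_of_norm_le_exp (L := L) hγ hc fun x => ?_
    rw [norm_mul, norm_phase, mul_one]
    exact h.bound x
  have hshift : ∫ x, F x * phase ξ x = ∫ x, F (x + d) * phase ξ (x + d) :=
    (integral_add_right_eq_self (fun x => F x * phase ξ x) d).symm
  have hi' : Integrable (fun x => F (x + d) * phase ξ (x + d)) := hi.comp_add_right d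
  -- A shift by half a period reverses the sign of the wave; averaging with the shifted integral
  -- replaces `F` by a difference, which the Lipschitz bound controls since the shift is at most
  -- `1`.
  have h2 : 2 * ∫ x, F x * phase ξ x = ∫ x, (F x - F (x + d)) * phase ξ x := by
    rw [two_mul]
    nth_rewrite 2 [hshift]
    rw [← integral_add hi hi']
    refine integral_congr_ae (ae_of_all _ fun x => ?_)
    simp only [hd, phase_add_half_period hne]
    ring
  have h3 : ‖∫ x, (F x - F (x + d)) * phase ξ x‖ ≤ L * |d| * ∫ x, Real.exp (-γ * |x|) := by
    refine norm_integral_le_exp hγ fun x => ?_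
    rw [norm_mul, norm_phase, mul_one]
    have := h.lip x (x + d) (by simpa using hd1)
    simpa using this
  rw [← h2, norm_mul, Complex.norm_ofNat, hdabs] at h3
  linarith [norm_nonneg (∫ x, F x * phase ξ x)]

/-- Two integrations by parts against a plane wave. -/
lemma integral_mul_phase_eq {F F' F'' : ℝ → ℂ} (h : ∀ x, HasDerivAt F (F' x) x)
    (h' : ∀ x, HasDerivAt F' (F'' x) x) (hi : Integrable F) (hi' : Integrable F')
    (hi'' : Integrable F'') {ξ : ℝ} (hξ : ξ ≠ 0) :
    ∫ x, F x * phase ξ x = -(1 / (ξ : ℂ) ^ 2) * ∫ x, F'' x * phase ξ x := by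
  have ip : ∀ {f : ℝ → ℂ}, Integrable f → Integrable (fun x => f x * phase ξ x) := fun {f} hf =>
    hf.mul_bdd (c := 1) (continuous_phase ξ).aestronglyMeasurable
      (ae_of_all _ fun x => (norm_phase ξ x).le)
  -- Both integrations by parts at once: `(F' - iξF) e^{iξx}` is a primitive of `(F'' + ξ² F)
  -- e^{iξx}`, whose integral therefore vanishes.
  have hd : ∀ x, HasDerivAt (fun x => (F' x - Complex.I * ξ * F x) * phase ξ x)
      (F'' x * phase ξ x + (ξ : ℂ) ^ 2 * (F x * phase ξ x)) x := by
    intro x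
    refine (((h' x).sub ((h x).const_mul (Complex.I * ξ))).mul (hasDerivAt_phase ξ x)).congr_deriv ?_
    simp only [Pi.sub_apply]
    linear_combination (-(ξ : ℂ) ^ 2 * F x * phase ξ x) * Complex.I_sq
  have h0 := integral_eq_zero_of_hasDerivAt_of_integrable hd
    ((ip hi'').add ((ip hi).const_mul _)) (ip (hi'.sub (hi.const_mul _)))
  rw [integral_add (ip hi'') ((ip hi).const_mul _), integral_const_mul] at h0
  have hne : (ξ : ℂ) ^ 2 ≠ 0 := by
    have : (ξ : ℂ) ≠ 0 := by exact_mod_cast hξ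
    exact pow_ne_zero 2 this
  have h1 : (ξ : ℂ) ^ 2 * ∫ x, F x * phase ξ x = -∫ x, F'' x * phase ξ x := by
    linear_combination h0
  rw [neg_mul, one_div, ← mul_neg, ← h1, inv_mul_cancel_left₀ hne]

/-! ### Regular two-scale potentials -/

/-- A real-valued two-scale potential with regular coefficients. -/
structure RegularTwoScale (θ β N ε : ℝ) (P : ℝ → ℂ) (Q Q₁ Q₂ : NZ → ℝ → ℂ) (lam : NZ → ℝ)
    (n : NZ → ℝ) : Prop where
  theta_pos : 0 < θ
  beta_pos : 0 < β
  eps_pos : 0 < |ε|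
  eps_le_one : |ε| ≤ 1
  eps_le : |ε| ≤ 2 * θ
  average : WeightedLipschitz β N P
  coeff : ∀ j, WeightedLipschitz β (n j) (Q j)
  coeff₁ : ∀ j, WeightedLipschitz β (n j) (Q₁ j)
  coeff₂ : ∀ j, WeightedLipschitz β (n j) (Q₂ j)
  hasDerivAt : ∀ j x, HasDerivAt (Q j) (Q₁ j x) x
  hasDerivAt₁ : ∀ j x, HasDerivAt (Q₁ j) (Q₂ j x) x
  summable : Summable n
  tsum_le : ∑' j, n j ≤ N
  separated : ∀ j l : NZ, j ≠ l → θ ≤ |lam j - lam l|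
  away_from_zero : ∀ j, θ ≤ |lam j|
  real_valued : ∀ᵐ x, (Veps P Q lam ε x).im = 0

/-- The frequency of `x ↦ e^{2πiλ_j x/ε}`. -/
def freq (lam : NZ → ℝ) (ε : ℝ) (j : NZ) : ℝ := 2 * Real.pi * lam j / ε

lemma Veps_eq (P : ℝ → ℂ) (Q : NZ → ℝ → ℂ) (lam : NZ → ℝ) (ε x : ℝ) :
    Veps P Q lam ε x = P x + ∑' j, Q j x * phase (freq lam ε j) x := by
  unfold Veps twoScale phase freq
  congr 1
  refine tsum_congr fun j => ?_
  congr 2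
  push_cast
  ring

namespace RegularTwoScale

variable {θ β N ε : ℝ} {P : ℝ → ℂ} {Q Q₁ Q₂ : NZ → ℝ → ℂ} {lam : NZ → ℝ} {n : NZ → ℝ}
  (ht : RegularTwoScale θ β N ε P Q Q₁ Q₂ lam n)
include ht

lemma n_nonneg (j : NZ) : 0 ≤ n j := (ht.coeff j).nonneg

lemma N_nonneg : 0 ≤ N := ht.average.nonneg

lemma n_le (j : NZ) : n j ≤ N :=
  (ht.summable.le_tsum j fun l _ => ht.n_nonneg l).trans ht.tsum_le

lemma exp_le_one (x : ℝ) : Real.exp (-β * |x|) ≤ 1 :=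
  Real.exp_le_one_iff.2 (by nlinarith [ht.beta_pos, abs_nonneg x])

lemma norm_coeff_le (j : NZ) (x : ℝ) : ‖Q j x‖ ≤ n j := by
  have := ht.n_nonneg j
  exact ((ht.coeff j).bound x).trans (mul_le_of_le_one_right this (ht.exp_le_one x))

/-- The first bound uses `|ε| ≤ 2θ` and puts half a period within the range of the local Lipschitz
condition; `μ` stands for `λ_j` or for `λ_j - λ_l`. -/
lemma pi_div_freq_le {μ : ℝ} (hμ : θ ≤ |μ|) :
    Real.pi ≤ |2 * Real.pi * μ / ε| ∧ Real.pi / |2 * Real.pi * μ / ε| ≤ |ε| / θ := by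
  have hε := ht.eps_pos
  have hθ := ht.theta_pos
  have hπ := Real.pi_pos
  have h2 := ht.eps_le
  have hμ0 : 0 < |μ| := hθ.trans_le hμ
  have e : |2 * Real.pi * μ / ε| = 2 * Real.pi * |μ| / |ε| := by
    rw [abs_div, abs_mul, abs_of_pos (by positivity : 0 < 2 * Real.pi)]
  rw [e]
  constructor
  · rw [le_div_iff₀ hε]
    nlinarith
  · rw [div_div_eq_mul_div, div_le_div_iff₀ (by positivity) hθ]
    have : |ε| * θ ≤ |ε| * |μ| := by gcongr
    nlinarith [mul_pos hε hμ0]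

lemma norm_freq_inv_sq_le (j : NZ) : 1 / freq lam ε j ^ 2 ≤ |ε| ^ 2 / θ ^ 2 := by
  obtain ⟨h1, h2⟩ := ht.pi_div_freq_le (ht.away_from_zero j)
  have hθ := ht.theta_pos
  have hw : 0 < |freq lam ε j| := Real.pi_pos.trans_le h1
  have h3 : 1 / |freq lam ε j| ≤ |ε| / θ := by
    refine le_trans ?_ h2
    have := Real.pi_gt_three
    change 1 / |freq lam ε j| ≤ Real.pi / |freq lam ε j|
    gcongr
    linarith
  rw [← sq_abs (freq lam ε j), ← div_pow, show 1 / |freq lam ε j| ^ 2 = (1 / |freq lam ε j|) ^ 2 by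
    rw [div_pow, one_pow]]
  gcongr

/-- Since `ε²/(2πλ_j)² = 1/ξ_j²`, this is the form in which two integrations by parts meet the
effective potential. -/
lemma sigmaEff_eq (x : ℝ) :
    (sigmaEff Q lam ε x : ℂ) = -∑' j, (1 / (freq lam ε j : ℂ) ^ 2) * (‖Q j x‖ : ℂ) ^ 2 := by
  have hε : ε ≠ 0 := abs_pos.1 ht.eps_pos
  unfold sigmaEff LambdaEff
  rw [← tsum_mul_left, ← tsum_mul_left, Complex.ofReal_tsum, ← tsum_neg]
  refine tsum_congr fun j => ?_
  have h1 : lam j ≠ 0 := abs_pos.1 (ht.theta_pos.trans_le (ht.away_from_zero j))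
  have h2 : (lam j : ℂ) ≠ 0 := by exact_mod_cast h1
  have h3 : (ε : ℂ) ≠ 0 := by exact_mod_cast hε
  have h4 : (Real.pi : ℂ) ≠ 0 := by exact_mod_cast Real.pi_ne_zero
  unfold freq
  push_cast
  field_simp

lemma norm_term_le (j : NZ) (x : ℝ) :
    ‖(1 / (freq lam ε j : ℂ) ^ 2) * (‖Q j x‖ : ℂ) ^ 2‖
      ≤ (|ε| ^ 2 / θ ^ 2 * N) * n j * Real.exp (-β * |x|) := by
  have h := ht.norm_freq_inv_sq_le j
  have hn := ht.n_nonneg j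
  have hθ := ht.theta_pos
  rw [norm_mul, norm_div, norm_one, norm_pow, norm_pow, Complex.norm_real, Complex.norm_real,
    norm_norm, Real.norm_eq_abs, sq_abs]
  calc 1 / freq lam ε j ^ 2 * ‖Q j x‖ ^ 2 ≤ |ε| ^ 2 / θ ^ 2 * ‖Q j x‖ ^ 2 := by gcongr
    _ = |ε| ^ 2 / θ ^ 2 * (‖Q j x‖ * ‖Q j x‖) := by ring
    _ ≤ |ε| ^ 2 / θ ^ 2 * (N * (n j * Real.exp (-β * |x|))) := by
        have hN := ht.N_nonneg
        gcongr
        · exact (ht.norm_coeff_le j x).trans (ht.n_le j)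
        · exact (ht.coeff j).bound x
    _ = _ := by ring

lemma norm_sigmaEff_le (x : ℝ) :
    ‖(sigmaEff Q lam ε x : ℂ)‖ ≤ |ε| ^ 2 / θ ^ 2 * N ^ 2 * Real.exp (-β * |x|) := by
  have hN := ht.N_nonneg
  rw [ht.sigmaEff_eq, norm_neg]
  have hs : HasSum (fun j => (|ε| ^ 2 / θ ^ 2 * N) * n j * Real.exp (-β * |x|))
      ((|ε| ^ 2 / θ ^ 2 * N) * (∑' j, n j) * Real.exp (-β * |x|)) :=
    (ht.summable.hasSum.mul_left _).mul_right _
  refine (tsum_of_norm_bounded hs fun j => ht.norm_term_le j x).trans ?_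
  have := ht.tsum_le
  calc (|ε| ^ 2 / θ ^ 2 * N) * (∑' j, n j) * Real.exp (-β * |x|)
      ≤ (|ε| ^ 2 / θ ^ 2 * N) * N * Real.exp (-β * |x|) := by gcongr
    _ = _ := by ring

lemma continuous_coeff (j : NZ) : Continuous (Q j) := (ht.coeff j).continuous

lemma continuous_sigmaEff : Continuous (fun x => (sigmaEff Q lam ε x : ℂ)) := by
  simp only [ht.sigmaEff_eq]
  refine (continuous_tsum (u := fun j => (|ε| ^ 2 / θ ^ 2 * N) * n j) (fun j => ?_)
    (ht.summable.mul_left _) fun j x => (ht.norm_term_le j x).trans ?_).neg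
  · have := ht.continuous_coeff j
    fun_prop
  · have := ht.n_nonneg j
    have := ht.N_nonneg
    exact mul_le_of_le_one_right (by positivity) (ht.exp_le_one x)

lemma norm_coeff_mul_phase_le (j : NZ) (x : ℝ) :
    ‖Q j x * phase (freq lam ε j) x‖ ≤ n j * Real.exp (-β * |x|) := by
  rw [norm_mul, norm_phase, mul_one]
  exact (ht.coeff j).bound x

lemma summable_coeff_mul_phase (x : ℝ) :
    Summable (fun j => Q j x * phase (freq lam ε j) x) :=
  Summable.of_norm_bounded (ht.summable.mul_right _) fun j => ht.norm_coeff_mul_phase_le j x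

lemma continuous_Veps : Continuous (Veps P Q lam ε) := by
  have e : Veps P Q lam ε = fun x => P x + ∑' j, Q j x * phase (freq lam ε j) x :=
    funext fun x => Veps_eq P Q lam ε x
  rw [e]
  refine ht.average.continuous.add (continuous_tsum
    (fun j => (ht.continuous_coeff j).mul (continuous_phase _)) ht.summable fun j x => ?_)
  exact (ht.norm_coeff_mul_phase_le j x).trans
    (mul_le_of_le_one_right (ht.n_nonneg j) (ht.exp_le_one x))

/-- A common bound for the amplitudes of the oscillatory and of the effective potential. -/
lemma norm_Veps_le (x : ℝ) :
    ‖Veps P Q lam ε x‖ ≤ (2 * N + N ^ 2 / θ ^ 2) * Real.exp (-β * |x|) := by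
  rw [Veps_eq]
  have hN := ht.N_nonneg
  have h1 : ‖∑' j, Q j x * phase (freq lam ε j) x‖ ≤ N * Real.exp (-β * |x|) := by
    refine (tsum_of_norm_bounded (ht.summable.hasSum.mul_right _)
      fun j => ht.norm_coeff_mul_phase_le j x).trans ?_
    gcongr
    exact ht.tsum_le
  have h2 := ht.average.bound x
  have h3 : 0 ≤ N ^ 2 / θ ^ 2 * Real.exp (-β * |x|) := by positivity
  refine (norm_add_le _ _).trans ?_
  linarith

lemma norm_Veff_le (x : ℝ) :
    ‖Veff P Q lam ε x‖ ≤ (2 * N + N ^ 2 / θ ^ 2) * Real.exp (-β * |x|) := by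
  unfold Veff
  have hN := ht.N_nonneg
  have hθ := ht.theta_pos
  have h1 : ‖(sigmaEff Q lam ε x : ℂ)‖ ≤ N ^ 2 / θ ^ 2 * Real.exp (-β * |x|) := by
    refine (ht.norm_sigmaEff_le x).trans ?_
    have : |ε| ^ 2 ≤ 1 := pow_le_one₀ (abs_nonneg _) ht.eps_le_one
    calc |ε| ^ 2 / θ ^ 2 * N ^ 2 * Real.exp (-β * |x|)
        ≤ 1 / θ ^ 2 * N ^ 2 * Real.exp (-β * |x|) := by gcongr
      _ = _ := by ring
  have h2 := ht.average.bound x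
  have h3 : 0 ≤ N * Real.exp (-β * |x|) := by positivity
  refine (norm_add_le _ _).trans ?_
  linarith

lemma jostSetting_Veps {α a : ℝ} (h₀ : 0 ≤ α) (h₁ : α < a) (h₂ : 0 < β - 2 * a) :
    JostSetting α a β (2 * N + N ^ 2 / θ ^ 2) (Veps P Q lam ε) :=
  ⟨h₀, h₁, h₂, ht.continuous_Veps, ht.norm_Veps_le⟩

lemma jostSetting_Veff {α a : ℝ} (h₀ : 0 ≤ α) (h₁ : α < a) (h₂ : 0 < β - 2 * a) :
    JostSetting α a β (2 * N + N ^ 2 / θ ^ 2) (Veff P Q lam ε) :=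
  ⟨h₀, h₁, h₂, ht.average.continuous.add ht.continuous_sigmaEff, ht.norm_Veff_le⟩

/-- Since the potential is real, it equals the series of conjugate modes. -/
lemma Veps_eq_conj (x : ℝ) : Veps P Q lam ε x = (starRingEnd ℂ) (P x)
    + ∑' j, (starRingEnd ℂ) (Q j x) * (starRingEnd ℂ) (phase (freq lam ε j) x) := by
  -- The imaginary part vanishes almost everywhere and is continuous, hence vanishes everywhere.
  have him : (fun x => (Veps P Q lam ε x).im) = fun _ => 0 :=
    ((Complex.continuous_im.comp ht.continuous_Veps).ae_eq_iff_eq volume continuous_const).1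
      ht.real_valued
  have h : Veps P Q lam ε x = (starRingEnd ℂ) (Veps P Q lam ε x) :=
    (Complex.conj_eq_iff_im.2 (congrFun him x)).symm
  rw [h, Veps_eq, map_add, Complex.conj_tsum]
  simp only [map_mul]

end RegularTwoScale

/-! ### The homogenization estimate -/

/-- Two kinds of bound are kept apart: the absolute bounds `p` justify exchanging sum and integral,
and the finer bounds `c`, which profit from oscillation, are then summed. -/
lemma norm_integral_tsum_le {ι : Type*} [Countable ι] {γ b : ℝ} (hγ : 0 < γ) {F : ι → ℝ → ℂ}
    {p c : ι → ℝ} (hc : ∀ i, Continuous (F i))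
    (hp : ∀ i x, ‖F i x‖ ≤ p i * Real.exp (-γ * |x|)) (hs : Summable p)
    (hb : ∀ i, ‖∫ x, F i x‖ ≤ c i) (hB : HasSum c b) : ‖∫ x, ∑' i, F i x‖ ≤ b := by
  have hi : ∀ i, Integrable (F i) := fun i => integrable_of_norm_le_exp hγ (hc i) (hp i)
  have hsum : Summable (fun i => ∫ x, ‖F i x‖) := by
    refine Summable.of_nonneg_of_le (fun i => integral_nonneg fun x => norm_nonneg _) (fun i => ?_)
      (hs.mul_right (∫ x, Real.exp (-γ * |x|)))
    rw [← integral_const_mul]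
    exact integral_mono (hi i).norm ((integrable_exp_weight hγ).const_mul _) (hp i)
  rw [← (hasSum_integral_of_summable_integral_norm hi hsum).tsum_eq]
  exact tsum_of_norm_bounded hB hb

/-- The weighted Lipschitz constant of a solution and of its derivative. -/
def solutionLipschitz (a A B M : ℝ) : ℝ := Real.exp a * ((1 + A + B ^ 2) * M)

/-- The equation bounds the derivative of `d` by the amplitude of `U`. No derivative of `U` is
needed, so for `V_ε` the constant does not deteriorate as `ε → 0`. -/
lemma IsSchrodingerSolution.weightedLipschitz {a A B M : ℝ} {U : ℝ → ℂ} {k : ℂ} {f d : ℝ → ℂ}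
    (h : IsSchrodingerSolution a M U k f d) (ha : 0 ≤ a) (hU : ∀ x, ‖U x‖ ≤ A) (hk : ‖k‖ ≤ B) :
    WeightedLipschitz (-a) (solutionLipschitz a A B M) f ∧
      WeightedLipschitz (-a) (solutionLipschitz a A B M) d := by
  have M0 : 0 ≤ M := by
    have := (norm_nonneg _).trans (h.bound 0)
    simpa using this
  have A0 : 0 ≤ A := (norm_nonneg _).trans (hU 0)
  have le : M ≤ (1 + A + B ^ 2) * M := by nlinarith [mul_nonneg A0 M0, mul_nonneg (sq_nonneg B) M0]
  have b1 : ∀ x, ‖f x‖ ≤ ((1 + A + B ^ 2) * M) * Real.exp (-(-a) * |x|) := fun x => by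
    rw [neg_neg]
    exact (h.bound x).trans (by gcongr)
  have b2 : ∀ x, ‖d x‖ ≤ ((1 + A + B ^ 2) * M) * Real.exp (-(-a) * |x|) := fun x => by
    rw [neg_neg]
    exact (h.bound' x).trans (by gcongr)
  have b3 : ∀ x, ‖(U x - k ^ 2) * f x‖ ≤ ((1 + A + B ^ 2) * M) * Real.exp (-(-a) * |x|) := by
    intro x
    rw [neg_neg, norm_mul]
    have h1 : ‖U x - k ^ 2‖ ≤ A + B ^ 2 := by
      refine (norm_sub_le _ _).trans (add_le_add (hU x) ?_)
      rw [norm_pow]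
      gcongr
    calc ‖U x - k ^ 2‖ * ‖f x‖ ≤ (A + B ^ 2) * (M * Real.exp (a * |x|)) :=
          mul_le_mul h1 (h.bound x) (norm_nonneg _) (by positivity)
      _ ≤ (1 + A + B ^ 2) * (M * Real.exp (a * |x|)) := by
          gcongr
          linarith
      _ = _ := by ring
  have e : solutionLipschitz a A B M = Real.exp |(-a)| * ((1 + A + B ^ 2) * M) := by
    rw [abs_neg, abs_of_nonneg ha]
    rfl
  rw [e]
  exact ⟨WeightedLipschitz.of_hasDerivAt h.hasDerivAt b1 b2,
    WeightedLipschitz.of_hasDerivAt h.hasDerivAt' b2 b3⟩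

/-- The constant in the homogenization estimate, in terms of the Lipschitz constant `m` of the
Jost solutions. -/
def homogenizationConstant (θ β a N B m : ℝ) : ℝ :=
  N / θ ^ 2 * (((63 + 54 * (N + B ^ 2)) * m ^ 2 / θ + N ^ 2 / θ ^ 2 * m ^ 2
    + 27 * N * m ^ 2 / θ) * ∫ x, Real.exp (-(β - 2 * a) * |x|))

namespace RegularTwoScale

variable {θ β N ε : ℝ} {P : ℝ → ℂ} {Q Q₁ Q₂ : NZ → ℝ → ℂ} {lam : NZ → ℝ} {n : NZ → ℝ}
  (ht : RegularTwoScale θ β N ε P Q Q₁ Q₂ lam n)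

section Estimate

variable {a B m : ℝ} {k : ℂ} {u u' v v' : ℝ → ℂ} (hγ : 0 < β - 2 * a)
  (hk : ‖k‖ ≤ B) (hu : WeightedLipschitz (-a) m u) (hu' : WeightedLipschitz (-a) m u')
  (hv : WeightedLipschitz (-a) m v) (hv' : WeightedLipschitz (-a) m v')

include ht hk hu hu' hv hv' in
/-- The part of the second derivative of `Q_j u v` that does not contain the fast scale. -/
lemma weightedLipschitz_slow (j : NZ) :
    WeightedLipschitz (β - 2 * a) (n j * ((63 + 54 * (N + B ^ 2)) * m ^ 2))
      (fun x => Q₂ j x * (u x * v x)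
        + (Q₁ j x * (u' x * v x) + Q₁ j x * (u' x * v x)
          + (Q₁ j x * (u x * v' x) + Q₁ j x * (u x * v' x)))
        + Q j x * (P x + (starRingEnd ℂ) (P x) + -(2 * k ^ 2)) * (u x * v x)
        + (Q j x * (u' x * v' x) + Q j x * (u' x * v' x))) := by
  have hn := ht.n_nonneg j
  have hβ := ht.beta_pos.le
  have e : β - 2 * a ≤ β + (-a + -a) := by linarith
  have t1 := ((ht.coeff₂ j).mul (hu.mul hv)).weaken e
  have t2 := ((ht.coeff₁ j).mul (hu'.mul hv)).weaken e
  have t3 := ((ht.coeff₁ j).mul (hu.mul hv')).weaken e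
  have t4 := ((ht.coeff j).mul (hu'.mul hv')).weaken e
  have hc : WeightedLipschitz 0 (2 * B ^ 2) (fun _ => -(2 * k ^ 2)) := by
    refine (WeightedLipschitz.const _).mono ?_
    rw [norm_neg, norm_mul, norm_pow, Complex.norm_ofNat]
    gcongr
  have t5 := (((ht.coeff j).mul (((ht.average.weaken hβ).add
    (ht.average.weaken hβ).star).add hc)).mul (hu.mul hv)).weaken
      (show β - 2 * a ≤ β + 0 + (-a + -a) by linarith)
  -- Each product costs a factor `3`: the seven products of a coefficient with two solution factors
  -- give `7·9 = 63`, and the term with `P + conj P - 2k²` gives `27·2(N + B²)`.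
  refine (((t1.add ((t2.add t2).add (t3.add t3))).add t5).add (t4.add t4)).mono (le_of_eq ?_)
  ring

include ht hγ hu hv in
/-- Interaction of different modes. -/
lemma norm_integral_nonresonant_le (j : NZ) :
    ‖∫ x, ∑' l, (if l = j then 0 else Q j x * (starRingEnd ℂ) (Q l x) * (u x * v x)
        * phase (freq lam ε j - freq lam ε l) x)‖
      ≤ |ε| * (n j * (27 * N * m ^ 2 / θ * ∫ x, Real.exp (-(β - 2 * a) * |x|))) := by
  have hn := ht.n_nonneg
  have hθ := ht.theta_pos
  have hβ := ht.beta_pos.le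
  set I := ∫ x, Real.exp (-(β - 2 * a) * |x|)
  have hI : 0 ≤ I := integral_nonneg fun y => (Real.exp_pos _).le
  have hw : ∀ l, WeightedLipschitz (β - 2 * a) (27 * n j * m ^ 2 * n l)
      (fun x => Q j x * (starRingEnd ℂ) (Q l x) * (u x * v x)) := fun l =>
    ((((ht.coeff j).mul (ht.coeff l).star).mul (hu.mul hv)).weaken
      (show β - 2 * a ≤ β + β + (-a + -a) by linarith)).mono (le_of_eq (by ring))
  have hB : HasSum (fun l => 27 * n j * m ^ 2 * n l * (|ε| / θ) * I)
      (27 * n j * m ^ 2 * (∑' l, n l) * (|ε| / θ) * I) :=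
    ((ht.summable.hasSum.mul_left _).mul_right _).mul_right _
  refine (norm_integral_tsum_le hγ (p := fun l => 27 * n j * m ^ 2 * n l) (fun l => ?_)
    (fun l x => ?_) (ht.summable.mul_left _) (fun l => ?_) hB).trans ?_
  · split_ifs
    · exact continuous_const
    · exact (hw l).continuous.mul (continuous_phase _)
  · split_ifs
    · have := hn j
      have := hn l
      rw [norm_zero]
      positivity
    · rw [norm_mul, norm_phase, mul_one]
      exact (hw l).bound x
  · have hnj := hn j
    have hnl := hn l
    split_ifs with hlj
    · rw [integral_zero, norm_zero]
      positivity
    -- Distinct frequencies differ by at least `2πθ/|ε|`, so every nonresonant mode oscillates fast,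
    -- uniformly in `l`.
    · have e : freq lam ε j - freq lam ε l = 2 * Real.pi * (lam j - lam l) / ε := by
        unfold freq
        ring
      obtain ⟨h1, h2⟩ := ht.pi_div_freq_le (ht.separated j l (Ne.symm hlj))
      rw [e]
      refine ((hw l).norm_integral_mul_phase_le hγ h1).trans ?_
      gcongr
  · have hnj := hn j
    have := ht.tsum_le
    calc 27 * n j * m ^ 2 * (∑' l, n l) * (|ε| / θ) * I
        ≤ 27 * n j * m ^ 2 * N * (|ε| / θ) * I := by gcongr
      _ = _ := by ring

variable (su : ∀ x, HasDerivAt u (u' x) x)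
  (su' : ∀ x, HasDerivAt u' ((Veff P Q lam ε x - k ^ 2) * u x) x)
  (sv : ∀ x, HasDerivAt v (v' x) x)
  (sv' : ∀ x, HasDerivAt v' ((Veps P Q lam ε x - k ^ 2) * v x) x)

include ht hγ hk hu hu' hv hv' su su' sv sv'

/-- A single mode acts like its contribution to the effective potential. -/
lemma norm_integral_mode_le (j : NZ) :
    ‖∫ x, (Q j x * phase (freq lam ε j) x + 1 / (freq lam ε j : ℂ) ^ 2 * (‖Q j x‖ : ℂ) ^ 2)
        * (u x * v x)‖
      ≤ |ε| ^ 3 / θ ^ 2 * n j * (((63 + 54 * (N + B ^ 2)) * m ^ 2 / θ + N ^ 2 / θ ^ 2 * m ^ 2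
          + 27 * N * m ^ 2 / θ) * ∫ x, Real.exp (-(β - 2 * a) * |x|)) := by
  have hnj := ht.n_nonneg j
  have hN := ht.N_nonneg
  have hθ := ht.theta_pos
  have hβ := ht.beta_pos.le
  obtain ⟨f1, f2⟩ := ht.pi_div_freq_le (ht.away_from_zero j)
  change Real.pi ≤ |freq lam ε j| at f1
  change Real.pi / |freq lam ε j| ≤ _ at f2
  have hξ0 : freq lam ε j ≠ 0 := abs_pos.1 (Real.pi_pos.trans_le f1)
  have hfreq := ht.norm_freq_inv_sq_le j
  have hnon := ht.norm_integral_nonresonant_le hγ hu hv j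
  have hslow := ht.weightedLipschitz_slow hk hu hu' hv hv' j
  have hslowi := hslow.norm_integral_mul_phase_le hγ f1
  have hQc := ht.continuous_coeff j
  have huc := hu.continuous
  have hvc := hv.continuous
  have hσc := ht.continuous_sigmaEff
  set ξ := freq lam ε j
  have hpc := continuous_phase ξ
  set I := ∫ x, Real.exp (-(β - 2 * a) * |x|)
  have hI : 0 ≤ I := integral_nonneg fun y => (Real.exp_pos _).le
  set H : ℝ → ℂ := fun x => Q₂ j x * (u x * v x)
        + (Q₁ j x * (u' x * v x) + Q₁ j x * (u' x * v x)
          + (Q₁ j x * (u x * v' x) + Q₁ j x * (u x * v' x)))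
        + Q j x * (P x + (starRingEnd ℂ) (P x) + -(2 * k ^ 2)) * (u x * v x)
        + (Q j x * (u' x * v' x) + Q j x * (u' x * v' x)) with hH
  set R : ℝ → ℂ := fun x => ∑' l, (if l = j then 0 else Q j x * (starRingEnd ℂ) (Q l x)
    * (u x * v x) * phase (ξ - freq lam ε l) x) with hR
  -- derivatives of `Q_j u v`
  have hd : ∀ x, HasDerivAt (fun x => Q j x * (u x * v x))
      (Q₁ j x * (u x * v x) + Q j x * (u' x * v x + u x * v' x)) x := fun x =>
    (ht.hasDerivAt j x).mul ((su x).mul (sv x))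
  have hd' : ∀ x, HasDerivAt (fun x => Q₁ j x * (u x * v x) + Q j x * (u' x * v x + u x * v' x))
      (Q₂ j x * (u x * v x) + 2 * (Q₁ j x * (u' x * v x + u x * v' x))
        + Q j x * ((Veff P Q lam ε x + Veps P Q lam ε x - 2 * k ^ 2) * (u x * v x)
          + 2 * (u' x * v' x))) x := by
    intro x
    have := ((ht.hasDerivAt₁ j x).mul ((su x).mul (sv x))).add ((ht.hasDerivAt j x).mul
      (((su' x).mul (sv x)).add ((su x).mul (sv' x))))
    refine this.congr_deriv ?_
    simp only [Pi.mul_apply, Pi.add_apply]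
    ring
  set F'' : ℝ → ℂ := fun x => Q₂ j x * (u x * v x) + 2 * (Q₁ j x * (u' x * v x + u x * v' x))
        + Q j x * ((Veff P Q lam ε x + Veps P Q lam ε x - 2 * k ^ 2) * (u x * v x)
          + 2 * (u' x * v' x)) with hF''
  -- Expanding `V_ε` in conjugate modes isolates the resonant term `|Q_j|² u v`; every other term
  -- still oscillates.
  have split : ∀ x, F'' x * phase ξ x = H x * phase ξ x
      + (sigmaEff Q lam ε x : ℂ) * (Q j x * (u x * v x)) * phase ξ x
      + (‖Q j x‖ : ℂ) ^ 2 * (u x * v x) + R x := by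
    intro x
    have hsum : Summable (fun l => Q j x * (starRingEnd ℂ) (Q l x) * (u x * v x)
        * phase (ξ - freq lam ε l) x) := by
      have h1 : Summable (fun l => (starRingEnd ℂ) (Q l x * phase (freq lam ε l) x)) :=
        (Complex.conjCLE.summable).2 (ht.summable_coeff_mul_phase x)
      refine (h1.mul_left (Q j x * (u x * v x) * phase ξ x)).congr fun l => ?_
      rw [← phase_mul_conj, map_mul]
      ring
    have e1 := hsum.tsum_eq_add_tsum_ite j
    have e2 : (∑' l, (starRingEnd ℂ) (Q l x) * (starRingEnd ℂ) (phase (freq lam ε l) x))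
        * (Q j x * (u x * v x) * phase ξ x)
        = ∑' l, Q j x * (starRingEnd ℂ) (Q l x) * (u x * v x) * phase (ξ - freq lam ε l) x := by
      rw [← tsum_mul_right]
      refine tsum_congr fun l => ?_
      rw [← phase_mul_conj]
      ring
    have e3 : Q j x * (starRingEnd ℂ) (Q j x) = (‖Q j x‖ : ℂ) ^ 2 := Complex.mul_conj' _
    have e4 : phase (ξ - freq lam ε j) x = 1 := by
      rw [sub_self]
      simp [phase]
    rw [e4, mul_one, e3, ← e2] at e1
    change _ = (‖Q j x‖ : ℂ) ^ 2 * (u x * v x) + R x at e1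
    simp only [hF'', hH]
    rw [ht.Veps_eq_conj x, Veff]
    linear_combination e1
  -- integrability
  have hγ' : β - 2 * a ≤ β + (-a + -a) := by linarith
  have wF := ((ht.coeff j).mul (hu.mul hv)).weaken hγ'
  have wF' := (((ht.coeff₁ j).mul (hu.mul hv)).add ((ht.coeff j).mul
    ((hu'.mul hv).add (hu.mul hv')))).weaken hγ'
  have hmm : ∀ x, ‖u x * v x‖ ≤ m ^ 2 * Real.exp (2 * a * |x|) := by
    intro x
    rw [norm_mul]
    have h1 := hu.bound x
    have h2 := hv.bound x
    refine (mul_le_mul h1 h2 (norm_nonneg _) ((norm_nonneg _).trans h1)).trans (le_of_eq ?_)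
    rw [show 2 * a * |x| = -(-a) * |x| + -(-a) * |x| by ring, Real.exp_add]
    ring
  have hQuv : ∀ x, ‖Q j x * (u x * v x)‖ ≤ n j * m ^ 2 * Real.exp (-(β - 2 * a) * |x|) := by
    intro x
    rw [norm_mul]
    have h1 := (ht.coeff j).bound x
    refine (mul_le_mul h1 (hmm x) (norm_nonneg _) ((norm_nonneg _).trans h1)).trans (le_of_eq ?_)
    rw [show -(β - 2 * a) * |x| = -β * |x| + 2 * a * |x| by ring, Real.exp_add]
    ring
  have iF : Integrable (fun x => Q j x * (u x * v x)) :=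
    integrable_of_norm_le_exp hγ wF.continuous wF.bound
  have ip : ∀ {f : ℝ → ℂ}, Integrable f → Integrable (fun x => f x * phase ξ x) := fun {f} hf =>
    hf.mul_bdd (c := 1) hpc.aestronglyMeasurable (ae_of_all _ fun x => (norm_phase ξ x).le)
  have iH : Integrable (fun x => H x * phase ξ x) :=
    ip (integrable_of_norm_le_exp hγ hslow.continuous hslow.bound)
  -- This term is `O(ε²)` by size alone; one power of `ε` suffices.
  have bS : ∀ x, ‖(sigmaEff Q lam ε x : ℂ) * (Q j x * (u x * v x)) * phase ξ x‖
      ≤ |ε| * (n j * (N ^ 2 / θ ^ 2 * m ^ 2)) * Real.exp (-(β - 2 * a) * |x|) := by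
    intro x
    rw [norm_mul, norm_phase, mul_one, norm_mul]
    have h1 : ‖(sigmaEff Q lam ε x : ℂ)‖ ≤ |ε| * (N ^ 2 / θ ^ 2) := by
      refine (ht.norm_sigmaEff_le x).trans ?_
      have h2 := ht.exp_le_one x
      have h3 : |ε| ^ 2 ≤ |ε| := by
        have := ht.eps_le_one
        have := ht.eps_pos
        nlinarith
      calc |ε| ^ 2 / θ ^ 2 * N ^ 2 * Real.exp (-β * |x|) ≤ |ε| ^ 2 / θ ^ 2 * N ^ 2 * 1 := by gcongr
        _ ≤ |ε| / θ ^ 2 * N ^ 2 * 1 := by gcongr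
        _ = _ := by ring
    refine (mul_le_mul h1 (hQuv x) (norm_nonneg _) (by positivity)).trans (le_of_eq ?_)
    ring
  have iS : Integrable (fun x => (sigmaEff Q lam ε x : ℂ) * (Q j x * (u x * v x)) * phase ξ x) :=
    integrable_of_norm_le_exp hγ (by fun_prop) bS
  have iD : Integrable (fun x => (‖Q j x‖ : ℂ) ^ 2 * (u x * v x)) := by
    refine integrable_of_norm_le_exp (L := n j * (n j * m ^ 2)) hγ (by fun_prop) fun x => ?_
    have h1 := ht.norm_coeff_le j x
    have h2 : ‖(‖Q j x‖ : ℂ) ^ 2 * (u x * v x)‖ = ‖Q j x‖ * ‖Q j x * (u x * v x)‖ := by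
      rw [norm_mul, norm_mul (Q j x), norm_pow, Complex.norm_real, norm_norm]
      ring
    rw [h2]
    refine (mul_le_mul h1 (hQuv x) (norm_nonneg _) hnj).trans (le_of_eq ?_)
    ring
  have cF'' : Continuous F'' := by
    have h1 := (ht.coeff₁ j).continuous
    have h2 := (ht.coeff₂ j).continuous
    have h3 := hu'.continuous
    have h4 := hv'.continuous
    have h5 : Continuous (Veff P Q lam ε) := ht.average.continuous.add hσc
    have h6 := ht.continuous_Veps
    fun_prop
  have iF'' : Integrable F'' := by
    have hA0 : 0 ≤ 2 * N + N ^ 2 / θ ^ 2 := by positivity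
    have t1 := ((ht.coeff₂ j).mul (hu.mul hv)).weaken hγ'
    have t2 := ((ht.coeff₁ j).mul ((hu'.mul hv).add (hu.mul hv'))).weaken hγ'
    have t4 := ((ht.coeff j).mul (hu'.mul hv')).weaken hγ'
    have i1 := integrable_of_norm_le_exp hγ t1.continuous t1.bound
    have i2 := integrable_of_norm_le_exp hγ t2.continuous t2.bound
    have i4 := integrable_of_norm_le_exp hγ t4.continuous t4.bound
    have i3 : Integrable (fun x => Q j x * (u x * v x)
        * (Veff P Q lam ε x + Veps P Q lam ε x - 2 * k ^ 2)) := by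
      refine iF.mul_bdd (c := (2 * N + N ^ 2 / θ ^ 2) + (2 * N + N ^ 2 / θ ^ 2) + 2 * B ^ 2)
        (Continuous.aestronglyMeasurable ?_) (ae_of_all _ fun x => ?_)
      · have h5 : Continuous (Veff P Q lam ε) := ht.average.continuous.add hσc
        have h6 := ht.continuous_Veps
        fun_prop
      · have h1 := ht.exp_le_one x
        have h2 := (ht.norm_Veff_le x).trans (mul_le_of_le_one_right hA0 h1)
        have h3 := (ht.norm_Veps_le x).trans (mul_le_of_le_one_right hA0 h1)
        refine (norm_sub_le _ _).trans (add_le_add ((norm_add_le _ _).trans (add_le_add h2 h3)) ?_)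
        rw [norm_mul, norm_pow, Complex.norm_ofNat]
        gcongr
    have := ((i1.add (i2.const_mul 2)).add i3).add (i4.const_mul 2)
    refine this.congr (ae_of_all _ fun x => ?_)
    simp only [Pi.add_apply, hF'']
    ring
  -- Integrability of the nonresonant series is read off from `split`, all other terms being
  -- integrable.
  have iR : Integrable R := by
    have e : R = fun x => F'' x * phase ξ x - H x * phase ξ x
        - (sigmaEff Q lam ε x : ℂ) * (Q j x * (u x * v x)) * phase ξ x
        - (‖Q j x‖ : ℂ) ^ 2 * (u x * v x) := by
      funext x
      rw [split x]
      ring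
    rw [e]
    exact (((ip iF'').sub iH).sub iS).sub iD
  have ibp := integral_mul_phase_eq hd hd' iF
    (integrable_of_norm_le_exp hγ wF'.continuous wF'.bound) iF'' hξ0
  have hsplit : ∫ x, F'' x * phase ξ x = (∫ x, H x * phase ξ x)
      + (∫ x, (sigmaEff Q lam ε x : ℂ) * (Q j x * (u x * v x)) * phase ξ x)
      + (∫ x, (‖Q j x‖ : ℂ) ^ 2 * (u x * v x)) + ∫ x, R x := by
    have i₁ : Integrable (fun x => H x * phase ξ x
        + (sigmaEff Q lam ε x : ℂ) * (Q j x * (u x * v x)) * phase ξ x) := iH.add iS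
    have i₂ : Integrable (fun x => H x * phase ξ x
        + (sigmaEff Q lam ε x : ℂ) * (Q j x * (u x * v x)) * phase ξ x
        + (‖Q j x‖ : ℂ) ^ 2 * (u x * v x)) := i₁.add iD
    simp only [split]
    rw [integral_add i₂ iR, integral_add i₁ iD, integral_add iH iS]
  -- The resonant contribution `-ξ⁻² ∫ |Q_j|² u v` cancels against the effective potential; this
  -- dictates the form of `Λ_eff`.
  have hfin : ∫ x, (Q j x * phase ξ x + 1 / (ξ : ℂ) ^ 2 * (‖Q j x‖ : ℂ) ^ 2) * (u x * v x)
      = -(1 / (ξ : ℂ) ^ 2) * ((∫ x, H x * phase ξ x)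
        + (∫ x, (sigmaEff Q lam ε x : ℂ) * (Q j x * (u x * v x)) * phase ξ x) + ∫ x, R x) := by
    have e1 : ∫ x, (Q j x * phase ξ x + 1 / (ξ : ℂ) ^ 2 * (‖Q j x‖ : ℂ) ^ 2) * (u x * v x)
        = (∫ x, Q j x * (u x * v x) * phase ξ x)
          + 1 / (ξ : ℂ) ^ 2 * ∫ x, (‖Q j x‖ : ℂ) ^ 2 * (u x * v x) := by
      rw [← integral_const_mul, ← integral_add (ip iF) (iD.const_mul _)]
      refine integral_congr_ae (ae_of_all _ fun x => ?_)
      ring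
    rw [e1, ibp, hsplit]
    ring
  rw [hfin, norm_mul, norm_neg, norm_div, norm_one, norm_pow, Complex.norm_real,
    Real.norm_eq_abs, sq_abs]
  have n1 : ‖∫ x, H x * phase ξ x‖
      ≤ |ε| * (n j * ((63 + 54 * (N + B ^ 2)) * m ^ 2 / θ * I)) := by
    refine hslowi.trans ?_
    have : 0 ≤ n j * ((63 + 54 * (N + B ^ 2)) * m ^ 2) := by positivity
    calc n j * ((63 + 54 * (N + B ^ 2)) * m ^ 2) * (Real.pi / |ξ|) * I
        ≤ n j * ((63 + 54 * (N + B ^ 2)) * m ^ 2) * (|ε| / θ) * I := by gcongr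
      _ = _ := by ring
  have n2 := norm_integral_le_exp hγ bS
  have n3 : ‖(∫ x, H x * phase ξ x)
        + (∫ x, (sigmaEff Q lam ε x : ℂ) * (Q j x * (u x * v x)) * phase ξ x) + ∫ x, R x‖
      ≤ |ε| * (n j * (((63 + 54 * (N + B ^ 2)) * m ^ 2 / θ + N ^ 2 / θ ^ 2 * m ^ 2
          + 27 * N * m ^ 2 / θ) * I)) := by
    refine (norm_add_le _ _).trans ((add_le_add (norm_add_le _ _) le_rfl).trans ?_)
    refine (add_le_add (add_le_add n1 n2) hnon).trans (le_of_eq ?_)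
    ring
  refine (mul_le_mul hfreq n3 (norm_nonneg _) (by positivity)).trans (le_of_eq ?_)
  ring

/-- Summation of the single-mode estimate: its bound is linear in `n j`, and `∑ n j ≤ N`. -/
lemma norm_integral_Veps_sub_Veff_le :
    ‖∫ x, (Veps P Q lam ε x - Veff P Q lam ε x) * (u x * v x)‖
      ≤ |ε| ^ 3 * homogenizationConstant θ β a N B m := by
  have hN := ht.N_nonneg
  have hθ := ht.theta_pos
  have hβ := ht.beta_pos.le
  have huc := hu.continuous
  have hvc := hv.continuous
  have hmm : ∀ x, ‖u x * v x‖ ≤ m ^ 2 * Real.exp (2 * a * |x|) := by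
    intro x
    rw [norm_mul]
    have h1 := hu.bound x
    have h2 := hv.bound x
    refine (mul_le_mul h1 h2 (norm_nonneg _) ((norm_nonneg _).trans h1)).trans (le_of_eq ?_)
    rw [show 2 * a * |x| = -(-a) * |x| + -(-a) * |x| by ring, Real.exp_add]
    ring
  have e : ∀ x, (Veps P Q lam ε x - Veff P Q lam ε x) * (u x * v x)
      = ∑' j, (Q j x * phase (freq lam ε j) x
        + 1 / (freq lam ε j : ℂ) ^ 2 * (‖Q j x‖ : ℂ) ^ 2) * (u x * v x) := by
    intro x
    have s2 : Summable (fun j => 1 / (freq lam ε j : ℂ) ^ 2 * (‖Q j x‖ : ℂ) ^ 2) :=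
      Summable.of_norm_bounded ((ht.summable.mul_left _).mul_right _) fun j => ht.norm_term_le j x
    rw [tsum_mul_right, (ht.summable_coeff_mul_phase x).tsum_add s2, Veps_eq, Veff, ht.sigmaEff_eq]
    ring
  simp only [e]
  set D := ((63 + 54 * (N + B ^ 2)) * m ^ 2 / θ + N ^ 2 / θ ^ 2 * m ^ 2
          + 27 * N * m ^ 2 / θ) * ∫ x, Real.exp (-(β - 2 * a) * |x|) with hD
  have hD0 : 0 ≤ D := by
    have : 0 ≤ ∫ x, Real.exp (-(β - 2 * a) * |x|) := integral_nonneg fun y => (Real.exp_pos _).le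
    positivity
  have hB : HasSum (fun j => |ε| ^ 3 / θ ^ 2 * n j * D) (|ε| ^ 3 / θ ^ 2 * (∑' j, n j) * D) :=
    (ht.summable.hasSum.mul_left _).mul_right _
  refine (norm_integral_tsum_le hγ (p := fun j => (1 + |ε| ^ 2 / θ ^ 2 * N) * m ^ 2 * n j)
    (fun j => ?_) (fun j x => ?_) (ht.summable.mul_left _) (fun j =>
      ht.norm_integral_mode_le hγ hk hu hu' hv hv' su su' sv sv' j) hB).trans ?_
  · have h1 := ht.continuous_coeff j
    have h2 := continuous_phase (freq lam ε j)
    fun_prop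
  · rw [norm_mul]
    have h1 : ‖Q j x * phase (freq lam ε j) x + 1 / (freq lam ε j : ℂ) ^ 2 * (‖Q j x‖ : ℂ) ^ 2‖
        ≤ (1 + |ε| ^ 2 / θ ^ 2 * N) * n j * Real.exp (-β * |x|) := by
      refine (norm_add_le _ _).trans ((add_le_add (ht.norm_coeff_mul_phase_le j x)
        (ht.norm_term_le j x)).trans (le_of_eq ?_))
      ring
    refine (mul_le_mul h1 (hmm x) (norm_nonneg _) ((norm_nonneg _).trans h1)).trans (le_of_eq ?_)
    rw [show -(β - 2 * a) * |x| = -β * |x| + 2 * a * |x| by ring, Real.exp_add]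
    ring
  · have := ht.tsum_le
    unfold homogenizationConstant
    rw [← hD]
    calc |ε| ^ 3 / θ ^ 2 * (∑' j, n j) * D ≤ |ε| ^ 3 / θ ^ 2 * N * D := by gcongr
      _ = _ := by ring

end Estimate

include ht

/-- The homogenization estimate for regular two-scale potentials. -/
theorem norm_kOverT_sub_le {α a B : ℝ} (hα : 0 < α) (hαa : α < a) (hγ : 0 < β - 2 * a) {k : ℂ}
    (hk : |k.im| ≤ α) (hB : ‖k‖ ≤ B) :
    ‖kOverT (Veff P Q lam ε) k - kOverT (Veps P Q lam ε) k‖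
      ≤ |ε| ^ 3 * homogenizationConstant θ β a N B (solutionLipschitz a (2 * N + N ^ 2 / θ ^ 2) B
        (solutionBound α a β (2 * N + N ^ 2 / θ ^ 2) B)) := by
  have h₁ := ht.jostSetting_Veff hα.le hαa hγ
  have h₂ := ht.jostSetting_Veps hα.le hαa hγ
  have hN := ht.N_nonneg
  have hA0 : 0 ≤ 2 * N + N ^ 2 / θ ^ 2 := by positivity
  have b₁ : ∀ x, ‖Veff P Q lam ε x‖ ≤ 2 * N + N ^ 2 / θ ^ 2 := fun x =>
    (ht.norm_Veff_le x).trans (mul_le_of_le_one_right hA0 (ht.exp_le_one x))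
  have b₂ : ∀ x, ‖Veps P Q lam ε x‖ ≤ 2 * N + N ^ 2 / θ ^ 2 := fun x =>
    (ht.norm_Veps_le x).trans (mul_le_of_le_one_right hA0 (ht.exp_le_one x))
  have p := h₁.jostPlus_solution hk hB
  have q := h₂.jostMinus_solution hk hB
  have ha := (hα.trans hαa).le
  obtain ⟨wp, wp'⟩ := p.weightedLipschitz ha b₁ hB
  obtain ⟨wq, wq'⟩ := q.weightedLipschitz ha b₂ hB
  -- `u` is `f_+` for the effective potential and `v` is `f_-` for the oscillatory one, the pair in
  -- the perturbation formula.
  have key := ht.norm_integral_Veps_sub_Veff_le hγ hB wp wp' wq wq' p.hasDerivAt p.hasDerivAt'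
    q.hasDerivAt q.hasDerivAt'
  rw [(JostSetting.jostWronskian_sub h₁ h₂ hk).2] at key
  rw [h₁.kOverT_eq hα hk, h₂.kOverT_eq hα hk, ← mul_sub, norm_mul, norm_sub_rev, norm_div,
    Complex.norm_I, Complex.norm_ofNat]
  linarith [norm_nonneg (jostWronskian (Veps P Q lam ε) k - jostWronskian (Veff P Q lam ε) k)]

end RegularTwoScale

/-! ### Regular representatives of two-scale potentials -/

lemma ae_norm_le_of_weightedSupNorm_le {β : ℝ} {g : ℝ → ℂ} {c : ℝ≥0∞} (hc : c ≠ ⊤)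
    (h : weightedSupNorm β g ≤ c) : ∀ᵐ x, ‖g x‖ ≤ c.toReal * Real.exp (-β * |x|) := by
  unfold weightedSupNorm at h
  rw [eLpNorm_exponent_top] at h
  filter_upwards [ae_le_eLpNormEssSup (f := fun x : ℝ => (Real.exp (β * |x|) : ℂ) * g x)
    (μ := volume)] with x hx
  have h1 := ENNReal.toReal_mono hc (hx.trans h)
  rw [toReal_enorm, norm_mul, Complex.norm_real, Real.norm_of_nonneg (Real.exp_pos _).le] at h1
  rw [neg_mul, Real.exp_neg, ← div_eq_mul_inv, le_div_iff₀ (Real.exp_pos _), mul_comm]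
  exact h1

lemma exists_weakDeriv_of_norm_lt {β : ℝ} {m : ℕ} {g : ℝ → ℂ} {c : ℝ≥0∞} (hc : c ≠ ⊤)
    (h : weightedSobolevNorm β m g < c) : ∃ D : ℕ → ℝ → ℂ, ∀ l ≤ m, HasWeakDeriv l g (D l) ∧
      ∀ᵐ x, ‖D l x‖ ≤ c.toReal * Real.exp (-β * |x|) := by
  unfold weightedSobolevNorm at h
  simp only [iInf_lt_iff] at h
  obtain ⟨D, hD, hlt⟩ := h
  refine ⟨D, fun l hl => ?_⟩
  have hm : l ∈ Finset.range (m + 1) := Finset.mem_range.2 (Nat.lt_succ_of_le hl)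
  exact ⟨hD l hm, ae_norm_le_of_weightedSupNorm_le hc ((Finset.single_le_sum
    (f := fun l => weightedSupNorm β (D l)) (fun _ _ => zero_le) hm).trans hlt.le)⟩

lemma exists_rep_of_norm_one_lt {β : ℝ} (hβ : 0 ≤ β) {g : ℝ → ℂ} {c : ℝ≥0∞} (hc : c ≠ ⊤)
    (h : weightedSobolevNorm β 1 g < c) :
    ∃ P : ℝ → ℂ, g =ᵐ[volume] P ∧ WeightedLipschitz β (Real.exp β * c.toReal) P := by
  obtain ⟨D, hD⟩ := exists_weakDeriv_of_norm_lt hc h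
  obtain ⟨w0, b0⟩ := hD 0 (by norm_num)
  obtain ⟨w1, b1⟩ := hD 1 le_rfl
  obtain ⟨P, e, hP, -, -⟩ := exists_weightedLipschitz_rep ENNReal.toReal_nonneg hβ w0 w1 b0 b1
  exact ⟨P, w0.ae_eq.trans e, hP⟩

/-- Each derivative of order at most two is represented by the primitive of the next; the third one,
merely bounded, makes the second Lipschitz. -/
lemma exists_rep_of_norm_three_lt {β : ℝ} (hβ : 0 ≤ β) {g : ℝ → ℂ} {c : ℝ≥0∞} (hc : c ≠ ⊤)
    (h : weightedSobolevNorm β 3 g < c) :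
    ∃ Q Q₁ Q₂ : ℝ → ℂ, g =ᵐ[volume] Q ∧ WeightedLipschitz β (Real.exp β * c.toReal) Q ∧
      WeightedLipschitz β (Real.exp β * c.toReal) Q₁ ∧
      WeightedLipschitz β (Real.exp β * c.toReal) Q₂ ∧
      (∀ x, HasDerivAt Q (Q₁ x) x) ∧ ∀ x, HasDerivAt Q₁ (Q₂ x) x := by
  obtain ⟨D, hD⟩ := exists_weakDeriv_of_norm_lt hc h
  obtain ⟨w0, b0⟩ := hD 0 (by norm_num)
  obtain ⟨w1, b1⟩ := hD 1 (by norm_num)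
  obtain ⟨w2, b2⟩ := hD 2 (by norm_num)
  obtain ⟨w3, b3⟩ := hD 3 le_rfl
  obtain ⟨Q, e, hQ, -, d⟩ := exists_weightedLipschitz_rep ENNReal.toReal_nonneg hβ w0 w1 b0 b1
  obtain ⟨Q₁, e₁, hQ₁, -, d₁⟩ := exists_weightedLipschitz_rep ENNReal.toReal_nonneg hβ w1 w2 b1 b2
  obtain ⟨Q₂, e₂, hQ₂, -, -⟩ := exists_weightedLipschitz_rep ENNReal.toReal_nonneg hβ w2 w3 b2 b3
  exact ⟨Q, Q₁, Q₂, w0.ae_eq.trans e, hQ, hQ₁, hQ₂, d Q₁ hQ₁.continuous e₁,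
    d₁ Q₂ hQ₂.continuous e₂⟩

lemma exists_regularTwoScale {θ β : ℝ} (hθ : 0 < θ) (hβ : 0 < β) {qav : ℝ → ℂ} {q : NZ → ℝ → ℂ}
    {lam : NZ → ℝ} (h : HypothesesV θ β qav q lam) :
    ∃ (P : ℝ → ℂ) (Q Q₁ Q₂ : NZ → ℝ → ℂ) (n : NZ → ℝ), qav =ᵐ[volume] P ∧
      (∀ j, q j =ᵐ[volume] Q j) ∧ ∀ ε : ℝ, 0 < |ε| → |ε| ≤ 1 → |ε| ≤ 2 * θ →
        RegularTwoScale θ β (Real.exp β * ((tripleNorm β qav q).toReal + 1)) ε P Q Q₁ Q₂ lam n := by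
  have hfin := h.norm_finite.ne
  set T := tripleNorm β qav q with hT
  set w : NZ → ℝ≥0∞ := fun j => weightedSobolevNorm β 3 (q j) with hw
  have hw0 : weightedSobolevNorm β 1 qav ≤ T := le_self_add
  have hwT : ∑' j, w j ≤ T := le_add_self
  -- The Sobolev norm is an infimum, so each `q_j` is given a margin `δ j`; the margins sum to less
  -- than `1`, whence the `+ 1` in the constant.
  obtain ⟨δ, hδ0, hδ⟩ := ENNReal.exists_pos_sum_of_countable one_ne_zero NZ
  have hsum : ∑' j, (w j + δ j) ≤ T + 1 := by
    rw [ENNReal.tsum_add]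
    exact add_le_add hwT hδ.le
  have hT1 : T + 1 ≠ ⊤ := ENNReal.add_ne_top.2 ⟨hfin, ENNReal.one_ne_top⟩
  have hsum_ne : ∑' j, (w j + δ j) ≠ ⊤ := ne_top_of_le_ne_top hT1 hsum
  have hne : ∀ j, w j + δ j ≠ ⊤ := ENNReal.ne_top_of_tsum_ne_top hsum_ne
  have hT1r : (T + 1).toReal = T.toReal + 1 := by
    rw [ENNReal.toReal_add hfin ENNReal.one_ne_top, ENNReal.toReal_one]
  have hlt : ∀ j, w j < w j + δ j := fun j =>
    ENNReal.lt_add_right (ENNReal.add_ne_top.1 (hne j)).1 (by exact_mod_cast (hδ0 j).ne')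
  obtain ⟨P, eP, hP⟩ := exists_rep_of_norm_one_lt hβ.le hT1
    (hw0.trans_lt (ENNReal.lt_add_right hfin one_ne_zero))
  rw [hT1r] at hP
  choose Q Q₁ Q₂ eQ hQ hQ₁ hQ₂ d d₁ using fun j =>
    exists_rep_of_norm_three_lt hβ.le (hne j) (hlt j)
  refine ⟨P, Q, Q₁, Q₂, fun j => Real.exp β * (w j + δ j).toReal, eP, eQ, fun ε h0 h1 h2 =>
    ⟨hθ, hβ, h0, h1, h2, hP, hQ, hQ₁, hQ₂, d, d₁, (ENNReal.summable_toReal hsum_ne).mul_left _, ?_,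
      h.separated, h.away_from_zero, ?_⟩⟩
  · rw [tsum_mul_left, ← ENNReal.tsum_toReal_eq hne, ← hT1r]
    gcongr
  · filter_upwards [h.real_valued, eP, ae_all_iff.2 eQ] with x hx hxP hxQ
    have := hx (x / ε)
    unfold twoScale at this
    unfold Veps twoScale
    simpa only [← hxP, ← hxQ] using this

lemma Veps_ae_eq {qav P : ℝ → ℂ} {q Q : NZ → ℝ → ℂ} (eP : qav =ᵐ[volume] P)
    (eQ : ∀ j, q j =ᵐ[volume] Q j) (lam : NZ → ℝ) (ε : ℝ) :
    Veps qav q lam ε =ᵐ[volume] Veps P Q lam ε := by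
  filter_upwards [eP, ae_all_iff.2 eQ] with x hxP hxQ
  unfold Veps twoScale
  simp only [hxP, hxQ]

lemma Veff_ae_eq {qav P : ℝ → ℂ} {q Q : NZ → ℝ → ℂ} (eP : qav =ᵐ[volume] P)
    (eQ : ∀ j, q j =ᵐ[volume] Q j) (lam : NZ → ℝ) (ε : ℝ) :
    Veff qav q lam ε =ᵐ[volume] Veff P Q lam ε := by
  filter_upwards [eP, ae_all_iff.2 eQ] with x hxP hxQ
  unfold Veff sigmaEff LambdaEff
  simp only [hxP, hxQ]

end Scattering

end

/-! ### Assembly of the main theorem. -/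

theorem mainTheorem1 (θ β α : ℝ) (hθ : 0 < θ) (hα : 0 < α) (hαβ : α < β / 2) :
    ∃ C : ℝ → ℝ → ℝ,
      ∀ (qav : ℝ → ℂ) (q : Scattering.NZ → ℝ → ℂ) (lam : Scattering.NZ → ℝ),
        Scattering.HypothesesV θ β qav q lam →
        ∀ K : Set ℂ, Scattering.HypothesesK α qav K →
          ∃ ε₀ : ℝ, 0 < ε₀ ∧ ∀ ε : ℝ, 0 < |ε| → |ε| < ε₀ → ∀ k ∈ K,
            ‖Scattering.kOverT (Scattering.Veff qav q lam ε) k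
                - Scattering.kOverT (Scattering.Veps qav q lam ε) k‖
              ≤ |ε| ^ 3 * Scattering.MK qav K
                * C (Scattering.tripleNorm β qav q).toReal (sSup ((fun k : ℂ => ‖k‖) '' K)) := by
  have hαa : α < (α + β / 2) / 2 := by linarith
  have hγ : 0 < β - 2 * ((α + β / 2) / 2) := by linarith
  -- The weight exponent is the midpoint of `α` and `β/2`: above `α` to absorb the linear growth of
  -- the kernel, below `β/2` to keep the integrals convergent.
  obtain ⟨a, ha⟩ : ∃ a, a = (α + β / 2) / 2 := ⟨_, rfl⟩
  rw [← ha] at hαa hγ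
  refine ⟨fun T s => Scattering.homogenizationConstant θ β a (Real.exp β * (T + 1)) s
    (Scattering.solutionLipschitz a
      (2 * (Real.exp β * (T + 1)) + (Real.exp β * (T + 1)) ^ 2 / θ ^ 2) s
      (Scattering.solutionBound α a β
        (2 * (Real.exp β * (T + 1)) + (Real.exp β * (T + 1)) ^ 2 / θ ^ 2) s)), ?_⟩
  intro qav q lam hV K hK
  obtain ⟨P, Q, Q₁, Q₂, n, eP, eQ, hreg⟩ :=
    Scattering.exists_regularTwoScale hθ (by linarith) hV
  -- The threshold `1` makes the amplitude of `σ_eff` independent of `ε`, and `2θ` makes the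
  -- half-periods at most `1`.
  refine ⟨min 1 (2 * θ), lt_min one_pos (by linarith), fun ε h0 hε k hk => ?_⟩
  have ht := hreg ε h0 (hε.le.trans (min_le_left _ _)) (hε.le.trans (min_le_right _ _))
  have hB : ‖k‖ ≤ sSup ((fun k : ℂ => ‖k‖) '' K) :=
    le_csSup (hK.compact.image continuous_norm).bddAbove ⟨k, hk, rfl⟩
  have key := ht.norm_kOverT_sub_le hα hαa hγ (hK.strip k hk).le hB
  rw [Scattering.kOverT_congr_ae (Scattering.Veps_ae_eq eP eQ lam ε),
    Scattering.kOverT_congr_ae (Scattering.Veff_ae_eq eP eQ lam ε)]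
  -- The estimate holds without `M_K`, which may be inserted since it is at least `1`.
  have hM : 1 ≤ Scattering.MK qav K := le_max_left _ _
  have h3 : 0 < |ε| ^ 3 := by positivity
  have hC := nonneg_of_mul_nonneg_right ((norm_nonneg _).trans key) h3
  refine key.trans (mul_le_mul_of_nonneg_right ?_ hC)
  exact le_mul_of_one_le_right h3.le hM
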